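/- **Setting.** Let $d\ge 1$ and let $X_1,X_2,\dots$ be i.i.d. random vectors in $\mathbb R^d$ with density $f$. Assume that $f$ vanishes off a convex compact set $C$, that $0<a_1\le f\le a_2<\infty$ on $C$, and that $f$ is differentiable on $C$ with uniformly bounded first order partial derivatives. Let $Q=\{1,\dots,2^d-1\}$, let $j_0\in\mathbb N$, and let $\varphi,\psi^{(q)}:\mathbb R^d\to\mathbb R$ ($q\in Q$) be bounded functions with compact support. For $\phi:\mathbb R^d\to\mathbb R$ write $\phi_{j,z}(x)=2^{dj/2}\phi(2^jx-z)$, and assume that $\{\varphi_{j_0,z},\psi^{(q)}_{j,z}: j\ge j_0,\ z\in\mathbb Z^d,\ q\in Q\}$ is an orthonormal basis of $L_2(\mathbb R^d)$. For $1\le k<n$ let $R_{(k);i}$ be the Euclidean distance from $X_i$ to its $k$-th nearest neighbour among the other points of $\{X_1,\dots,X_n\}$, let $V_{(k);i}=c_0R_{(k);i}^d$ with $c_0=\pi^{d/2}/\Gamma(d/2+1)$, and put $$\hat\alpha_{j,z}=\frac{\Gamma(k)}{\Gamma(k+1/2)}\frac1{\sqrt n}\sum_{i=1}^n\varphi_{j,z}(X_i)\sqrt{V_{(k);i}},\qquad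 \hat\beta^{(q)}_{j,z}=\frac{\Gamma(k)}{\Gamma(k+1/2)}\frac1{\sqrt n}\sum_{i=1}^n\psi^{(q)}_{j,z}(X_i)\sqrt{V_{(k);i}},$$ $$\hat g_J(x)=\sum_{z\in\mathbb Z^d}\hat\alpha_{J+1,z}\,\varphi_{J+1,z}(x),\qquad K_j(x,y)=\sum_{z\in\mathbb Z^d}\varphi_{j,z}(x)\varphi_{j,z}(y),\qquad K_jh(x)=\int_{\mathbb R^d}K_j(x,y)h(y)\,dy .$$ **Proposition.** There is a constant $\kappa<\infty$ depending only on $d$ such that, in every setting as above, the following holds. (0) For every $J\ge j_0$ and almost every $x\in\mathbb R^d$, almost surely, for all $n$ and $k$, $$\hat g_J(x)=\sum_{z}\hat\alpha_{j_0,z}\varphi_{j_0,z}(x)+\sum_{j=j_0}^J\sum_z\sum_{q\in Q}\hat\beta^{(q)}_{j,z}\psi^{(q)}_{j,z}(x).$$ Moreover, let $k=k_n\ge1$ be integers with $k^{3/2}\,\Gamma(k)/\Gamma(k+1/2)=o(n^{1/2})$ (for instance $k$ fixed), and let $J\ge j_0$ be fixed. For all large $n$ and all $x\in C$ the variable $\hat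 g_J(x)$ is square integrable, and, as $n\to\infty$, uniformly in $x\in C$: (i) $\displaystyle \mathbb E(\hat g_J(x))=K_{J+1}\sqrt f(x)+O\big((k/n)^{1/d}\big)$; in particular the remainder is $O(n^{-1/d})$ when $k$ is fixed; (ii) $\displaystyle \Big(\frac{\Gamma(k+1/2)}{\Gamma(k)}\Big)^2\frac n{k^3}\operatorname{Var}(\hat g_J(x))\le\kappa\int_{\mathbb R^d}K_{J+1}^2(x,y)\,dy+O(n^{-1/d})$. (iii) (Consistency.) For every $x\in C$, $\hat g_J(x)\to K_{J+1}\sqrt f(x)$ in probability as $n\to\infty$. Furthermore, for almost every $x\in C$, $\hat g_J(x)$ is consistent for $\sqrt f(x)$ when first $n\to\infty$ and then $J\to\infty$: for every $\varepsilon>0$ there is $J_0$ such that $\lim_{n\to\infty}\mathbb P(|\hat g_J(x)-\sqrt f(x)|\ge\varepsilon)=0$ for all $J\ge J_0$. -/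

import Mathlib

open MeasureTheory ProbabilityTheory Filter Topology Asymptotics

noncomputable section

namespace WaveletKNN

/-- The Euclidean space `ℝ^d`. -/
abbrev E (d : ℕ) : Type := EuclideanSpace ℝ (Fin d)

/-- The index set `Q` of the mother wavelets, of cardinality `2 ^ d - 1`. -/
abbrev Q (d : ℕ) : Type := Fin (2 ^ d - 1)

/-- An integer vector, seen as a point of `ℝ^d`. -/
def latticePoint {d : ℕ} (z : Fin d → ℤ) : E d := WithLp.toLp 2 (fun i => (z i : ℝ))

/-- The rescaled and translated function `φ_{j,z}(x) = 2^{dj/2} φ(2^j x - z)`. -/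
def dilate {d : ℕ} (φ : E d → ℝ) (j : ℕ) (z : Fin d → ℤ) (x : E d) : ℝ :=
  (2 : ℝ) ^ ((d : ℝ) * (j : ℝ) / 2) * φ ((2 : ℝ) ^ j • x - latticePoint z)

/-- Indices of the wavelet system: `z` for the father wavelets at the basic level, and
`(m, z, q)` for the mother wavelets at level `j₀ + m`. -/
abbrev WaveletIndex (d : ℕ) : Type := (Fin d → ℤ) ⊕ (ℕ × (Fin d → ℤ) × Q d)

/-- The system `{φ_{j₀,z}, ψ^{(q)}_{j,z} : j ≥ j₀, z ∈ ℤ^d, q ∈ Q}`. -/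
def waveletFamily {d : ℕ} (j₀ : ℕ) (φ : E d → ℝ) (ψ : Q d → E d → ℝ) :
    WaveletIndex d → E d → ℝ
  | Sum.inl z => dilate φ j₀ z
  | Sum.inr (m, z, q) => dilate (ψ q) (j₀ + m) z

/-- The wavelets are bounded and compactly supported, and the wavelet system
is an orthonormal (Hilbert) basis of `L²(ℝ^d)`. -/
structure WaveletAssumption {d : ℕ} (j₀ : ℕ) (φ : E d → ℝ) (ψ : Q d → E d → ℝ) : Prop where
  father_compact : HasCompactSupport φ
  mother_compact : ∀ q, HasCompactSupport (ψ q)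
  father_bounded : ∃ M : ℝ, ∀ x, |φ x| ≤ M
  mother_bounded : ∀ q, ∃ M : ℝ, ∀ x, |ψ q x| ≤ M
  basis : ∃ b : HilbertBasis (WaveletIndex d) ℝ (Lp ℝ 2 (volume : Measure (E d))),
    ∀ i, (b i : E d → ℝ) =ᵐ[volume] waveletFamily j₀ φ ψ i

/-- The density `f` has convex compact support `C`, is bounded and bounded away from `0` on `C`,
and is differentiable on `C` with uniformly bounded first order partial derivatives. -/
structure DensityAssumption {d : ℕ} (f : E d → ℝ) (C : Set (E d)) : Prop where
  convex : Convex ℝ C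
  compact : IsCompact C
  zero_off : ∀ x, x ∉ C → f x = 0
  lower : ∃ a₁ : ℝ, 0 < a₁ ∧ ∀ x ∈ C, a₁ ≤ f x
  upper : ∃ a₂ : ℝ, ∀ x ∈ C, f x ≤ a₂
  differentiable : DifferentiableOn ℝ f C
  partials : ∃ M : ℝ, ∀ x ∈ C, ∀ i : Fin d,
    |fderivWithin ℝ f C x (EuclideanSpace.single i (1 : ℝ))| ≤ M

/-- `X 0, X 1, …` are independent random vectors, each with density `f`. -/
structure SampleAssumption {d : ℕ} {Ω : Type*} [MeasurableSpace Ω] (P : Measure Ω)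
    (X : ℕ → Ω → E d) (f : E d → ℝ) : Prop where
  measurable : ∀ i, Measurable (X i)
  indep : iIndepFun X P
  law : ∀ i, P.map (X i) = (volume : Measure (E d)).withDensity (fun x => ENNReal.ofReal (f x))

open Classical in
/-- `R_{(k);i}`: the distance from `x i` to its `k`-th closest point among the other points,
that is, the least `r` such that at least `k` other points are within distance `r` of `x i`
(meaningful for `1 ≤ k < n`). -/
def knnDist {d n : ℕ} (k : ℕ) (x : Fin n → E d) (i : Fin n) : ℝ :=
  sInf {r : ℝ | k ≤ (Finset.univ.filter (fun j => j ≠ i ∧ dist (x j) (x i) ≤ r)).card}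

/-- The volume `c₀ = π^{d/2} / Γ(d/2 + 1)` of the unit ball of `ℝ^d`. -/
def unitBallVolume (d : ℕ) : ℝ :=
  Real.pi ^ ((d : ℝ) / 2) / Real.Gamma ((d : ℝ) / 2 + 1)

/-- `V_{(k);i} = c₀ R_{(k);i}^d`. -/
def knnVolume {d n : ℕ} (k : ℕ) (x : Fin n → E d) (i : Fin n) : ℝ :=
  unitBallVolume d * knnDist k x i ^ d

/-- The ratio `Γ(k) / Γ(k + 1/2)`. -/
def gammaRatio (k : ℕ) : ℝ := Real.Gamma (k : ℝ) / Real.Gamma ((k : ℝ) + 1 / 2)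

/-- The estimated coefficient of `√f` on `φ_{j,z}` (or on `ψ^{(q)}_{j,z}`, for `φ = ψ q`). -/
def coefEstimator {d n : ℕ} (φ : E d → ℝ) (k : ℕ) (x : Fin n → E d) (j : ℕ)
    (z : Fin d → ℤ) : ℝ :=
  gammaRatio k * (1 / √(n : ℝ)) * ∑ i, dilate φ j z (x i) * √(knnVolume k x i)

/-- The estimator `ĝ_J(y) = ∑_z α̂_{J+1,z} φ_{J+1,z}(y)`, from the sample points `x`. -/
def sqrtEstimator {d n : ℕ} (φ : E d → ℝ) (J k : ℕ) (x : Fin n → E d) (y : E d) : ℝ :=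
  ∑' z : Fin d → ℤ, coefEstimator φ k x (J + 1) z * dilate φ (J + 1) z y

/-- The multiscale form of the estimator: the trend at level `j₀` and the
details at levels `j₀, …, J`. -/
def sqrtEstimatorMultiscale {d n : ℕ} (j₀ : ℕ) (φ : E d → ℝ) (ψ : Q d → E d → ℝ) (J k : ℕ)
    (x : Fin n → E d) (y : E d) : ℝ :=
  ∑' z : Fin d → ℤ, coefEstimator φ k x j₀ z * dilate φ j₀ z y
    + ∑ j ∈ Finset.Icc j₀ J, ∑' z : Fin d → ℤ, ∑ q : Q d,
        coefEstimator (ψ q) k x j z * dilate (ψ q) j z y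

/-- The first `n` points of the sample. -/
def sample {d : ℕ} {Ω : Type*} (X : ℕ → Ω → E d) (n : ℕ) (ω : Ω) : Fin n → E d :=
  fun i => X i ω

/-- The wavelet approximating kernel `K_j(x,y) = ∑_z φ_{j,z}(x) φ_{j,z}(y)`. -/
def kernel {d : ℕ} (φ : E d → ℝ) (j : ℕ) (x y : E d) : ℝ :=
  ∑' z : Fin d → ℤ, dilate φ j z x * dilate φ j z y

/-- The kernel operator `K_j h (x) = ∫ K_j(x,y) h(y) dy`. -/
def kernelOp {d : ℕ} (φ : E d → ℝ) (j : ℕ) (h : E d → ℝ) (x : E d) : ℝ :=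
  ∫ y, kernel φ j x y * h y

end WaveletKNN

end

/-! By `sqrtEstimator_eq` the estimator at `x` is Γ(k)/Γ(k+1/2) · n^(-1/2) times the sum of w(X_i)
√V_i with the weight w = K_{J+1}(x, ·). Part (0) is therefore an identity between kernels, and (i)
and (ii) concern the first two moments of `knnSum k w`, to be bounded through the sup norm and the
L² norm of w alone. That makes the bounds uniform in `x`.

Mean. Let U be the f-mass of the ball about X_i that reaches to its k-th neighbour. Given X_i = y, U
is distributed as the k-th order statistic of n - 1 uniform variables, whatever y is, so its moments
are Gamma quotients (`IsOrderLaw.integral_rpow`). The product f(y)V equals U up to a relative error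
of order U^(1/d), except when y lies within a distance of order U^(1/d) of the complement of C,
where the relative error is only bounded (`exists_massError`). As C is convex, this layer has volume
O(U^(1/d)). On average f E√V = √f E√(fV) is thus close to √f E√U, and the normalisation turns E√U
into Γ(n)/Γ(n+1/2) = n^(-1/2)(1 + O(1/n)). The bias is of order (k/n)^(1/d).

Variance. The Efron–Stein inequality is applied with the same sum over the sample with one point
deleted. A covering of the sphere by narrow cones shows that a point lies strictly inside the
neighbour balls of at most γk others, with γ depending on d only (`exists_card_lt_knnDist_le`); only
those terms change. By Cauchy–Schwarz the squared change is at most 1 + γk times a sum of terms w²V: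
the deleted point's own, of mean about (k/n)∫w², and those of the affected points. A given point is
affected with conditional probability at most U, so these contribute about n E(w²VU), that is
(k²/n)∫w². Summing over n deletions gives the order k³∫w². The error terms carry the supremum of w²,
which for w = K_{J+1}(x, ·) is at most a constant times ∫w² (`kernel_sq_le_integral`); they are
absorbed into κ.

Kernel identity. The wavelet basis stays orthonormal under dyadic rescaling. Hence mothers of level
at least j₀ + m are orthogonal both to the fathers of level j₀ + m and to all lower wavelets, and
these two families expand into each other with transposed coefficients. Compact supports make all
the sums finite, so the kernels agree off a null set (`ae_kernel_eq`).

Consistency. For fixed J this is Chebyshev's inequality, the growth condition on k being exactly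
what makes the variance bound vanish. For J → ∞ one needs K_j √f → √f at interior points of C, hence
∫ K_j(x, y) dy = 1. This is not assumed. The function K_0 1 is periodic and K_j 1(x) = K_0 1(2^j x),
so its deviation from 1 in mean square over the unit cube is bounded by the L² error of the
expansion of the indicator of a ball, which tends to 0 (`ae_kernelOp_one_eq`). -/

noncomputable section

namespace WaveletKNN

/-! ### Order statistics of a real vector -/

/-- The number of coordinates of `v` that are at most `r`. -/
def countLE {m : ℕ} (v : Fin m → ℝ) (r : ℝ) : ℕ := (Finset.univ.filter (fun j => v j ≤ r)).card

/-- The `k`-th smallest coordinate of `v`. -/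
def kthValue {m : ℕ} (k : ℕ) (v : Fin m → ℝ) : ℝ := sInf {r : ℝ | k ≤ countLE v r}

lemma countLE_mono {m : ℕ} (v : Fin m → ℝ) : Monotone (countLE v) := fun _ _ h =>
  Finset.card_le_card (Finset.monotone_filter_right _ fun _ _ hj => le_trans hj h)

/-- Trading the count for a witnessing set of coordinates writes sublevel sets as finite unions of
finite intersections, which makes closedness and measurability immediate. -/
lemma le_countLE_iff {m k : ℕ} (v : Fin m → ℝ) (r : ℝ) :
    k ≤ countLE v r ↔ ∃ A : Finset (Fin m), k ≤ A.card ∧ ∀ j ∈ A, v j ≤ r := by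
  constructor
  · intro h
    exact ⟨_, h, fun j hj => (Finset.mem_filter.1 hj).2⟩
  · rintro ⟨A, hA, h⟩
    exact hA.trans (Finset.card_le_card fun j hj => by simp [h j hj])

lemma isClosed_le_countLE {m k : ℕ} (v : Fin m → ℝ) : IsClosed {r : ℝ | k ≤ countLE v r} := by
  have : {r : ℝ | k ≤ countLE v r} =
      ⋃ A ∈ {A : Finset (Fin m) | k ≤ A.card}, ⋂ j ∈ A, Set.Ici (v j) := by
    ext r
    simp [le_countLE_iff]
  rw [this]
  exact (Set.toFinite _).isClosed_biUnion fun A _ => isClosed_biInter fun j _ => isClosed_Ici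

/-- The infimum is attained: the set is closed, nonempty because `k ≤ m`, and bounded below because
`1 ≤ k`. This equivalence is the main handle on the infimum. -/
lemma kthValue_le_iff {m k : ℕ} (hk : 1 ≤ k) (hkm : k ≤ m) (v : Fin m → ℝ) (r : ℝ) :
    kthValue k v ≤ r ↔ k ≤ countLE v r := by
  have hne : {r : ℝ | k ≤ countLE v r}.Nonempty := by
    refine ⟨∑ j, |v j|, (le_countLE_iff _ _).2 ⟨Finset.univ, by simpa using hkm, fun j _ => ?_⟩⟩
    exact (le_abs_self _).trans
      (Finset.single_le_sum (f := fun j => |v j|) (fun _ _ => abs_nonneg _) (Finset.mem_univ j))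
  have hbd : BddBelow {r : ℝ | k ≤ countLE v r} := by
    refine ⟨-∑ j, |v j|, fun s hs => ?_⟩
    obtain ⟨A, hA, h⟩ := (le_countLE_iff _ _).1 hs
    obtain ⟨j, hj⟩ := Finset.card_pos.1 (hk.trans hA)
    have h1 := Finset.single_le_sum (f := fun j => |v j|) (fun _ _ => abs_nonneg _)
      (Finset.mem_univ j)
    have h2 := h j hj
    have h3 := neg_abs_le (v j)
    linarith
  constructor
  · intro h
    have := (isClosed_le_countLE v).csInf_mem hne hbd
    exact le_trans this (countLE_mono v h)
  · intro h
    exact csInf_le hbd h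

lemma measurable_kthValue {m k : ℕ} (hk : 1 ≤ k) (hkm : k ≤ m) :
    Measurable (kthValue k : (Fin m → ℝ) → ℝ) := by
  refine measurable_of_Iic fun r => ?_
  have : kthValue k ⁻¹' Set.Iic r = ⋃ A ∈ {A : Finset (Fin m) | k ≤ A.card},
      ⋂ j ∈ A, {v : Fin m → ℝ | v j ≤ r} := by
    ext v
    simp [kthValue_le_iff hk hkm, le_countLE_iff]
  rw [this]
  exact (Set.toFinite _).measurableSet_biUnion fun A _ =>
    A.measurableSet_biInter fun j _ => measurableSet_le (measurable_pi_apply j) measurable_const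

lemma kthValue_le {m k : ℕ} (hk : 1 ≤ k) (hkm : k ≤ m) {v : Fin m → ℝ} {D : ℝ}
    (h : ∀ j, v j ≤ D) : kthValue k v ≤ D :=
  (kthValue_le_iff hk hkm v D).2
    ((le_countLE_iff _ _).2 ⟨Finset.univ, by simpa using hkm, fun j _ => h j⟩)

lemma kthValue_nonneg {m k : ℕ} (hk : 1 ≤ k) {v : Fin m → ℝ}
    (h : ∀ j, 0 ≤ v j) : 0 ≤ kthValue k v := by
  refine Real.sInf_nonneg fun r hr => ?_
  obtain ⟨A, hA, hr⟩ := (le_countLE_iff _ _).1 hr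
  obtain ⟨j, hj⟩ := Finset.card_pos.1 (hk.trans hA)
  exact (h j).trans (hr j hj)

/-! ### Nearest neighbour distances -/

open Classical in
/-- The number of the other points within distance `r` of `x i`. -/
def knnCount {d n : ℕ} (x : Fin n → E d) (i : Fin n) (r : ℝ) : ℕ :=
  (Finset.univ.filter (fun j => j ≠ i ∧ dist (x j) (x i) ≤ r)).card

lemma knnCount_eq_countLE {d m : ℕ} (x : Fin (m + 1) → E d) (i : Fin (m + 1)) (r : ℝ) :
    knnCount x i r = countLE (fun j => dist (x (i.succAbove j)) (x i)) r := by
  classical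
  rw [knnCount, countLE, Finset.card_filter, Finset.card_filter, Fin.sum_univ_succAbove _ i]
  simp [Fin.succAbove_ne]

lemma knnDist_eq_kthValue {d m : ℕ} (k : ℕ) (x : Fin (m + 1) → E d) (i : Fin (m + 1)) :
    knnDist k x i = kthValue k (fun j => dist (x (i.succAbove j)) (x i)) := by
  simp only [kthValue, ← knnCount_eq_countLE]
  rfl

lemma knnDist_le_iff {d m k : ℕ} (hk : 1 ≤ k) (hkm : k ≤ m) (x : Fin (m + 1) → E d)
    (i : Fin (m + 1)) (r : ℝ) : knnDist k x i ≤ r ↔ k ≤ knnCount x i r := by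
  rw [knnDist_eq_kthValue, kthValue_le_iff hk hkm, knnCount_eq_countLE]

lemma knnDist_nonneg {d m k : ℕ} (hk : 1 ≤ k) (x : Fin (m + 1) → E d)
    (i : Fin (m + 1)) : 0 ≤ knnDist k x i := by
  rw [knnDist_eq_kthValue]
  exact kthValue_nonneg hk fun _ => dist_nonneg

lemma knnCount_succAbove {d m : ℕ} (x : Fin (m + 1) → E d) (a : Fin (m + 1)) (i : Fin m) (r : ℝ) :
    knnCount x (a.succAbove i) r = (if dist (x a) (x (a.succAbove i)) ≤ r then 1 else 0)
      + knnCount (fun j => x (a.succAbove j)) i r := by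
  classical
  rw [knnCount, knnCount, Finset.card_filter, Finset.card_filter, Fin.sum_univ_succAbove _ a]
  simp [Fin.ne_succAbove]

lemma knnDist_succAbove_le {d m k : ℕ} (hk : 1 ≤ k) (hkm : k ≤ m) (x : Fin (m + 1 + 1) → E d)
    (a : Fin (m + 1 + 1)) (i : Fin (m + 1)) :
    knnDist k x (a.succAbove i) ≤ knnDist k (fun j => x (a.succAbove j)) i := by
  rw [knnDist_le_iff hk (by omega), knnCount_succAbove]
  exact ((knnDist_le_iff hk hkm _ _ _).1 le_rfl).trans (Nat.le_add_left _ _)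

/-- At a radius below the distance computed without `x a`, the point `x a` is not counted, so
restoring it cannot bring the count up to `k`. -/
lemma knnDist_succAbove_eq {d m k : ℕ} (hk : 1 ≤ k) (hkm : k ≤ m) (x : Fin (m + 1 + 1) → E d)
    (a : Fin (m + 1 + 1)) (i : Fin (m + 1))
    (h : knnDist k (fun j => x (a.succAbove j)) i ≤ dist (x a) (x (a.succAbove i))) :
    knnDist k x (a.succAbove i) = knnDist k (fun j => x (a.succAbove j)) i := by
  refine le_antisymm (knnDist_succAbove_le hk hkm x a i) ?_
  by_contra hlt
  push Not at hlt
  have h1 := (knnDist_le_iff hk (by omega) x (a.succAbove i) _).1 le_rfl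
  rw [knnCount_succAbove, if_neg (by linarith), zero_add, ← knnDist_le_iff hk hkm] at h1
  linarith

/-- Two vectors in a common narrow cone: the shorter one is closer to the longer one than the
apex is. -/
lemma norm_sub_le_of_same_cone {V : Type*} [NormedAddCommGroup V] [InnerProductSpace ℝ V]
    {u v c : V} (hu : ‖u‖ = 1) (hv : ‖v‖ = 1) (huc : ‖u - c‖ ≤ 1 / 2) (hvc : ‖v - c‖ ≤ 1 / 2)
    {s t : ℝ} (hs : 0 ≤ s) (hst : s ≤ t) : ‖s • u - t • v‖ ≤ t := by
  have h1 : ‖u - v‖ ≤ 1 := by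
    have := norm_sub_le_norm_sub_add_norm_sub u c v
    rw [norm_sub_rev c v] at this
    linarith
  have h2 : ‖u - v‖ ^ 2 = 2 - 2 * inner ℝ u v := by
    rw [norm_sub_sq_real, hu, hv]; ring
  have h3 : 1 / 2 ≤ inner ℝ u v := by nlinarith [norm_nonneg (u - v)]
  have h4 : ‖s • u - t • v‖ ^ 2 = s ^ 2 + t ^ 2 - 2 * (s * t * inner ℝ u v) := by
    rw [norm_sub_sq_real, norm_smul, norm_smul, hu, hv, inner_smul_left, inner_smul_right]
    simp
    ring
  have h5 : ‖s • u - t • v‖ ^ 2 ≤ t ^ 2 := by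
    rw [h4]
    nlinarith [mul_nonneg hs (hs.trans hst)]
  exact le_of_sq_le_sq h5 (hs.trans hst)

/-- A point is among the `k` nearest neighbours of at most `γ k` other points. -/
theorem exists_card_lt_knnDist_le (d : ℕ) : ∃ γ : ℕ, ∀ (m k : ℕ), 1 ≤ k → k ≤ m →
    ∀ (x : Fin (m + 1) → E d) (p : E d),
      (Finset.univ.filter (fun i => dist p (x i) < knnDist k x i)).card ≤ γ * k := by
  classical
  -- Two directions in the same ball of radius 1/2 are at distance at most 1. There is one cone for
  -- each centre in `t`; the extra one in `t.card + 1` accounts for sample points equal to `p`.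
  obtain ⟨t, -, ht, hcov⟩ := (isCompact_sphere (0 : E d) 1).finite_cover_balls
    (e := 1 / 2) (by norm_num)
  obtain ⟨t, rfl⟩ := ht.exists_finset_coe
  refine ⟨t.card + 1, fun m k hk hkm x p => ?_⟩
  set S := Finset.univ.filter (fun i => dist p (x i) < knnDist k x i) with hS
  -- in a family in which some point is at least as close to all the others as `p` is,
  -- there are at most `k` members
  have key : ∀ A : Finset (Fin (m + 1)), A ⊆ S →
      (∀ i ∈ A, ∀ j ∈ A, dist p (x j) ≤ dist p (x i) → dist (x j) (x i) ≤ dist p (x i)) →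
      A.card ≤ k := by
    intro A hA h
    rcases A.eq_empty_or_nonempty with rfl | hne
    · simp
    -- Every other member of `A` is within `dist p (x i)` of the farthest point `x i`, and since
    -- this is strictly below its k-th neighbour distance, there are fewer than `k` of them.
    obtain ⟨i, hi, hmax⟩ := A.exists_max_image (fun i => dist p (x i)) hne
    have h1 : knnCount x i (dist p (x i)) < k := by
      by_contra hcon
      push Not at hcon
      have h2 := (knnDist_le_iff hk hkm x i _).2 hcon
      have h3 := (Finset.mem_filter.1 (hA hi)).2
      linarith
    have h2 : (A.erase i).card ≤ knnCount x i (dist p (x i)) := by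
      refine Finset.card_le_card fun j hj => ?_
      rw [Finset.mem_erase] at hj
      simp [hj.1, h i hi j hj.2 (hmax j hj.2)]
    rw [Finset.card_erase_of_mem hi] at h2
    omega
  let cone : E d → Finset (Fin (m + 1)) := fun c => S.filter (fun i =>
    x i ≠ p ∧ ‖(‖x i - p‖)⁻¹ • (x i - p) - c‖ ≤ 1 / 2)
  let apex : Finset (Fin (m + 1)) := S.filter (fun i => x i = p)
  have hsub : S ⊆ apex ∪ t.biUnion cone := by
    intro i hi
    by_cases hp : x i = p
    · exact Finset.mem_union_left _ (by simp [apex, hi, hp])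
    · have hn : ‖x i - p‖ ≠ 0 := by simpa [sub_eq_zero] using hp
      have hmem : (‖x i - p‖)⁻¹ • (x i - p) ∈ Metric.sphere (0 : E d) 1 := by
        simp [norm_smul, hn]
      obtain ⟨c, hc, hic⟩ := Set.mem_iUnion₂.1 (hcov hmem)
      refine Finset.mem_union_right _ (Finset.mem_biUnion.2 ⟨c, hc, ?_⟩)
      rw [Metric.mem_ball, dist_eq_norm] at hic
      exact Finset.mem_filter.2 ⟨hi, hp, hic.le⟩
  have hapex : apex.card ≤ k := by
    refine key _ (Finset.filter_subset _ _) fun i hi j hj _ => ?_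
    rw [(Finset.mem_filter.1 hi).2, (Finset.mem_filter.1 hj).2]
  have hcone : ∀ c ∈ t, (cone c).card ≤ k := by
    intro c _
    refine key _ (Finset.filter_subset _ _) fun i hi j hj hij => ?_
    obtain ⟨-, hip, hic⟩ := Finset.mem_filter.1 hi
    obtain ⟨-, hjp, hjc⟩ := Finset.mem_filter.1 hj
    have hi0 : ‖x i - p‖ ≠ 0 := by simpa [sub_eq_zero] using hip
    have hj0 : ‖x j - p‖ ≠ 0 := by simpa [sub_eq_zero] using hjp
    rw [dist_comm p, dist_comm p, dist_eq_norm, dist_eq_norm] at hij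
    rw [dist_comm p, dist_eq_norm, dist_eq_norm]
    have := norm_sub_le_of_same_cone (by simp [norm_smul, hj0]) (by simp [norm_smul, hi0])
      hjc hic (norm_nonneg (x j - p)) hij
    rwa [smul_inv_smul₀ hj0, smul_inv_smul₀ hi0, sub_sub_sub_cancel_right] at this
  calc S.card ≤ (apex ∪ t.biUnion cone).card := Finset.card_le_card hsub
    _ ≤ apex.card + ∑ c ∈ t, (cone c).card :=
        (Finset.card_union_le _ _).trans (Nat.add_le_add_left Finset.card_biUnion_le _)
    _ ≤ k + ∑ c ∈ t, k := Nat.add_le_add hapex (Finset.sum_le_sum hcone)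
    _ = (t.card + 1) * k := by simp; ring

/-! ### The law of the uniform order statistics -/

/-- The probability that fewer than `k` out of `m` independent events of probability `p` occur. -/
def binomialTail (m k : ℕ) (p : ℝ) : ℝ :=
  ∑ i ∈ Finset.range k, (m.choose i : ℝ) * (p ^ i * (1 - p) ^ (m - i))

/-- The event splits according to the exact set `A` of coordinates at which `h ≤ r`. Each piece is a
box, whose product measure depends only on the size of `A`. -/
lemma measureReal_pi_card_lt {α : Type*} [MeasurableSpace α] (μ : Measure α)
    [IsProbabilityMeasure μ] {h : α → ℝ} (hh : Measurable h) (r : ℝ) {m k : ℕ} (hkm : k ≤ m) :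
    (Measure.pi fun _ : Fin m => μ).real {z | countLE (fun j => h (z j)) r < k}
      = binomialTail m k (μ.real {a | h a ≤ r}) := by
  classical
  set B := {a | h a ≤ r} with hB
  have hBm : MeasurableSet B := measurableSet_le hh measurable_const
  set p := μ.real B with hp
  let F : Finset (Fin m) → Set (Fin m → α) := fun A =>
    Set.univ.pi fun j => if j ∈ A then B else Bᶜ
  have hF : ∀ A z, z ∈ F A ↔ Finset.univ.filter (fun j => h (z j) ≤ r) = A := by
    intro A z
    simp only [F, Set.mem_univ_pi, Finset.ext_iff, Finset.mem_filter, Finset.mem_univ, true_and]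
    refine forall_congr' fun j => ?_
    by_cases hj : j ∈ A <;> simp [hj, hB]
  have hset : {z : Fin m → α | countLE (fun j => h (z j)) r < k} =
      ⋃ A ∈ Finset.univ.filter (fun A : Finset (Fin m) => A.card < k), F A := by
    ext z
    simp [hF, countLE]
  have hFm : ∀ A, (Measure.pi fun _ : Fin m => μ).real (F A)
      = p ^ A.card * (1 - p) ^ (m - A.card) := by
    intro A
    have hc : μ.real Bᶜ = 1 - p := by rw [measureReal_compl hBm]; simp [hp]
    simp only [F, measureReal_def, Measure.pi_pi, ENNReal.toReal_prod]
    have : ∀ j, (μ (if j ∈ A then B else Bᶜ)).toReal = if j ∈ A then p else 1 - p := by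
      intro j
      split_ifs
      · rfl
      · exact hc
    simp only [this]
    rw [Finset.prod_ite]
    simp only [Finset.prod_const]
    congr 2
    · congr 1; ext; simp
    · rw [← Finset.compl_filter, Finset.card_compl, Fintype.card_fin]
      congr 2; ext; simp
  rw [hset, measureReal_biUnion_finset]
  · simp only [hFm]
    have h1 : ∑ A ∈ Finset.univ.filter (fun A : Finset (Fin m) => A.card < k),
        p ^ A.card * (1 - p) ^ (m - A.card)
        = ∑ A ∈ (Finset.univ : Finset (Fin m)).powerset,
          (fun i => if i < k then p ^ i * (1 - p) ^ (m - i) else 0) A.card := by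
      rw [Finset.sum_filter, Finset.powerset_univ]
    rw [h1, Finset.sum_powerset_apply_card
      (fun i => if i < k then p ^ i * (1 - p) ^ (m - i) else 0), binomialTail, Finset.card_univ, Fintype.card_fin]
    rw [← Finset.sum_subset (Finset.range_mono (hkm.trans (Nat.le_succ m)))]
    · refine Finset.sum_congr rfl fun i hi => ?_
      rw [if_pos (Finset.mem_range.1 hi), nsmul_eq_mul]
    · intro i _ hi
      rw [if_neg (by simpa using hi), smul_zero]
  · intro A _ A' _ hAA'
    refine Set.disjoint_left.2 fun z hz hz' => hAA' ?_
    rw [← (hF A z).1 hz, ← (hF A' z).1 hz']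
  · intro A _
    refine MeasurableSet.univ_pi fun j => ?_
    split_ifs
    · exact hBm
    · exact hBm.compl

/-- Quantiles of an atomless law. -/
lemma exists_quantile (ν : Measure ℝ) [IsProbabilityMeasure ν] [NullSingletonClass ν]
    {a : ℝ} (ha : ν (Set.Iic a) = 0) {t : ℝ} (ht0 : 0 ≤ t) (ht1 : t < 1) :
    ∃ r₀, ν.real (Set.Iic r₀) = t ∧ ∀ r, ν.real (Set.Iic r) ≤ t ↔ r ≤ r₀ := by
  have hcont : Continuous (cdf ν) := by
    rw [continuous_iff_continuousAt]
    intro x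
    rw [(monotone_cdf ν).continuousAt_iff_leftLim_eq_rightLim, (cdf ν).rightLim_eq]
    have h1 : (cdf ν).measure {x} = 0 := by rw [measure_cdf]; simp
    rw [StieltjesFunction.measure_singleton, ENNReal.ofReal_eq_zero] at h1
    exact le_antisymm ((monotone_cdf ν).leftLim_le le_rfl) (by linarith)
  simp only [← cdf_eq_real]
  -- The largest quantile is chosen: it gives the equivalence with `r ≤ r₀` even where the
  -- distribution function is flat at height `t`.
  set A := {r | cdf ν r ≤ t} with hA
  have hne : A.Nonempty := ⟨a, by simp [hA, cdf_eq_real, measureReal_def, ha, ht0]⟩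
  obtain ⟨b, hb⟩ := ((tendsto_cdf_atTop ν).eventually (lt_mem_nhds ht1)).exists
  have hbd : BddAbove A := ⟨b, fun r hr => by
    by_contra hcon
    push Not at hcon
    exact absurd (monotone_cdf ν hcon.le) (not_le.2 (lt_of_le_of_lt hr hb))⟩
  have hcl : IsClosed A := isClosed_le hcont continuous_const
  have hmem : cdf ν (sSup A) ≤ t := hcl.csSup_mem hne hbd
  have hiff : ∀ r, cdf ν r ≤ t ↔ r ≤ sSup A := fun r =>
    ⟨fun h => le_csSup hbd h, fun h => (monotone_cdf ν h).trans hmem⟩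
  refine ⟨sSup A, le_antisymm hmem ?_, hiff⟩
  refine ge_of_tendsto (hcont.continuousWithinAt (s := Set.Ioi (sSup A)) (x := sSup A)) ?_
  filter_upwards [self_mem_nhdsWithin] with r hr
  by_contra hcon
  push Not at hcon
  exact absurd ((hiff r).1 hcon.le) (not_le.2 hr)

section UniformOrderStatistic

variable {α : Type*} [MeasurableSpace α] {μ : Measure α} [IsProbabilityMeasure μ]
  {h : α → ℝ}

/-- The tail of the `k`-th order statistic of a sample transformed to the uniform law. -/
lemma measureReal_lt_cdf_kthValue (hh : Measurable h) (hnn : ∀ a, 0 ≤ h a)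
    (hat : ∀ r, μ {a | h a = r} = 0) {m k : ℕ} (hk : 1 ≤ k) (hkm : k ≤ m) {t : ℝ}
    (ht0 : 0 ≤ t) (ht1 : t < 1) :
    (Measure.pi fun _ : Fin m => μ).real
      {z | t < μ.real {a | h a ≤ kthValue k (fun j => h (z j))}} = binomialTail m k t := by
  set ν := μ.map h with hν
  have : IsProbabilityMeasure ν := Measure.isProbabilityMeasure_map hh.aemeasurable
  have : NullSingletonClass ν := ⟨fun r => by
    rw [hν, Measure.map_apply hh (measurableSet_singleton r)]; exact hat r⟩
  have hνr : ∀ r, ν.real (Set.Iic r) = μ.real {a | h a ≤ r} := fun r => by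
    rw [hν, map_measureReal_apply hh measurableSet_Iic]; rfl
  -- Any negative point would do; it makes the set defining the quantile nonempty.
  have hν0 : ν (Set.Iic (-1)) = 0 := by
    rw [hν, Measure.map_apply hh measurableSet_Iic]
    convert measure_empty (μ := μ)
    ext a
    have := hnn a
    simp only [Set.mem_preimage, Set.mem_Iic, Set.mem_empty_iff_false, iff_false, not_le]
    linarith
  obtain ⟨r₀, hr₀, hiff⟩ := exists_quantile ν hν0 ht0 ht1
  rw [← hr₀, hνr, ← measureReal_pi_card_lt μ hh r₀ hkm]
  congr 1
  ext z
  simp only [Set.mem_ofPred_eq]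
  -- The transformed order statistic exceeds `t` exactly when the order statistic exceeds `r₀`, that
  -- is, when fewer than `k` values are at most `r₀`.
  rw [← not_le, ← not_le, ← kthValue_le_iff hk hkm, ← hiff, ← hνr, ← hνr, hr₀]

lemma measurable_cdf_comp (h : α → ℝ) : Measurable fun r : ℝ => μ.real {a | h a ≤ r} :=
  Monotone.measurable fun _ _ hrs => measureReal_mono fun _ ha => le_trans ha hrs

lemma measurable_cdf_kthValue (hh : Measurable h) {m k : ℕ} (hk : 1 ≤ k) (hkm : k ≤ m) :
    Measurable fun z : Fin m → α => μ.real {a | h a ≤ kthValue k (fun j => h (z j))} :=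
  (measurable_cdf_comp h).comp ((measurable_kthValue hk hkm).comp
    (measurable_pi_lambda _ fun j => hh.comp (measurable_pi_apply j)))

end UniformOrderStatistic

/-! ### Beta integrals and the moments of order statistics -/

lemma lintegral_rpow_mul_one_sub_rpow {a b : ℝ} (ha : 0 < a) (hb : 0 < b) :
    ∫⁻ t in Set.Ioo (0 : ℝ) 1, ENNReal.ofReal (t ^ (a - 1) * (1 - t) ^ (b - 1))
      = ENNReal.ofReal (beta a b) := by
  have h1 := lintegral_betaPDF_eq_one ha hb
  rw [lintegral_betaPDF] at h1
  have hpos := beta_pos ha hb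
  simp only [mul_assoc, ENNReal.ofReal_mul (one_div_nonneg.2 hpos.le)] at h1
  rw [lintegral_const_mul' _ _ ENNReal.ofReal_ne_top] at h1
  calc _ = ENNReal.ofReal (beta a b) * (ENNReal.ofReal (1 / beta a b) *
        ∫⁻ t in Set.Ioo (0 : ℝ) 1, ENNReal.ofReal (t ^ (a - 1) * (1 - t) ^ (b - 1))) := by
        rw [← mul_assoc, ← ENNReal.ofReal_mul hpos.le, mul_one_div_cancel hpos.ne']
        simp
    _ = _ := by rw [h1, mul_one]

/-- A hockey-stick identity with a real parameter. It collapses the sum of Beta integrals coming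
from a binomial tail into one Gamma quotient. -/
lemma sum_Gamma_div_factorial {s : ℝ} (hs : 0 < s) {k : ℕ} (hk : 1 ≤ k) :
    s * ∑ i ∈ Finset.range k, Real.Gamma (i + s) / (i.factorial : ℝ)
      = Real.Gamma (k + s) / Real.Gamma k := by
  induction k, hk using Nat.le_induction with
  | base =>
    simp only [Finset.range_one, Finset.sum_singleton, Nat.cast_zero, zero_add, Nat.factorial_zero,
      Nat.cast_one, div_one, Real.Gamma_one]
    rw [add_comm, Real.Gamma_add_one hs.ne']
  | succ k hk ih =>
    have hk0 : (0 : ℝ) < k := by exact_mod_cast hk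
    rw [Finset.sum_range_succ, mul_add, ih]
    have h1 : ((k + 1 : ℕ) : ℝ) + s = (k + s) + 1 := by push_cast; ring
    rw [h1, Real.Gamma_add_one (by positivity)]
    have h2 : (k.factorial : ℝ) = k * Real.Gamma k := by
      rw [← Real.Gamma_nat_eq_factorial, Real.Gamma_add_one hk0.ne']
    have h3 : Real.Gamma ((k + 1 : ℕ) : ℝ) = k * Real.Gamma k := by
      push_cast; exact Real.Gamma_add_one hk0.ne'
    rw [h2, h3]
    have := (Real.Gamma_pos_of_pos hk0).ne'
    field_simp

/-- The moments of the `Beta (k, m + 1 - k)` law. -/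
def betaMoment (m k : ℕ) (s : ℝ) : ℝ :=
  Real.Gamma (m + 1) * Real.Gamma (k + s) / (Real.Gamma (m + 1 + s) * Real.Gamma k)

lemma betaMoment_nonneg {m k : ℕ} {s : ℝ} (hs : 0 < s) : 0 ≤ betaMoment m k s := by
  have h1 : 0 ≤ Real.Gamma k := Real.Gamma_nonneg_of_nonneg (Nat.cast_nonneg k)
  unfold betaMoment
  have := Real.Gamma_pos_of_pos (s := (m : ℝ) + 1) (by positivity)
  have := Real.Gamma_pos_of_pos (s := (k : ℝ) + s) (by positivity)
  have := Real.Gamma_pos_of_pos (s := (m : ℝ) + 1 + s) (by positivity)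
  positivity

/-- The i-th binomial term against t^(s-1) is a Beta integral with parameters i + s and m - i + 1,
and `sum_Gamma_div_factorial` adds them up. The left side is the layer-cake formula for the s-th
moment. -/
lemma lintegral_binomialTail {s : ℝ} (hs : 0 < s) {m k : ℕ} (hk : 1 ≤ k) (hkm : k ≤ m) :
    ENNReal.ofReal s * ∫⁻ t in Set.Ioo (0 : ℝ) 1,
      ENNReal.ofReal (binomialTail m k t) * ENNReal.ofReal (t ^ (s - 1))
      = ENNReal.ofReal (betaMoment m k s) := by
  have h1 : ∀ t ∈ Set.Ioo (0 : ℝ) 1,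
      ENNReal.ofReal (binomialTail m k t) * ENNReal.ofReal (t ^ (s - 1))
      = ∑ i ∈ Finset.range k, ENNReal.ofReal (m.choose i : ℝ) *
        ENNReal.ofReal (t ^ ((i + s) - 1) * (1 - t) ^ (((m - i : ℕ) + 1 : ℝ) - 1)) := by
    intro t ht
    have ht0 := ht.1
    have ht1 : 0 < 1 - t := by linarith [ht.2]
    rw [← ENNReal.ofReal_mul (by unfold binomialTail; positivity), binomialTail, Finset.sum_mul,
      ENNReal.ofReal_sum_of_nonneg fun i _ => by positivity]
    refine Finset.sum_congr rfl fun i _ => ?_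
    rw [← ENNReal.ofReal_mul (by positivity)]
    congr 1
    rw [add_sub_assoc, Real.rpow_add ht0, add_sub_cancel_right, Real.rpow_natCast,
      Real.rpow_natCast]
    ring
  rw [setLIntegral_congr_fun measurableSet_Ioo h1, lintegral_finsetSum' _ fun i _ => by fun_prop]
  have h2 : ∀ i ∈ Finset.range k, ∫⁻ t in Set.Ioo (0 : ℝ) 1, ENNReal.ofReal (m.choose i : ℝ) *
        ENNReal.ofReal (t ^ ((i + s) - 1) * (1 - t) ^ (((m - i : ℕ) + 1 : ℝ) - 1))
      = ENNReal.ofReal (Real.Gamma (m + 1) / Real.Gamma (m + 1 + s) *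
          (Real.Gamma (i + s) / (i.factorial : ℝ))) := by
    intro i hi
    have him : i ≤ m := (Finset.mem_range.1 hi).le.trans hkm
    rw [lintegral_const_mul' _ _ ENNReal.ofReal_ne_top,
      lintegral_rpow_mul_one_sub_rpow (by positivity) (by positivity),
      ← ENNReal.ofReal_mul (by positivity), beta, Real.Gamma_nat_eq_factorial,
      Real.Gamma_nat_eq_factorial, Nat.cast_choose ℝ him]
    have h3 : (i : ℝ) + s + (((m - i : ℕ) : ℝ) + 1) = m + 1 + s := by
      rw [Nat.cast_sub him]; ring
    rw [h3]
    have := (Real.Gamma_pos_of_pos (s := (m : ℝ) + 1 + s) (by positivity)).ne'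
    congr 1
    field_simp
  rw [Finset.sum_congr rfl h2, ← ENNReal.ofReal_sum_of_nonneg, ← ENNReal.ofReal_mul hs.le,
    ← Finset.mul_sum]
  · congr 1
    rw [mul_left_comm, sum_Gamma_div_factorial hs hk, betaMoment]
    have := (Real.Gamma_pos_of_pos (s := (m : ℝ) + 1 + s) (by positivity)).ne'
    field_simp
  · intro i _
    have := Real.Gamma_pos_of_pos (s := (m : ℝ) + 1 + s) (by positivity)
    have := Real.Gamma_pos_of_pos (s := (m : ℝ) + 1) (by positivity)
    have := Real.Gamma_pos_of_pos (s := (i : ℝ) + s) (by positivity)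
    positivity

/-- A law on `[0, 1]` with the tail of the `k`-th order statistic of `m` uniform variables. -/
structure IsOrderLaw (ν : Measure ℝ) (m k : ℕ) : Prop where
  prob : IsProbabilityMeasure ν
  mem_Icc : ∀ᵐ u ∂ν, u ∈ Set.Icc (0 : ℝ) 1
  tail : ∀ t ∈ Set.Ico (0 : ℝ) 1, ν.real (Set.Ioi t) = binomialTail m k t

lemma isOrderLaw_map {α : Type*} [MeasurableSpace α] {μ : Measure α} [IsProbabilityMeasure μ]
    {h : α → ℝ} (hh : Measurable h) (hnn : ∀ a, 0 ≤ h a)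
    (hat : ∀ r, μ {a | h a = r} = 0) {m k : ℕ} (hk : 1 ≤ k) (hkm : k ≤ m) :
    IsOrderLaw ((Measure.pi fun _ : Fin m => μ).map
      fun z => μ.real {a | h a ≤ kthValue k (fun j => h (z j))}) m k where
  prob := Measure.isProbabilityMeasure_map (measurable_cdf_kthValue hh hk hkm).aemeasurable
  mem_Icc := by
    refine (ae_map_iff (measurable_cdf_kthValue hh hk hkm).aemeasurable measurableSet_Icc).2 ?_
    exact ae_of_all _ fun z => ⟨measureReal_nonneg, measureReal_le_one⟩
  tail t ht := by
    rw [map_measureReal_apply (measurable_cdf_kthValue hh hk hkm) measurableSet_Ioi]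
    exact measureReal_lt_cdf_kthValue hh hnn hat hk hkm ht.1 ht.2

/-- The tail on [0, 1) and the support determine the distribution function. Consequently the law of
the mass of a neighbour ball is the same for every centre. -/
lemma IsOrderLaw.eq {ν ν' : Measure ℝ} {m k : ℕ} (hν : IsOrderLaw ν m k)
    (hν' : IsOrderLaw ν' m k) : ν = ν' := by
  have := hν.prob
  have := hν'.prob
  refine Measure.ext_of_Iic _ _ fun t => ?_
  have key : ∀ {ν : Measure ℝ}, IsOrderLaw ν m k → ν (Set.Iic t) = ENNReal.ofReal
      (if t < 0 then 0 else if t < 1 then 1 - binomialTail m k t else 1) := by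
    intro ν hν
    have := hν.prob
    rw [← ENNReal.ofReal_toReal (measure_ne_top ν (Set.Iic t))]
    congr 1
    change ν.real (Set.Iic t) = _
    split_ifs with h0 h1
    · rw [measureReal_def, ENNReal.toReal_eq_zero_iff]
      refine Or.inl (measure_mono_null ?_ hν.mem_Icc)
      intro u hu hcon
      have := hcon.1
      simp only [Set.mem_Iic] at hu
      linarith
    · rw [← hν.tail t ⟨not_lt.1 h0, h1⟩, ← Set.compl_Ioi, measureReal_compl measurableSet_Ioi]
      simp
    · have h2 : ν (Set.Iic t) = 1 := by
        refine (mem_ae_iff_prob_eq_one measurableSet_Iic).1 ?_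
        filter_upwards [hν.mem_Icc] with u hu
        exact hu.2.trans (not_lt.1 h1)
      simp [measureReal_def, h2]
  rw [key hν, key hν']

lemma IsOrderLaw.integral_rpow {ν : Measure ℝ} {m k : ℕ} (hν : IsOrderLaw ν m k) (hk : 1 ≤ k)
    (hkm : k ≤ m) {s : ℝ} (hs : 0 < s) : ∫ u, u ^ s ∂ν = betaMoment m k s := by
  have := hν.prob
  have hnn : ∀ᵐ u ∂ν, 0 ≤ u := hν.mem_Icc.mono fun u hu => hu.1
  rw [integral_eq_lintegral_of_nonneg_ae (hnn.mono fun u hu => Real.rpow_nonneg hu s)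
    (by fun_prop), lintegral_rpow_eq_lintegral_meas_lt_mul ν hnn (by fun_prop) hs,
    ← Set.Ioo_union_Ici_eq_Ioi (zero_lt_one (α := ℝ)),
    lintegral_union measurableSet_Ici (Set.disjoint_left.2 fun t h1 h2 => not_lt.2 h2 h1.2)]
  have h1 : ∫⁻ t in Set.Ici (1 : ℝ), ν {a | t < a} * ENNReal.ofReal (t ^ (s - 1)) = 0 := by
    rw [setLIntegral_eq_zero measurableSet_Ici fun t ht => ?_]
    have : ν {a | t < a} = 0 := by
      refine measure_mono_null ?_ hν.mem_Icc
      intro u hu hcon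
      exact absurd (lt_of_le_of_lt (Set.mem_Ici.1 ht) hu) (not_lt.2 hcon.2)
    simp [this]
  have h2 : ∫⁻ t in Set.Ioo (0 : ℝ) 1, ν {a | t < a} * ENNReal.ofReal (t ^ (s - 1))
      = ∫⁻ t in Set.Ioo (0 : ℝ) 1,
        ENNReal.ofReal (binomialTail m k t) * ENNReal.ofReal (t ^ (s - 1)) := by
    refine setLIntegral_congr_fun measurableSet_Ioo fun t ht => ?_
    rw [← hν.tail t ⟨ht.1.le, ht.2⟩, measureReal_def, ENNReal.ofReal_toReal (measure_ne_top _ _)]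
    rfl
  rw [h1, h2, add_zero, lintegral_binomialTail hs hk hkm,
    ENNReal.toReal_ofReal (betaMoment_nonneg hs)]

/-! ### Densities on a convex body -/

/-- The measure with density `f`. -/
def densityMeasure {d : ℕ} (f : E d → ℝ) : Measure (E d) :=
  (volume : Measure (E d)).withDensity (fun x => ENNReal.ofReal (f x))

lemma volume_real_closedBall {d : ℕ} (y : E d) {r : ℝ} (hr : 0 ≤ r) :
    (volume : Measure (E d)).real (Metric.closedBall y r) = unitBallVolume d * r ^ d := by
  have h0 : (0 : ℝ) < Real.Gamma ((d : ℝ) / 2 + 1) := Real.Gamma_pos_of_pos (by positivity)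
  have hpi : √Real.pi ^ d = Real.pi ^ ((d : ℝ) / 2) := by
    rw [Real.sqrt_eq_rpow, ← Real.rpow_natCast, ← Real.rpow_mul Real.pi_pos.le]
    congr 1
    ring
  rcases d with _ | d
  · have : Metric.closedBall y r = {y} :=
      (Set.subsingleton_of_subsingleton).eq_singleton_of_mem (Metric.mem_closedBall_self hr)
    rw [this, measureReal_def, volume_euclideanSpace_eq_dirac]
    simp [unitBallVolume, Subsingleton.elim y 0]
  · rw [measureReal_def, EuclideanSpace.volume_closedBall, Fintype.card_fin, ENNReal.toReal_mul,
      ENNReal.toReal_pow, ENNReal.toReal_ofReal hr, ENNReal.toReal_ofReal (by positivity),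
      unitBallVolume, ← hpi]
    ring

lemma unitBallVolume_pos (d : ℕ) : 0 < unitBallVolume d := by
  unfold unitBallVolume
  have h0 : (0 : ℝ) < Real.Gamma ((d : ℝ) / 2 + 1) := Real.Gamma_pos_of_pos (by positivity)
  have := Real.pi_pos
  positivity

namespace DensityAssumption

variable {d : ℕ} {f : E d → ℝ} {C : Set (E d)}

lemma measurableSet (h : DensityAssumption f C) : MeasurableSet C := h.compact.measurableSet

lemma nonneg (h : DensityAssumption f C) (x : E d) : 0 ≤ f x := by
  by_cases hx : x ∈ C
  · obtain ⟨a, ha, h'⟩ := h.lower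
    exact ha.le.trans (h' x hx)
  · rw [h.zero_off x hx]

lemma measurable (h : DensityAssumption f C) : Measurable f := by
  classical
  have h1 : f = C.piecewise f (fun _ => 0) := by
    funext x
    by_cases hx : x ∈ C
    · simp [hx]
    · simp [hx, h.zero_off x hx]
  rw [h1]
  exact h.differentiable.continuousOn.measurable_piecewise continuousOn_const h.measurableSet

lemma bounded (h : DensityAssumption f C) : ∃ a : ℝ, 0 < a ∧ ∀ x, f x ≤ a := by
  obtain ⟨a, ha⟩ := h.upper
  refine ⟨max a 1, by positivity, fun x => ?_⟩
  by_cases hx : x ∈ C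
  · exact (ha x hx).trans (le_max_left _ _)
  · rw [h.zero_off x hx]; positivity

lemma integrable (h : DensityAssumption f C) : Integrable f := by
  obtain ⟨a, -, ha⟩ := h.bounded
  have h1 : IntegrableOn f C := by
    refine Measure.integrableOn_of_bounded (M := a) h.compact.measure_lt_top.ne
      h.measurable.aestronglyMeasurable (ae_of_all _ fun x => ?_)
    rw [Real.norm_of_nonneg (h.nonneg x)]
    exact ha x
  exact h1.integrable_of_forall_notMem_eq_zero fun x hx => h.zero_off x hx

lemma measureReal (h : DensityAssumption f C) {S : Set (E d)} (hS : MeasurableSet S) :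
    (densityMeasure f).real S = ∫ x in S, f x := by
  rw [measureReal_def, densityMeasure, withDensity_apply _ hS,
    integral_eq_lintegral_of_nonneg_ae (ae_of_all _ h.nonneg)
      h.measurable.aestronglyMeasurable]

lemma integral_densityMeasure (h : DensityAssumption f C) (g : E d → ℝ) :
    ∫ x, g x ∂(densityMeasure f) = ∫ x, f x * g x := by
  rw [densityMeasure, integral_withDensity_eq_integral_toReal_smul (by
    exact h.measurable.ennreal_ofReal) (ae_of_all _ fun _ => ENNReal.ofReal_lt_top)]
  simp [ENNReal.toReal_ofReal (h.nonneg _)]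

lemma ae_mem (h : DensityAssumption f C) : ∀ᵐ x ∂(densityMeasure f), x ∈ C := by
  rw [densityMeasure, ae_withDensity_iff h.measurable.ennreal_ofReal]
  refine ae_of_all _ fun x hx => ?_
  by_contra hC
  simp [h.zero_off x hC] at hx

lemma measure_sphere (hd : 0 < d) (y : E d) (r : ℝ) :
    (densityMeasure f) {x | dist x y = r} = 0 := by
  have : Nonempty (Fin d) := ⟨⟨0, hd⟩⟩
  refine withDensity_absolutelyContinuous _ _ ?_
  exact Measure.addHaar_sphere volume y r

/-- A convex set has a null frontier. If the interior of the closed set `C` were empty, `C` would be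
its own frontier and the probability measure carried by it would vanish. -/
lemma exists_closedBall_subset (h : DensityAssumption f C)
    [IsProbabilityMeasure (densityMeasure f)] :
    ∃ c r₀, 0 < r₀ ∧ Metric.closedBall c r₀ ⊆ C := by
  have hne : (interior C).Nonempty := by
    by_contra hcon
    rw [Set.not_nonempty_iff_eq_empty] at hcon
    have h1 := h.convex.addHaar_frontier volume
    rw [h.compact.isClosed.frontier_eq, hcon, Set.sdiff_empty] at h1
    have h2 : densityMeasure f C = 0 := withDensity_absolutelyContinuous _ _ h1
    have h3 : densityMeasure f Cᶜ = 0 := h.ae_mem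
    have h4 : densityMeasure f Set.univ = 0 := by
      rw [← Set.union_compl_self C]; exact measure_union_null h2 h3
    simp at h4
  obtain ⟨c, hc⟩ := hne
  obtain ⟨r, hr, hsub⟩ := Metric.nhds_basis_closedBall.mem_iff.1 (mem_interior_iff_mem_nhds.1 hc)
  exact ⟨c, r, hr, hsub⟩

lemma exists_dist_le (h : DensityAssumption f C) : ∃ D : ℝ, 0 < D ∧ ∀ x ∈ C, ∀ y ∈ C,
    dist x y ≤ D := by
  obtain ⟨D, hD⟩ := Metric.isBounded_iff.1 h.compact.isBounded
  exact ⟨max D 1, by positivity, fun x hx y hy => (hD hx hy).trans (le_max_left _ _)⟩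

/-- Contracting an inscribed ball towards `y` by the factor r/D keeps it in `C` by convexity and
puts it inside the ball of radius `r` about `y`. No regularity of the boundary is needed. -/
lemma closedBall_lower (h : DensityAssumption f C) [IsProbabilityMeasure (densityMeasure f)]
    {D : ℝ} (hD0 : 0 < D) (hD : ∀ x ∈ C, ∀ y ∈ C, dist x y ≤ D) :
    ∃ c : ℝ, 0 < c ∧ ∀ y ∈ C, ∀ r, 0 ≤ r → r ≤ D →
      c * r ^ d ≤ (densityMeasure f).real (Metric.closedBall y r) := by
  obtain ⟨b, r₀, hr₀, hb⟩ := h.exists_closedBall_subset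
  obtain ⟨a, ha, hfa⟩ := h.lower
  refine ⟨a * (unitBallVolume d * r₀ ^ d) / D ^ d, ?_, fun y hy r hr hrD => ?_⟩
  · have := unitBallVolume_pos d
    positivity
  set t := r / D with ht
  have ht0 : 0 ≤ t := by positivity
  have ht1 : t ≤ 1 := (div_le_one hD0).2 hrD
  set S := AffineMap.homothety y t '' Metric.closedBall b r₀ with hS
  have hScomp : IsCompact S :=
    (isCompact_closedBall b r₀).image (AffineMap.homothety_continuous y t)
  have hS1 : S ⊆ C := by
    rintro _ ⟨x, hx, rfl⟩
    rw [AffineMap.homothety_eq_lineMap]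
    exact h.convex.lineMap_mem hy (hb hx) ⟨ht0, ht1⟩
  have hS2 : S ⊆ Metric.closedBall y r := by
    rintro _ ⟨x, hx, rfl⟩
    rw [Metric.mem_closedBall, dist_homothety_center, Real.norm_of_nonneg ht0]
    calc t * dist y x ≤ t * D := by gcongr; exact hD y hy x (hb hx)
      _ = r := by rw [ht]; field_simp
  have hvol : volume.real S = t ^ d * (unitBallVolume d * r₀ ^ d) := by
    rw [measureReal_def, hS, Measure.addHaar_image_homothety, ENNReal.toReal_mul,
      ENNReal.toReal_ofReal (abs_nonneg _), ← measureReal_def, volume_real_closedBall _ hr₀.le,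
      finrank_euclideanSpace_fin, abs_of_nonneg (by positivity)]
  calc a * (unitBallVolume d * r₀ ^ d) / D ^ d * r ^ d = a * volume.real S := by
        rw [hvol, ht, div_pow]; ring
    _ = ∫ x in S, a := by simp [mul_comm]
    _ ≤ ∫ x in S, f x := by
        refine setIntegral_mono_on (by simp [hScomp.measure_lt_top]) h.integrable.integrableOn
          hScomp.measurableSet fun x hx => hfa x (hS1 hx)
    _ ≤ ∫ x in Metric.closedBall y r, f x :=
        setIntegral_mono_set h.integrable.integrableOn (ae_of_all _ h.nonneg) hS2.eventuallyLE
    _ = _ := (h.measureReal Metric.isClosed_closedBall.measurableSet).symm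

/-- Bounded partial derivatives bound the operator norm of the derivative, and the mean value
inequality applies because `C` is convex. -/
lemma exists_lipschitz (h : DensityAssumption f C) :
    ∃ L : ℝ, 0 ≤ L ∧ ∀ x ∈ C, ∀ y ∈ C, |f x - f y| ≤ L * dist x y := by
  obtain ⟨M, hM⟩ := h.partials
  refine ⟨∑ _i : Fin d, max M 0, by positivity, fun x hx y hy => ?_⟩
  rw [← Real.norm_eq_abs, dist_eq_norm]
  refine h.convex.norm_image_sub_le_of_norm_fderivWithin_le h.differentiable (fun z hz => ?_) hy hx
  refine ContinuousLinearMap.opNorm_le_bound _ (by positivity) fun v => ?_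
  have hv : v = ∑ i, v i • EuclideanSpace.single i (1 : ℝ) := by
    ext j
    simp [Finset.sum_apply, Pi.single_apply]
  calc ‖fderivWithin ℝ f C z v‖
      = ‖∑ i, v i • fderivWithin ℝ f C z (EuclideanSpace.single i (1 : ℝ))‖ := by
        conv_lhs => rw [hv, map_sum]
        simp only [map_smul]
    _ ≤ ∑ i, ‖v i • fderivWithin ℝ f C z (EuclideanSpace.single i (1 : ℝ))‖ := norm_sum_le _ _
    _ ≤ ∑ _i : Fin d, max M 0 * ‖v‖ := by
        refine Finset.sum_le_sum fun i _ => ?_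
        rw [norm_smul, mul_comm]
        exact mul_le_mul ((hM z hz i).trans (le_max_left _ _)) (PiLp.norm_apply_le v i)
          (norm_nonneg _) (le_max_right _ _)
    _ = _ := by rw [Finset.sum_mul]

lemma abs_sub_measureReal_closedBall_le (h : DensityAssumption f C) {L : ℝ}
    (hL : ∀ x ∈ C, ∀ y ∈ C, |f x - f y| ≤ L * dist x y) (hL0 : 0 ≤ L) {y : E d} {r : ℝ} (hr : 0 ≤ r)
    (hsub : Metric.closedBall y r ⊆ C) :
    |f y * (unitBallVolume d * r ^ d) - (densityMeasure f).real (Metric.closedBall y r)|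
      ≤ L * r * (unitBallVolume d * r ^ d) := by
  have hm : MeasurableSet (Metric.closedBall y r) := Metric.isClosed_closedBall.measurableSet
  have hfin : volume (Metric.closedBall y r) < ⊤ := measure_closedBall_lt_top
  rw [h.measureReal hm, ← volume_real_closedBall y hr]
  have h1 : f y * volume.real (Metric.closedBall y r) = ∫ x in Metric.closedBall y r, f y := by
    simp [mul_comm]
  have h2 : Integrable (fun _ => f y) (volume.restrict (Metric.closedBall y r)) :=
    integrableOn_const hfin.ne
  rw [h1, ← integral_sub h2 h.integrable.integrableOn, ← Real.norm_eq_abs]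
  refine norm_setIntegral_le_of_norm_le_const hfin fun x hx => ?_
  rw [Real.norm_eq_abs]
  refine (hL y (hsub (Metric.mem_closedBall_self hr)) x (hsub hx)).trans ?_
  rw [dist_comm]
  exact mul_le_mul_of_nonneg_left hx hL0

lemma nonempty_compl (hd : 0 < d) (h : DensityAssumption f C) : (Cᶜ : Set (E d)).Nonempty := by
  have : Nonempty (Fin d) := ⟨⟨0, hd⟩⟩
  have : NoncompactSpace (E d) := NormedSpace.noncompactSpace ℝ (E d)
  exact Set.nonempty_compl.2 h.compact.ne_univ

/-- The boundary layer of width `ρ` has volume `O(ρ)`. -/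
lemma exists_boundary_layer_le (hd : 0 < d) (h : DensityAssumption f C)
    [IsProbabilityMeasure (densityMeasure f)] :
    ∃ L : ℝ, 0 ≤ L ∧ ∀ ρ, 0 ≤ ρ →
      volume.real {y | y ∈ C ∧ Metric.infDist y Cᶜ < ρ} ≤ L * ρ := by
  obtain ⟨c, r₀, hr₀, hc⟩ := h.exists_closedBall_subset
  have hfin : volume C ≠ ⊤ := h.compact.measure_lt_top.ne
  -- The first summand is for ρ < r₀; the second covers ρ ≥ r₀, where the volume of `C` itself is a
  -- sufficient bound.
  refine ⟨volume.real C * d / r₀ + volume.real C / r₀, by positivity, fun ρ hρ => ?_⟩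
  set S := {y | y ∈ C ∧ Metric.infDist y Cᶜ < ρ} with hS
  have hSC : S ⊆ C := fun y hy => hy.1
  set t := ρ / r₀ with ht
  have ht0 : 0 ≤ t := by positivity
  have hbd : volume.real C * d / r₀ * ρ = volume.real C * (d * t) := by rw [ht]; ring
  have hbd2 : volume.real C / r₀ * ρ = volume.real C * t := by rw [ht]; ring
  rw [add_mul, hbd, hbd2]
  rcases le_or_gt 1 t with h1 | h1
  · calc volume.real S ≤ volume.real C := measureReal_mono hSC hfin
      _ ≤ volume.real C * t := le_mul_of_one_le_right measureReal_nonneg h1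
      _ ≤ _ := le_add_of_nonneg_left (by positivity)
  -- By convexity a point of the contracted copy `T` has the ball of radius t r₀ = ρ around it
  -- inside `C`. So the layer avoids `T`, and Bernoulli's inequality bounds the lost volume by d t
  -- times that of `C`.
  · set T := AffineMap.homothety c (1 - t) '' C with hT
    have hTcomp : IsCompact T := h.compact.image (AffineMap.homothety_continuous c (1 - t))
    have hcC : c ∈ C := hc (Metric.mem_closedBall_self hr₀.le)
    have hTC : T ⊆ C := by
      rintro _ ⟨x, hx, rfl⟩
      rw [AffineMap.homothety_eq_lineMap]
      exact h.convex.lineMap_mem hcC hx ⟨by linarith, by linarith⟩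
    have hvol : volume.real T = (1 - t) ^ d * volume.real C := by
      rw [measureReal_def, hT, Measure.addHaar_image_homothety, ENNReal.toReal_mul,
        ENNReal.toReal_ofReal (abs_nonneg _), ← measureReal_def,
        finrank_euclideanSpace_fin, abs_of_nonneg (by have : 0 ≤ 1 - t := by linarith
                                                      positivity)]
    have hdisj : S ⊆ C \ T := by
      rintro y ⟨hyC, hyρ⟩
      refine ⟨hyC, ?_⟩
      rintro ⟨x, hx, rfl⟩
      have hne : (Cᶜ : Set (E d)).Nonempty := h.nonempty_compl hd
      obtain ⟨z, hz, hyz⟩ := (Metric.infDist_lt_iff hne).1 hyρ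
      refine hz ?_
      have hρ0 : 0 < ρ := lt_of_le_of_lt dist_nonneg hyz
      have ht0 : 0 < t := by positivity
      -- `z` is a convex combination of `x` and of a point of the ball
      set w := c + t⁻¹ • (z - AffineMap.homothety c (1 - t) x) with hw
      have hwC : w ∈ C := by
        apply hc
        rw [Metric.mem_closedBall, hw, dist_eq_norm, add_sub_cancel_left, norm_smul,
          norm_inv, Real.norm_of_nonneg ht0.le, ← dist_eq_norm, dist_comm, inv_mul_le_iff₀ ht0]
        refine hyz.le.trans (le_of_eq ?_)
        rw [ht]; field_simp
      have hz' : z = AffineMap.lineMap w x (1 - t) := by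
        rw [AffineMap.lineMap_apply_module, hw, AffineMap.homothety_apply]
        simp only [vsub_eq_sub, vadd_eq_add, sub_sub_cancel, smul_add, smul_inv_smul₀ ht0.ne']
        module
      rw [hz']
      exact h.convex.lineMap_mem hwC hx ⟨by linarith, by linarith⟩
    have hb := one_add_mul_le_pow (a := -t) (by linarith) d
    calc volume.real S ≤ volume.real (C \ T) := measureReal_mono hdisj
          (measure_ne_top_of_subset Set.sdiff_subset hfin)
      _ = volume.real C - volume.real T :=
          measureReal_sdiff hTC hTcomp.measurableSet
      _ = volume.real C * (1 - (1 - t) ^ d) := by rw [hvol]; ring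
      _ ≤ volume.real C * (d * t) := by
          refine mul_le_mul_of_nonneg_left ?_ measureReal_nonneg
          rw [← sub_eq_add_neg] at hb
          linarith
      _ ≤ _ := le_add_of_nonneg_right (by positivity)

/-- The relative error in approximating the mass `u` of a ball centred at `y` by its volume
times `f y`. -/
def massError (C : Set (E d)) (L : ℝ) (y : E d) (u : ℝ) : ℝ :=
  L * (u ^ (1 / (d : ℝ)) + Set.indicator {y | Metric.infDist y Cᶜ < L * u ^ (1 / (d : ℝ))} 1 y)

lemma massError_nonneg {L : ℝ} (hL : 0 ≤ L) (y : E d) {u : ℝ} (hu : 0 ≤ u) :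
    0 ≤ massError C L y u :=
  mul_nonneg hL (add_nonneg (Real.rpow_nonneg hu _) (Set.indicator_nonneg (by simp) _))

lemma massError_le {L : ℝ} (hL : 0 ≤ L) (y : E d) {u : ℝ} (hu : 0 ≤ u) (hu1 : u ≤ 1) :
    massError C L y u ≤ 2 * L := by
  have h1 : u ^ (1 / (d : ℝ)) ≤ 1 := Real.rpow_le_one hu hu1 (by positivity)
  have h2 : Set.indicator {y | Metric.infDist y Cᶜ < L * u ^ (1 / (d : ℝ))} (1 : E d → ℝ) y ≤ 1 :=
    Set.indicator_apply_le' (fun _ => le_rfl) (fun _ => zero_le_one)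
  unfold massError
  nlinarith

lemma measurable_massError (C : Set (E d)) (L : ℝ) :
    Measurable fun p : E d × ℝ => massError C L p.1 p.2 := by
  have h2 : Measurable fun p : E d × ℝ => p.2 ^ (1 / (d : ℝ)) := by fun_prop
  refine (h2.add ?_).const_mul L
  have h1 : Measurable fun p : E d × ℝ => Metric.infDist p.1 Cᶜ :=
    (Metric.continuous_infDist_pt _).measurable.comp measurable_fst
  have : MeasurableSet {p : E d × ℝ | Metric.infDist p.1 Cᶜ < L * p.2 ^ (1 / (d : ℝ))} :=
    measurableSet_lt h1 (h2.const_mul L)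
  exact (measurable_const (a := (1 : ℝ))).indicator this

/-- By `closedBall_lower` the radius is O(u^(1/d)) for a ball of mass u. If the ball lies in `C`,
the Lipschitz bound gives a relative error of this order. Otherwise `y` is that close to the
complement, the indicator in `massError` is 1, and the crude bound f(y)V = O(u) suffices. -/
theorem exists_massError (hd : 0 < d) (h : DensityAssumption f C)
    [IsProbabilityMeasure (densityMeasure f)]
    {D : ℝ} (hD0 : 0 < D) (hD : ∀ x ∈ C, ∀ y ∈ C, dist x y ≤ D) :
    ∃ L : ℝ, 0 ≤ L ∧
      (∀ ρ, 0 ≤ ρ → volume.real {y | y ∈ C ∧ Metric.infDist y Cᶜ < ρ} ≤ L * ρ) ∧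
      ∀ y ∈ C, ∀ r, 0 ≤ r → r ≤ D →
        |f y * (unitBallVolume d * r ^ d) - (densityMeasure f).real (Metric.closedBall y r)|
          ≤ (densityMeasure f).real (Metric.closedBall y r) *
            massError C L y ((densityMeasure f).real (Metric.closedBall y r)) := by
  obtain ⟨c, hc0, hc⟩ := h.closedBall_lower hD0 hD
  obtain ⟨L₁, hL₁0, hL₁⟩ := h.exists_lipschitz
  obtain ⟨L₂, hL₂0, hL₂⟩ := h.exists_boundary_layer_le hd
  obtain ⟨a, ha0, ha⟩ := h.bounded
  set c₀ := unitBallVolume d with hc₀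
  have hc₀0 : 0 < c₀ := unitBallVolume_pos d
  set b := (c⁻¹) ^ (1 / (d : ℝ)) with hb
  have hb0 : 0 < b := by positivity
  -- One constant for four purposes: the boundary layer (`L₂`), the threshold in the indicator (`2 *
  -- b`), balls inside `C` (`L₁ * b * (c₀ / c)`), and balls that leave `C` (`a * c₀ / c + 1`).
  set L := L₂ + 2 * b + L₁ * b * (c₀ / c) + (a * c₀ / c + 1) with hL
  refine ⟨L, by positivity, fun ρ hρ => (hL₂ ρ hρ).trans ?_, fun y hy r hr hrD => ?_⟩
  · gcongr
    have : 0 ≤ 2 * b + L₁ * b * (c₀ / c) + (a * c₀ / c + 1) := by positivity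
    linarith
  set u := (densityMeasure f).real (Metric.closedBall y r) with hu
  have hu0 : 0 ≤ u := measureReal_nonneg
  have hru : r ^ d ≤ u / c := by
    rw [le_div_iff₀ hc0, mul_comm]; exact hc y hy r hr hrD
  have hrb : r ≤ b * u ^ (1 / (d : ℝ)) := by
    rw [hb, ← Real.mul_rpow (by positivity) hu0]
    calc r = (r ^ d) ^ (1 / (d : ℝ)) := by
          rw [← Real.rpow_natCast, ← Real.rpow_mul hr, mul_one_div_cancel (by positivity),
            Real.rpow_one]
      _ ≤ _ := by
          refine Real.rpow_le_rpow (by positivity) (hru.trans (le_of_eq ?_)) (by positivity)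
          rw [div_eq_mul_inv, mul_comm]
  have hub : 0 ≤ u ^ (1 / (d : ℝ)) := by positivity
  rw [massError]
  by_cases hsub : Metric.closedBall y r ⊆ C
  · calc _ ≤ L₁ * r * (c₀ * r ^ d) := h.abs_sub_measureReal_closedBall_le hL₁ hL₁0 hr hsub
      _ ≤ L₁ * (b * u ^ (1 / (d : ℝ))) * (c₀ * (u / c)) := by gcongr
      _ = u * ((L₁ * b * (c₀ / c)) * (u ^ (1 / (d : ℝ)) + 0)) := by ring
      _ ≤ _ := by
        gcongr
        · have : 0 ≤ L₂ + 2 * b + (a * c₀ / c + 1) := by positivity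
          linarith
        · exact Set.indicator_nonneg (by simp) _
  · obtain ⟨z, hz, hzC⟩ := Set.not_subset.1 hsub
    have hr0 : 0 < r := by
      rcases hr.eq_or_lt with rfl | h0
      · rw [Metric.closedBall_zero, Set.mem_singleton_iff] at hz
        exact absurd (hz ▸ hy) hzC
      · exact h0
    have hlt : Metric.infDist y Cᶜ < L * u ^ (1 / (d : ℝ)) := by
      calc Metric.infDist y Cᶜ ≤ dist y z := Metric.infDist_le_dist_of_mem hzC
        _ ≤ r := by rw [dist_comm]; exact hz
        -- The factor 2 provides the strict inequality required by the indicator.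
        _ < 2 * r := by linarith
        _ ≤ 2 * b * u ^ (1 / (d : ℝ)) := by linarith
        _ ≤ _ := by
          gcongr
          have : 0 ≤ L₂ + L₁ * b * (c₀ / c) + (a * c₀ / c + 1) := by positivity
          linarith
    rw [Set.indicator_of_mem (by exact hlt)]
    have hfy := h.nonneg y
    calc |f y * (c₀ * r ^ d) - u| ≤ |f y * (c₀ * r ^ d)| + |u| := abs_sub _ _
      _ = f y * (c₀ * r ^ d) + u := by rw [abs_of_nonneg (by positivity), abs_of_nonneg hu0]
      _ ≤ a * (c₀ * (u / c)) + u := by gcongr; exact ha y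
      _ = u * ((a * c₀ / c + 1) * (0 + 1)) := by ring
      _ ≤ _ := by
        simp only [Pi.one_apply]
        gcongr
        have : 0 ≤ L₂ + 2 * b + L₁ * b * (c₀ / c) := by positivity
        linarith

end DensityAssumption

attribute [irreducible] densityMeasure

/-- The difference of the roots is |a - u| / (√a + √u), and the denominator is at least √u; so a
relative error survives the square root. -/
lemma abs_sqrt_sub_sqrt_le {a u η : ℝ} (ha : 0 ≤ a) (hu : 0 ≤ u) (h : |a - u| ≤ u * η) :
    |√a - √u| ≤ √u * η := by
  rcases hu.eq_or_lt with rfl | hu0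
  · have : a = 0 := by simpa using h
    simp [this]
  · have h1 : 0 < √u := Real.sqrt_pos.2 hu0
    have h2 : |√a - √u| * √u ≤ (√u * η) * √u := by
      calc |√a - √u| * √u ≤ |√a - √u| * (√a + √u) := by gcongr; linarith [Real.sqrt_nonneg a]
        _ = |a - u| := by
          rw [← abs_of_nonneg (add_nonneg (Real.sqrt_nonneg a) h1.le), ← abs_mul]
          congr 1
          ring_nf
          rw [Real.sq_sqrt ha, Real.sq_sqrt hu]
        _ ≤ u * η := h
        _ = √u * η * √u := by rw [mul_right_comm, Real.mul_self_sqrt hu]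
    exact le_of_mul_le_mul_right h2 h1

/-! ### Bounded measurable functions -/

/-- Bounded measurable real functions. -/
structure BddMeasurable {α : Type*} [MeasurableSpace α] (g : α → ℝ) : Prop where
  measurable : Measurable g
  bounded : ∃ B : ℝ, ∀ x, |g x| ≤ B

namespace BddMeasurable

variable {α β : Type*} [MeasurableSpace α] [MeasurableSpace β] {g h : α → ℝ}

lemma integrable (hg : BddMeasurable g) (μ : Measure α) [IsFiniteMeasure μ] : Integrable g μ := by
  obtain ⟨B, hB⟩ := hg.bounded
  exact Integrable.of_bound hg.measurable.aestronglyMeasurable B (ae_of_all _ hB)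

lemma const (c : ℝ) : BddMeasurable fun _ : α => c := ⟨measurable_const, |c|, fun _ => le_rfl⟩

lemma add (hg : BddMeasurable g) (hh : BddMeasurable h) : BddMeasurable fun x => g x + h x := by
  obtain ⟨B, hB⟩ := hg.bounded
  obtain ⟨B', hB'⟩ := hh.bounded
  exact ⟨hg.measurable.add hh.measurable, B + B', fun x =>
    (abs_add_le _ _).trans (add_le_add (hB x) (hB' x))⟩

lemma sub (hg : BddMeasurable g) (hh : BddMeasurable h) : BddMeasurable fun x => g x - h x := by
  obtain ⟨B, hB⟩ := hg.bounded
  obtain ⟨B', hB'⟩ := hh.bounded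
  exact ⟨hg.measurable.sub hh.measurable, B + B', fun x =>
    (abs_sub _ _).trans (add_le_add (hB x) (hB' x))⟩

lemma mul (hg : BddMeasurable g) (hh : BddMeasurable h) : BddMeasurable fun x => g x * h x := by
  obtain ⟨B, hB⟩ := hg.bounded
  obtain ⟨B', hB'⟩ := hh.bounded
  refine ⟨hg.measurable.mul hh.measurable, B * B', fun x => ?_⟩
  rw [abs_mul]
  exact mul_le_mul (hB x) (hB' x) (abs_nonneg _) ((abs_nonneg _).trans (hB x))

lemma pow (hg : BddMeasurable g) (n : ℕ) : BddMeasurable fun x => g x ^ n := by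
  obtain ⟨B, hB⟩ := hg.bounded
  refine ⟨hg.measurable.pow_const n, B ^ n, fun x => ?_⟩
  rw [abs_pow]
  exact pow_le_pow_left₀ (abs_nonneg _) (hB x) n

lemma sqrt (hg : BddMeasurable g) : BddMeasurable fun x => √(g x) := by
  obtain ⟨B, hB⟩ := hg.bounded
  refine ⟨hg.measurable.sqrt, √B, fun x => ?_⟩
  rw [abs_of_nonneg (Real.sqrt_nonneg _)]
  exact Real.sqrt_le_sqrt ((le_abs_self _).trans (hB x))

lemma sum {ι : Type*} (s : Finset ι) {g : ι → α → ℝ} (hg : ∀ i, BddMeasurable (g i)) :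
    BddMeasurable fun x => ∑ i ∈ s, g i x := by
  classical
  induction s using Finset.induction_on with
  | empty => simpa using const 0
  | insert i s hi ih => simpa [Finset.sum_insert hi] using (hg i).add ih

lemma indicator (hg : BddMeasurable g) {s : Set α} (hs : MeasurableSet s) :
    BddMeasurable (s.indicator g) := by
  obtain ⟨B, hB⟩ := hg.bounded
  refine ⟨hg.measurable.indicator hs, B, fun x => ?_⟩
  by_cases hx : x ∈ s
  · simpa [hx] using hB x
  · simpa [hx] using (abs_nonneg _).trans (hB x)

lemma comp (hg : BddMeasurable g) {f : β → α} (hf : Measurable f) :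
    BddMeasurable fun x => g (f x) :=
  ⟨hg.measurable.comp hf, hg.bounded.imp fun _ hB x => hB (f x)⟩

lemma integral_right {g : α × β → ℝ} (hg : BddMeasurable g) (ν : Measure β)
    [IsFiniteMeasure ν] : BddMeasurable fun x => ∫ y, g (x, y) ∂ν := by
  obtain ⟨B, hB⟩ := hg.bounded
  refine ⟨hg.measurable.stronglyMeasurable.integral_prod_right'.measurable, B * ν.real Set.univ,
    fun x => ?_⟩
  exact norm_integral_le_of_norm_le_const (f := fun y => g (x, y)) (ae_of_all _ fun y => hB (x, y))

lemma integral_left {g : α × β → ℝ} (hg : BddMeasurable g) (μ : Measure α)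
    [IsFiniteMeasure μ] : BddMeasurable fun y => ∫ x, g (x, y) ∂μ :=
  (hg.comp (f := Prod.swap) measurable_swap).integral_right μ

lemma integral_integral_swap {g : α × β → ℝ} (hg : BddMeasurable g) (μ : Measure α)
    (ν : Measure β) [IsFiniteMeasure μ] [IsFiniteMeasure ν] :
    ∫ x, ∫ y, g (x, y) ∂ν ∂μ = ∫ y, ∫ x, g (x, y) ∂μ ∂ν :=
  MeasureTheory.integral_integral_swap (hg.integrable _)

/-- The mean is the best constant predictor in mean square; hence the freedom of choice of the
predictors in `efronStein`. -/
lemma integral_sq_sub_sq_le (hg : BddMeasurable g) (μ : Measure α) [IsProbabilityMeasure μ]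
    (c : ℝ) : ∫ x, g x ^ 2 ∂μ - (∫ x, g x ∂μ) ^ 2 ≤ ∫ x, (g x - c) ^ 2 ∂μ := by
  have h1 : ∫ x, (g x - c) ^ 2 ∂μ = ∫ x, g x ^ 2 ∂μ - 2 * c * ∫ x, g x ∂μ + c ^ 2 := by
    have : ∀ x, (g x - c) ^ 2 = g x ^ 2 - 2 * c * g x + c ^ 2 := fun x => by ring
    simp only [this]
    rw [integral_add (((hg.pow 2).sub ((const _).mul hg)).integrable μ) (integrable_const _),
      integral_sub ((hg.pow 2).integrable μ) (((const _).mul hg).integrable μ),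
      integral_const_mul]
    simp
  rw [h1]
  nlinarith [sq_nonneg (∫ x, g x ∂μ - c)]

lemma sq_integral_le (hg : BddMeasurable g) (μ : Measure α) [IsProbabilityMeasure μ] :
    (∫ x, g x ∂μ) ^ 2 ≤ ∫ x, g x ^ 2 ∂μ := by
  have h1 := hg.integral_sq_sub_sq_le μ (∫ x, g x ∂μ)
  have h2 : ∫ x, (g x - ∫ x, g x ∂μ) ^ 2 ∂μ
      = ∫ x, g x ^ 2 ∂μ - (∫ x, g x ∂μ) ^ 2 := by
    set c := ∫ x, g x ∂μ
    have : ∀ x, (g x - c) ^ 2 = g x ^ 2 - 2 * c * g x + c ^ 2 := fun x => by ring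
    simp only [this]
    rw [integral_add (((hg.pow 2).sub ((const _).mul hg)).integrable μ) (integrable_const _),
      integral_sub ((hg.pow 2).integrable μ) (((const _).mul hg).integrable μ),
      integral_const_mul]
    simp
    ring
  have h3 : 0 ≤ ∫ x, (g x - ∫ x, g x ∂μ) ^ 2 ∂μ := integral_nonneg fun x => sq_nonneg _
  linarith

end BddMeasurable

/-! ### Integrals over product spaces and the Efron–Stein inequality -/

section Pi

variable {α : Type*} [MeasurableSpace α] (μ : Measure α) [IsProbabilityMeasure μ]

lemma measurable_insertNth {n : ℕ} (a : Fin (n + 1)) :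
    Measurable fun p : α × (Fin n → α) => (a.insertNth p.1 p.2 : Fin (n + 1) → α) :=
  (MeasurableEquiv.piFinSuccAbove (fun _ => α) a).symm.measurable

lemma integral_pi_succAbove {n : ℕ} (a : Fin (n + 1)) {g : (Fin (n + 1) → α) → ℝ}
    (hg : BddMeasurable g) :
    ∫ x, g x ∂(Measure.pi fun _ => μ)
      = ∫ p, ∫ y, g (a.insertNth p y) ∂(Measure.pi fun _ : Fin n => μ) ∂μ := by
  have h1 := (measurePreserving_piFinSuccAbove (fun _ : Fin (n + 1) => μ) a).symm
  rw [← h1.integral_comp' g, integral_prod]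
  · rfl
  · exact (hg.comp (measurable_insertNth a)).integrable _

lemma integral_pi_succAbove' {n : ℕ} (a : Fin (n + 1)) {g : (Fin (n + 1) → α) → ℝ}
    (hg : BddMeasurable g) :
    ∫ x, g x ∂(Measure.pi fun _ => μ)
      = ∫ y, ∫ p, g (a.insertNth p y) ∂μ ∂(Measure.pi fun _ : Fin n => μ) := by
  rw [integral_pi_succAbove μ a hg]
  exact (hg.comp (measurable_insertNth a)).integral_integral_swap _ _

/-- The **Efron–Stein inequality**, with arbitrary predictors `S a` that do not depend on the
`a`-th coordinate. -/
theorem efronStein {n : ℕ} {T : (Fin n → α) → ℝ} (hT : BddMeasurable T)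
    {S : Fin n → (Fin n → α) → ℝ} (hS : ∀ a, BddMeasurable (S a))
    (hindep : ∀ a x x', (∀ j, j ≠ a → x j = x' j) → S a x = S a x') :
    ∫ x, T x ^ 2 ∂(Measure.pi fun _ => μ) - (∫ x, T x ∂(Measure.pi fun _ => μ)) ^ 2
      ≤ ∑ a, ∫ x, (T x - S a x) ^ 2 ∂(Measure.pi fun _ => μ) := by
  induction n with
  | zero => simp [Measure.pi_of_empty (fun _ : Fin 0 => μ) (fun i => i.elim0)]
  | succ n ih =>
    set ρ := Measure.pi fun _ : Fin n => μ with hρ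
    set F : α × (Fin n → α) → ℝ := fun q => T ((0 : Fin (n + 1)).insertNth q.1 q.2) with hF
    have hFb : BddMeasurable F := hT.comp (measurable_insertNth 0)
    set G : Fin (n + 1) → α × (Fin n → α) → ℝ :=
      fun a q => S a ((0 : Fin (n + 1)).insertNth q.1 q.2) with hG
    have hGb : ∀ a, BddMeasurable (G a) := fun a => (hS a).comp (measurable_insertNth 0)
    set A : (Fin n → α) → ℝ := fun y => ∫ p, F (p, y) ∂μ with hA
    have hAb : BddMeasurable A := hFb.integral_left μ
    have hsec : ∀ {g : α × (Fin n → α) → ℝ}, BddMeasurable g → ∀ y,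
        BddMeasurable fun p => g (p, y) := fun hg y => hg.comp measurable_prodMk_right
    have e1 : ∫ x, T x ^ 2 ∂(Measure.pi fun _ => μ) = ∫ y, ∫ p, F (p, y) ^ 2 ∂μ ∂ρ :=
      integral_pi_succAbove' μ 0 (hT.pow 2)
    have e2 : ∫ x, T x ∂(Measure.pi fun _ => μ) = ∫ y, A y ∂ρ :=
      integral_pi_succAbove' μ 0 hT
    have e3 : ∀ a, ∫ x, (T x - S a x) ^ 2 ∂(Measure.pi fun _ => μ)
        = ∫ y, ∫ p, (F (p, y) - G a (p, y)) ^ 2 ∂μ ∂ρ := fun a =>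
      integral_pi_succAbove' μ 0 ((hT.sub (hS a)).pow 2)
    have hd : ∀ a, BddMeasurable fun y => ∫ p, (F (p, y) - G a (p, y)) ^ 2 ∂μ := fun a =>
      ((hFb.sub (hGb a)).pow 2).integral_left μ
    -- the conditional variance with respect to the first coordinate
    have h1 : ∫ y, ∫ p, F (p, y) ^ 2 ∂μ ∂ρ - ∫ y, A y ^ 2 ∂ρ
        ≤ ∫ y, ∫ p, (F (p, y) - G 0 (p, y)) ^ 2 ∂μ ∂ρ := by
      have hF2 : BddMeasurable fun y => ∫ p, F (p, y) ^ 2 ∂μ := (hFb.pow 2).integral_left μ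
      rw [← integral_sub (hF2.integrable ρ) ((hAb.pow 2).integrable ρ)]
      refine integral_mono ((hF2.sub (hAb.pow 2)).integrable ρ) ((hd 0).integrable ρ) fun y => ?_
      obtain ⟨p₀⟩ : Nonempty α := μ.nonempty_of_neZero
      have hc : ∀ p, G 0 (p, y) = G 0 (p₀, y) := fun p => by
        refine hindep 0 _ _ fun j hj => ?_
        obtain ⟨i, rfl⟩ := Fin.exists_succAbove_eq hj
        simp only [Fin.insertNth_apply_succAbove]
      simp only [hc]
      exact (hsec hFb y).integral_sq_sub_sq_le μ _
    -- the variance of the conditional expectation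
    have h2 : ∫ y, A y ^ 2 ∂ρ - (∫ y, A y ∂ρ) ^ 2
        ≤ ∑ a : Fin n, ∫ y, ∫ p, (F (p, y) - G a.succ (p, y)) ^ 2 ∂μ ∂ρ := by
      -- After the first coordinate is averaged out, the averaged predictors still ignore their own
      -- coordinate. Jensen's inequality then bounds their errors by those of the original
      -- predictors.
      have h3 := ih hAb (S := fun a y => ∫ p, G a.succ (p, y) ∂μ)
        (fun a => (hGb a.succ).integral_left μ) (by
          intro a x x' hx
          refine integral_congr_ae (ae_of_all _ fun p => ?_)
          refine hindep _ _ _ fun j hj => ?_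
          refine Fin.cases ?_ (fun i hi => ?_) j hj
          · intro _
            simp
          · simp only [Fin.insertNth_zero, Fin.cons_succ]
            exact hx i fun h => hi (by rw [h]))
      refine h3.trans (Finset.sum_le_sum fun a _ => ?_)
      refine integral_mono (((hAb.sub ((hGb a.succ).integral_left μ)).pow 2).integrable ρ)
        ((hd a.succ).integrable ρ) fun y => ?_
      simp only [hA]
      rw [← integral_sub ((hsec hFb y).integrable μ) ((hsec (hGb a.succ) y).integrable μ)]
      exact (hsec (hFb.sub (hGb a.succ)) y).sq_integral_le μ
    rw [e1, e2, Fin.sum_univ_succ]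
    simp only [e3]
    linarith

end Pi

/-! ### Moments of the order statistics -/

lemma betaMoment_zero (m : ℕ) {k : ℕ} (hk : 1 ≤ k) : betaMoment m k 0 = 1 := by
  have h1 := Real.Gamma_pos_of_pos (s := (m : ℝ) + 1) (by positivity)
  have h2 := Real.Gamma_pos_of_pos (s := (k : ℝ)) (by exact_mod_cast hk)
  rw [betaMoment, add_zero, add_zero, div_self (by positivity)]

lemma betaMoment_add_one (m : ℕ) {k : ℕ} (hk : 1 ≤ k) {s : ℝ} (hs : 0 ≤ s) :
    betaMoment m k (s + 1) = betaMoment m k s * ((k + s) / (m + 1 + s)) := by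
  have hk0 : (0 : ℝ) < k := by exact_mod_cast hk
  have h1 := Real.Gamma_pos_of_pos (s := (m : ℝ) + 1 + s) (by positivity)
  have h2 := Real.Gamma_pos_of_pos hk0
  rw [betaMoment, betaMoment, ← add_assoc, ← add_assoc,
    Real.Gamma_add_one (s := (k : ℝ) + s) (by positivity),
    Real.Gamma_add_one (s := (m : ℝ) + 1 + s) (by positivity)]
  field_simp

lemma betaMoment_one (m : ℕ) {k : ℕ} (hk : 1 ≤ k) : betaMoment m k 1 = k / (m + 1) := by
  have := betaMoment_add_one m hk (le_refl (0 : ℝ))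
  simpa [betaMoment_zero m hk] using this

lemma betaMoment_two (m : ℕ) {k : ℕ} (hk : 1 ≤ k) :
    betaMoment m k 2 = k / (m + 1) * ((k + 1) / (m + 1 + 1)) := by
  have := betaMoment_add_one m hk (zero_le_one (α := ℝ))
  rw [betaMoment_one m hk] at this
  rw [← this]; norm_num

lemma add_div_add_le (m : ℕ) {k : ℕ} (hk : 1 ≤ k) {s : ℝ} (hs : 0 ≤ s) :
    ((k : ℝ) + s) / (m + 1 + s) ≤ (1 + s) * (k / (m + 1)) := by
  have hk1 : (1 : ℝ) ≤ k := by exact_mod_cast hk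
  rw [← mul_div_assoc]
  have : (k : ℝ) + s ≤ (1 + s) * k := by nlinarith
  exact div_le_div₀ (by positivity) this (by positivity) (by linarith)

lemma betaMoment_two_le (m : ℕ) {k : ℕ} (hk : 1 ≤ k) :
    betaMoment m k 2 ≤ 2 * ((k : ℝ) / (m + 1)) ^ 2 := by
  rw [betaMoment_two m hk]
  have := add_div_add_le m hk (zero_le_one (α := ℝ))
  have h0 : (0 : ℝ) ≤ k / (m + 1) := by positivity
  nlinarith

lemma betaMoment_three_le (m : ℕ) {k : ℕ} (hk : 1 ≤ k) :
    betaMoment m k 3 ≤ 6 * ((k : ℝ) / (m + 1)) ^ 3 := by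
  have h1 : betaMoment m k 3 = betaMoment m k 2 * ((k + 2) / (m + 1 + 2)) := by
    rw [← betaMoment_add_one m hk (by norm_num)]; norm_num
  have h2 := betaMoment_two_le m hk
  have h3 := add_div_add_le m hk (s := 2) (by norm_num)
  have h0 : (0 : ℝ) ≤ k / (m + 1) := by positivity
  have h4 : (0 : ℝ) ≤ (k + 2) / (m + 1 + 2) := by positivity
  rw [h1]
  calc betaMoment m k 2 * ((k + 2) / (m + 1 + 2))
      ≤ 2 * ((k : ℝ) / (m + 1)) ^ 2 * ((1 + 2) * (k / (m + 1))) := by gcongr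
    _ = _ := by ring

/-! ### Averages over the position of the nearest neighbours -/

/-- The distance from `y` to its `k`-th nearest point of `z`. -/
def nnRadius {d m : ℕ} (k : ℕ) (y : E d) (z : Fin m → E d) : ℝ :=
  kthValue k (fun j => dist (z j) y)

/-- The mass of the ball about `y` that reaches to its `k`-th nearest point of `z`. -/
def nnMass {d m : ℕ} (f : E d → ℝ) (k : ℕ) (y : E d) (z : Fin m → E d) : ℝ :=
  (densityMeasure f).real (Metric.closedBall y (nnRadius k y z))

lemma measurable_nnRadius {d m k : ℕ} (hk : 1 ≤ k) (hkm : k ≤ m) :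
    Measurable fun p : E d × (Fin m → E d) => nnRadius k p.1 p.2 := by
  refine (measurable_kthValue hk hkm).comp (measurable_pi_lambda _ fun j => ?_)
  exact ((measurable_pi_apply j).comp measurable_snd).dist measurable_fst

lemma measurable_measureReal_closedBall {d : ℕ} (μ : Measure (E d)) [IsFiniteMeasure μ] :
    Measurable fun p : E d × ℝ => μ.real (Metric.closedBall p.1 p.2) := by
  have h1 : MeasurableSet {q : (E d × ℝ) × E d | dist q.2 q.1.1 ≤ q.1.2} :=
    measurableSet_le (measurable_snd.dist (measurable_fst.comp measurable_fst))
      (measurable_snd.comp measurable_fst)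
  exact (measurable_measure_prodMk_left (ν := μ) h1).ennreal_toReal

lemma measurable_nnMass {d m k : ℕ} {f : E d → ℝ} [IsProbabilityMeasure (densityMeasure f)]
    (hk : 1 ≤ k) (hkm : k ≤ m) :
    Measurable fun p : E d × (Fin m → E d) => nnMass f k p.1 p.2 := by
  have h1 : Measurable fun p : E d × (Fin m → E d) => (p.1, nnRadius k p.1 p.2) :=
    measurable_fst.prodMk (measurable_nnRadius hk hkm)
  have h2 := (measurable_measureReal_closedBall (densityMeasure f)).comp h1
  simp only [nnMass]
  exact h2

lemma nnMass_mem {d m k : ℕ} {f : E d → ℝ} [IsProbabilityMeasure (densityMeasure f)] (y : E d)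
    (z : Fin m → E d) : nnMass f k y z ∈ Set.Icc 0 1 := ⟨measureReal_nonneg, measureReal_le_one⟩

/-- This is the probability integral transform: the mass of the ball is the distribution function of
the distance to `y` evaluated at its k-th order statistic. That law has no atoms because spheres are
null. -/
lemma isOrderLaw_nnMass {d m k : ℕ} {f : E d → ℝ} (hd : 0 < d)
    [IsProbabilityMeasure (densityMeasure f)] (hk : 1 ≤ k) (hkm : k ≤ m) (y : E d) :
    IsOrderLaw ((Measure.pi fun _ : Fin m => densityMeasure f).map (nnMass f k y)) m k :=
  isOrderLaw_map (μ := densityMeasure f) (h := fun x => dist x y)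
    (measurable_id.dist measurable_const) (fun _ => dist_nonneg)
    (fun r => DensityAssumption.measure_sphere hd y r) hk hkm

lemma nnRadius_mem {d m k : ℕ} {C : Set (E d)} {D : ℝ} (hD : ∀ x ∈ C, ∀ y ∈ C, dist x y ≤ D)
    (hk : 1 ≤ k) (hkm : k ≤ m) {y : E d} (hy : y ∈ C) {z : Fin m → E d} (hz : ∀ j, z j ∈ C) :
    nnRadius k y z ∈ Set.Icc 0 D :=
  ⟨kthValue_nonneg hk fun _ => dist_nonneg, kthValue_le hk hkm fun j => hD _ (hz j) _ hy⟩

attribute [irreducible] nnRadius nnMass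

lemma measurable_nnMass_right {d m k : ℕ} {f : E d → ℝ} [IsProbabilityMeasure (densityMeasure f)]
    (hk : 1 ≤ k) (hkm : k ≤ m) (y : E d) :
    Measurable (nnMass f k y : (Fin m → E d) → ℝ) := by
  have h1 : Measurable fun z : Fin m → E d => (y, z) := measurable_prodMk_left
  exact (measurable_nnMass (f := f) hk hkm).comp h1

/-- A measurable retraction onto `C`. -/
structure IsRetraction {d : ℕ} (C : Set (E d)) (π : E d → E d) : Prop where
  measurable : Measurable π
  mem : ∀ y, π y ∈ C
  eq : ∀ y ∈ C, π y = y

section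

variable {d : ℕ} {f : E d → ℝ} {C : Set (E d)} {π : E d → E d}

/-- Composition with such a map makes radii, volumes and masses bounded everywhere and not just
almost surely, so integrability is automatic. Nothing is lost, since the sample lies in `C` almost
surely. -/
lemma DensityAssumption.exists_retraction (h : DensityAssumption f C)
    [IsProbabilityMeasure (densityMeasure f)] : ∃ π, IsRetraction C π := by
  classical
  obtain ⟨c, r, hr, hc⟩ := h.exists_closedBall_subset
  have hcC : c ∈ C := hc (Metric.mem_closedBall_self hr.le)
  refine ⟨C.piecewise id fun _ => c, measurable_id.piecewise h.measurableSet measurable_const,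
    fun y => ?_, fun y hy => by simp [hy]⟩
  by_cases hy : y ∈ C <;> simp [hy, hcC]

lemma IsRetraction.measurable_comp (hπ : IsRetraction C π) (m : ℕ) :
    Measurable fun z : Fin m → E d => fun j => π (z j) :=
  measurable_pi_lambda _ fun j => hπ.measurable.comp (measurable_pi_apply j)

lemma IsRetraction.measurable_prod (hπ : IsRetraction C π) (m : ℕ) :
    Measurable fun p : E d × (Fin m → E d) => (π p.1, fun j => π (p.2 j)) :=
  (hπ.measurable.comp measurable_fst).prodMk ((hπ.measurable_comp m).comp measurable_snd)

lemma DensityAssumption.ae_retract_eq (h : DensityAssumption f C) (hπ : IsRetraction C π)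
    [IsProbabilityMeasure (densityMeasure f)] (m : ℕ) :
    ∀ᵐ z ∂(Measure.pi fun _ : Fin m => densityMeasure f), (fun j => π (z j)) = z := by
  have h1 : ∀ j : Fin m, ∀ᵐ z ∂(Measure.pi fun _ : Fin m => densityMeasure f), z j ∈ C :=
    fun j => (measurePreserving_eval (fun _ : Fin m => densityMeasure f) j).quasiMeasurePreserving.ae
      h.ae_mem
  filter_upwards [ae_all_iff.2 h1] with z hz
  funext j
  exact hπ.eq _ (hz j)

variable {D : ℝ} {m k : ℕ}

lemma bddMeasurable_nnRadius (hπ : IsRetraction C π) (hD : ∀ x ∈ C, ∀ y ∈ C, dist x y ≤ D)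
    (hk : 1 ≤ k) (hkm : k ≤ m) :
    BddMeasurable fun p : E d × (Fin m → E d) => nnRadius k (π p.1) (fun j => π (p.2 j)) := by
  refine ⟨(measurable_nnRadius hk hkm).comp (hπ.measurable_prod m), D, fun p => ?_⟩
  have := nnRadius_mem hD hk hkm (hπ.mem p.1) (fun j => hπ.mem (p.2 j))
  rw [abs_of_nonneg this.1]
  exact this.2

lemma bddMeasurable_nnMass [IsProbabilityMeasure (densityMeasure f)] (hπ : IsRetraction C π)
    (hk : 1 ≤ k) (hkm : k ≤ m) :
    BddMeasurable fun p : E d × (Fin m → E d) => nnMass f k (π p.1) (fun j => π (p.2 j)) := by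
  refine ⟨(measurable_nnMass hk hkm).comp (hπ.measurable_prod m), 1, fun p => ?_⟩
  have := nnMass_mem (f := f) (k := k) (π p.1) (fun j => π (p.2 j))
  rw [abs_of_nonneg this.1]
  exact this.2

/-- The law of the mass of a nearest neighbour ball does not depend on its centre. -/
lemma integral_nnMass_eq (hd : 0 < d) (h : DensityAssumption f C)
    [IsProbabilityMeasure (densityMeasure f)] (hπ : IsRetraction C π) (hk : 1 ≤ k)
    (hkm : k ≤ m) (y y' : E d) {g : ℝ → ℝ} (hg : Measurable g) :
    ∫ z, g (nnMass f k y (fun j => π (z j))) ∂(Measure.pi fun _ : Fin m => densityMeasure f)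
      = ∫ z, g (nnMass f k y' (fun j => π (z j)))
        ∂(Measure.pi fun _ : Fin m => densityMeasure f) := by
  have key : ∀ y, ∫ z, g (nnMass f k y (fun j => π (z j)))
        ∂(Measure.pi fun _ : Fin m => densityMeasure f)
      = ∫ u, g u ∂((Measure.pi fun _ : Fin m => densityMeasure f).map (nnMass f k y)) := by
    intro y
    rw [integral_map (measurable_nnMass_right (f := f) hk hkm y).aemeasurable
      hg.aestronglyMeasurable]
    refine integral_congr_ae ?_
    filter_upwards [h.ae_retract_eq hπ m] with z hz
    rw [hz]
  rw [key, key, (isOrderLaw_nnMass (f := f) hd hk hkm y).eq (isOrderLaw_nnMass (f := f) hd hk hkm y')]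

lemma integral_nnMass_rpow (hd : 0 < d) (h : DensityAssumption f C)
    [IsProbabilityMeasure (densityMeasure f)] (hπ : IsRetraction C π) (hk : 1 ≤ k)
    (hkm : k ≤ m) (y : E d) {s : ℝ} (hs : 0 < s) :
    ∫ z, nnMass f k y (fun j => π (z j)) ^ s ∂(Measure.pi fun _ : Fin m => densityMeasure f)
      = betaMoment m k s := by
  rw [← (isOrderLaw_nnMass (f := f) hd hk hkm y).integral_rpow hk hkm hs,
    integral_map (measurable_nnMass_right (f := f) hk hkm y).aemeasurable
      (by fun_prop)]
  refine integral_congr_ae ?_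
  filter_upwards [h.ae_retract_eq hπ m] with z hz
  rw [hz]

/-- For x = u/c this is x^s ≤ 1 + x³, valid on both sides of x = 1. -/
lemma rpow_le_rpow_mul_one_add {u c s : ℝ} (hu : 0 ≤ u) (hc : 0 < c) (hs0 : 0 < s) (hs : s ≤ 3) :
    u ^ s ≤ c ^ s * (1 + (u / c) ^ (3 : ℝ)) := by
  have h1 : u ^ s = c ^ s * (u / c) ^ s := by
    rw [← Real.mul_rpow hc.le (by positivity), mul_div_cancel₀ _ hc.ne']
  rw [h1]
  gcongr
  have h0 : 0 ≤ u / c := by positivity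
  rcases le_total (u / c) 1 with h2 | h2
  · have := Real.rpow_le_one h0 h2 hs0.le
    have : 0 ≤ (u / c) ^ (3 : ℝ) := by positivity
    linarith
  · have := Real.rpow_le_rpow_of_exponent_le h2 hs
    linarith

/-- Domination by the third moment gives the right scaling of all powers up to 3 without asymptotics
of Gamma. The constant is 7 = 1 + 6, with 6 from `betaMoment_three_le`. -/
lemma integral_nnMass_rpow_le (hd : 0 < d) (h : DensityAssumption f C)
    [IsProbabilityMeasure (densityMeasure f)] (hπ : IsRetraction C π) (hk : 1 ≤ k)
    (hkm : k ≤ m) (y : E d) {s : ℝ} (hs0 : 0 < s) (hs : s ≤ 3) :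
    ∫ z, nnMass f k (π y) (fun j => π (z j)) ^ s
      ∂(Measure.pi fun _ : Fin m => densityMeasure f) ≤ 7 * ((k : ℝ) / (m + 1)) ^ s := by
  set ρ := Measure.pi fun _ : Fin m => densityMeasure f
  have hk0 : (0 : ℝ) < k := by exact_mod_cast hk
  set c : ℝ := k / (m + 1) with hc
  have hc0 : 0 < c := by positivity
  set u : (Fin m → E d) → ℝ := fun z => nnMass f k (π y) (fun j => π (z j)) with hu
  have hub : BddMeasurable u := (bddMeasurable_nnMass hπ hk hkm).comp measurable_prodMk_left
  have hu0 : ∀ z, u z ∈ Set.Icc (0 : ℝ) 1 := fun z => nnMass_mem _ _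
  have hpow : ∀ s : ℝ, 0 < s → BddMeasurable fun z => u z ^ s := fun s hs =>
    ⟨hub.measurable.pow_const s, 1, fun z => by
      rw [abs_of_nonneg (Real.rpow_nonneg (hu0 z).1 s)]
      exact Real.rpow_le_one (hu0 z).1 (hu0 z).2 hs.le⟩
  have h3 : ∫ z, u z ^ (3 : ℝ) ∂ρ ≤ 6 * c ^ 3 := by
    rw [hu, integral_nnMass_rpow hd h hπ hk hkm (π y) (by norm_num)]
    exact betaMoment_three_le m hk
  have hb : BddMeasurable fun z => c ^ s * (1 + (c⁻¹) ^ (3 : ℝ) * u z ^ (3 : ℝ)) :=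
    (BddMeasurable.const _).mul ((BddMeasurable.const _).add
      ((BddMeasurable.const _).mul (hpow 3 (by norm_num))))
  calc ∫ z, u z ^ s ∂ρ ≤ ∫ z, c ^ s * (1 + (c⁻¹) ^ (3 : ℝ) * u z ^ (3 : ℝ)) ∂ρ := by
        refine integral_mono ((hpow s hs0).integrable ρ) (hb.integrable ρ) fun z => ?_
        simp only
        refine (rpow_le_rpow_mul_one_add (hu0 z).1 hc0 hs0 hs).trans (le_of_eq ?_)
        rw [div_eq_inv_mul, Real.mul_rpow (by positivity) (hu0 z).1]
    _ = c ^ s * (1 + (c⁻¹) ^ (3 : ℝ) * ∫ z, u z ^ (3 : ℝ) ∂ρ) := by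
        rw [integral_const_mul, integral_add (integrable_const _)
          (((BddMeasurable.const _).mul (hpow 3 (by norm_num))).integrable ρ), integral_const_mul]
        simp
    _ ≤ c ^ s * (1 + (c⁻¹) ^ (3 : ℝ) * (6 * c ^ 3)) := by gcongr
    _ = 7 * c ^ s := by
        have : (c⁻¹) ^ (3 : ℝ) * (6 * c ^ 3) = 6 := by
          rw [show (3 : ℝ) = ((3 : ℕ) : ℝ) by norm_num, Real.rpow_natCast]
          field_simp
        rw [this]; ring

/-- The averaged effect of the boundary layer and of the variation of the density. -/
lemma exists_integral_massError_le (hd : 0 < d) (h : DensityAssumption f C)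
    [IsProbabilityMeasure (densityMeasure f)] (hπ : IsRetraction C π) {L : ℝ} (hL0 : 0 ≤ L)
    (hL : ∀ ρ, 0 ≤ ρ → volume.real {y | y ∈ C ∧ Metric.infDist y Cᶜ < ρ} ≤ L * ρ) :
    ∃ K : ℝ, 0 ≤ K ∧ ∀ m k : ℕ, 1 ≤ k → k ≤ m → ∀ s : ℝ, 0 < s → s ≤ 2 →
      ∫ y in C, ∫ z, nnMass f k (π y) (fun j => π (z j)) ^ s *
          DensityAssumption.massError C L y (nnMass f k (π y) (fun j => π (z j)))
          ∂(Measure.pi fun _ : Fin m => densityMeasure f)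
        ≤ K * ((k : ℝ) / (m + 1)) ^ (s + 1 / (d : ℝ)) := by
  have hfin : IsFiniteMeasure (volume.restrict C) := ⟨by simpa using h.compact.measure_lt_top⟩
  refine ⟨L * (volume.real C + L * L) * 7, by positivity, fun m k hk hkm s hs0 hs => ?_⟩
  set ρ := Measure.pi fun _ : Fin m => densityMeasure f
  set u : (Fin m → E d) → ℝ := fun z => nnMass f k (π 0) (fun j => π (z j)) with hu
  have hub : BddMeasurable u := (bddMeasurable_nnMass hπ hk hkm).comp measurable_prodMk_left
  have hu0 : ∀ z, u z ∈ Set.Icc (0 : ℝ) 1 := fun z => nnMass_mem _ _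
  have hd1 : 1 / (d : ℝ) ≤ 1 := by
    rw [div_le_one (by exact_mod_cast hd)]
    exact_mod_cast hd
  have hd0 : 0 ≤ 1 / (d : ℝ) := by positivity
  have hpow : ∀ s : ℝ, 0 < s → BddMeasurable fun z => u z ^ s := fun s hs =>
    ⟨hub.measurable.pow_const s, 1, fun z => by
      rw [abs_of_nonneg (Real.rpow_nonneg (hu0 z).1 s)]
      exact Real.rpow_le_one (hu0 z).1 (hu0 z).2 hs.le⟩
  have herr : BddMeasurable fun p : E d × (Fin m → E d) =>
      DensityAssumption.massError C L p.1 (u p.2) := by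
    refine ⟨(DensityAssumption.measurable_massError C L).comp
      (measurable_fst.prodMk (hub.measurable.comp measurable_snd)), 2 * L, fun p => ?_⟩
    rw [abs_of_nonneg (DensityAssumption.massError_nonneg hL0 _ (hu0 _).1)]
    exact DensityAssumption.massError_le hL0 _ (hu0 _).1 (hu0 _).2
  have hprod : BddMeasurable fun p : E d × (Fin m → E d) =>
      u p.2 ^ s * DensityAssumption.massError C L p.1 (u p.2) :=
    ((hpow s hs0).comp measurable_snd).mul herr
  -- The law of the mass is the same for all centres, so the centre is frozen at `π 0`. Then the
  -- mass no longer depends on `y`, and integrating over `y` first turns the indicator into the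
  -- volume of a boundary layer.
  have h1 : ∀ y, ∫ z, nnMass f k (π y) (fun j => π (z j)) ^ s *
          DensityAssumption.massError C L y (nnMass f k (π y) (fun j => π (z j))) ∂ρ
      = ∫ z, u z ^ s * DensityAssumption.massError C L y (u z) ∂ρ := fun y =>
    integral_nnMass_eq hd h hπ hk hkm (π y) (π 0)
      (g := fun v => v ^ s * DensityAssumption.massError C L y v)
      ((measurable_id.pow_const s).mul
        ((DensityAssumption.measurable_massError C L).comp measurable_prodMk_left))
  simp only [h1]
  rw [hprod.integral_integral_swap (volume.restrict C) ρ]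
  have h2 : ∀ z, ∫ y in C, u z ^ s * DensityAssumption.massError C L y (u z)
      ≤ L * (volume.real C + L * L) * u z ^ (s + 1 / (d : ℝ)) := by
    intro z
    have hz := (hu0 z).1
    set v := u z ^ (1 / (d : ℝ)) with hv
    have hv0 : 0 ≤ v := Real.rpow_nonneg hz _
    have hms : MeasurableSet {y : E d | Metric.infDist y Cᶜ < L * v} :=
      measurableSet_lt (Metric.continuous_infDist_pt _).measurable measurable_const
    have hind : Integrable (Set.indicator {y : E d | Metric.infDist y Cᶜ < L * v} (1 : E d → ℝ))
        (volume.restrict C) := ((BddMeasurable.const (1 : ℝ)).indicator hms).integrable _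
    have hint : ∫ y in C, (v + Set.indicator {y | Metric.infDist y Cᶜ < L * v} 1 y)
        = volume.real C * v + volume.real {y | y ∈ C ∧ Metric.infDist y Cᶜ < L * v} := by
      rw [integral_add (integrable_const _) hind, integral_indicator_one hms,
        measureReal_restrict_apply hms, Set.inter_comm]
      simp
      rfl
    simp only [DensityAssumption.massError, ← hv]
    rw [integral_const_mul, integral_const_mul, hint,
      Real.rpow_add_of_nonneg hz hs0.le hd0, ← hv]
    have := hL (L * v) (by positivity)
    have hus : 0 ≤ u z ^ s := Real.rpow_nonneg hz _
    calc _ ≤ u z ^ s * (L * (volume.real C * v + L * (L * v))) := by gcongr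
      _ = _ := by ring
  calc _ ≤ ∫ z, L * (volume.real C + L * L) * u z ^ (s + 1 / (d : ℝ)) ∂ρ :=
        integral_mono ((hprod.integral_left (volume.restrict C)).integrable ρ)
          (((BddMeasurable.const _).mul (hpow _ (by positivity))).integrable ρ) h2
    _ = L * (volume.real C + L * L) * ∫ z, u z ^ (s + 1 / (d : ℝ)) ∂ρ := integral_const_mul _ _
    _ ≤ L * (volume.real C + L * L) * (7 * ((k : ℝ) / (m + 1)) ^ (s + 1 / (d : ℝ))) := by
        gcongr
        exact integral_nnMass_rpow_le hd h hπ hk hkm 0 (by positivity) (by linarith)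
    _ = _ := by ring

end

/-! ### Weighted sums of nearest neighbour volumes -/

/-- The volume of the ball about `y` that reaches to its `k`-th nearest point of `z`. -/
def nnVolume {d m : ℕ} (k : ℕ) (y : E d) (z : Fin m → E d) : ℝ :=
  unitBallVolume d * nnRadius k y z ^ d

lemma knnDist_eq_nnRadius {d m : ℕ} (k : ℕ) (x : Fin (m + 1) → E d) (i : Fin (m + 1)) :
    knnDist k x i = nnRadius k (x i) (fun j => x (i.succAbove j)) := by
  rw [nnRadius, knnDist_eq_kthValue]

lemma knnVolume_eq_nnVolume {d m : ℕ} (k : ℕ) (x : Fin (m + 1) → E d) (i : Fin (m + 1)) :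
    knnVolume k x i = nnVolume k (x i) (fun j => x (i.succAbove j)) := by
  rw [nnVolume, knnVolume, knnDist_eq_nnRadius]

/-- The sum of the square roots of the nearest neighbour volumes, with weights `w`. -/
def knnSum {d n : ℕ} (k : ℕ) (w : E d → ℝ) (x : Fin n → E d) : ℝ :=
  ∑ i, w (x i) * √(knnVolume k x i)

section

variable {d : ℕ} {f : E d → ℝ} {C : Set (E d)} {π : E d → E d} {D : ℝ} {m k : ℕ}

lemma nnVolume_nonneg (hD : ∀ x ∈ C, ∀ y ∈ C, dist x y ≤ D) (hk : 1 ≤ k) (hkm : k ≤ m)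
    {y : E d} (hy : y ∈ C) {z : Fin m → E d} (hz : ∀ j, z j ∈ C) : 0 ≤ nnVolume k y z :=
  mul_nonneg (unitBallVolume_pos d).le (pow_nonneg (nnRadius_mem hD hk hkm hy hz).1 d)

lemma bddMeasurable_nnVolume (hπ : IsRetraction C π) (hD : ∀ x ∈ C, ∀ y ∈ C, dist x y ≤ D)
    (hk : 1 ≤ k) (hkm : k ≤ m) :
    BddMeasurable fun p : E d × (Fin m → E d) => nnVolume k (π p.1) (fun j => π (p.2 j)) :=
  (BddMeasurable.const _).mul ((bddMeasurable_nnRadius hπ hD hk hkm).pow d)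

lemma measurable_eval_prod_succAbove (i : Fin (m + 1)) :
    Measurable fun x : Fin (m + 1) → E d => (x i, fun j => x (i.succAbove j)) :=
  (measurable_pi_apply i).prodMk (measurable_pi_lambda _ fun _ => measurable_pi_apply _)

lemma bddMeasurable_knnVolume (hπ : IsRetraction C π) (hD : ∀ x ∈ C, ∀ y ∈ C, dist x y ≤ D)
    (hk : 1 ≤ k) (hkm : k ≤ m) (i : Fin (m + 1)) :
    BddMeasurable fun x : Fin (m + 1) → E d => knnVolume k (fun j => π (x j)) i := by
  simp only [knnVolume_eq_nnVolume]
  exact (bddMeasurable_nnVolume hπ hD hk hkm).comp (measurable_eval_prod_succAbove i)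

lemma bddMeasurable_knnSum (hπ : IsRetraction C π) (hD : ∀ x ∈ C, ∀ y ∈ C, dist x y ≤ D)
    (hk : 1 ≤ k) (hkm : k ≤ m) {w : E d → ℝ} (hw : BddMeasurable w) :
    BddMeasurable fun x : Fin (m + 1) → E d => knnSum k w (fun j => π (x j)) :=
  BddMeasurable.sum _ fun i => (hw.comp (hπ.measurable.comp (measurable_pi_apply i))).mul
    (bddMeasurable_knnVolume hπ hD hk hkm i).sqrt

lemma integral_knnSum (hπ : IsRetraction C π) (hD : ∀ x ∈ C, ∀ y ∈ C, dist x y ≤ D)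
    (μ : Measure (E d)) [IsProbabilityMeasure μ]
    (hk : 1 ≤ k) (hkm : k ≤ m) {w : E d → ℝ} (hw : BddMeasurable w) :
    ∫ x, knnSum k w (fun j => π (x j)) ∂(Measure.pi fun _ : Fin (m + 1) => μ)
      = (m + 1) * ∫ y, w (π y) * ∫ z, √(nnVolume k (π y) (fun j => π (z j)))
          ∂(Measure.pi fun _ : Fin m => μ) ∂μ := by
  have hterm : ∀ i : Fin (m + 1), BddMeasurable fun x : Fin (m + 1) → E d =>
      w (π (x i)) * √(knnVolume k (fun j => π (x j)) i) := fun i =>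
    (hw.comp (hπ.measurable.comp (measurable_pi_apply i))).mul
      (bddMeasurable_knnVolume hπ hD hk hkm i).sqrt
  simp only [knnSum]
  rw [integral_finsetSum _ fun i _ => (hterm i).integrable _]
  have h1 : ∀ i : Fin (m + 1), ∫ x, w (π (x i)) * √(knnVolume k (fun j => π (x j)) i)
        ∂(Measure.pi fun _ : Fin (m + 1) => μ)
      = ∫ y, w (π y) * ∫ z, √(nnVolume k (π y) (fun j => π (z j)))
          ∂(Measure.pi fun _ : Fin m => μ) ∂μ := by
    intro i
    rw [integral_pi_succAbove μ i (hterm i)]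
    simp only [knnVolume_eq_nnVolume, Fin.insertNth_apply_same, Fin.insertNth_apply_succAbove,
      integral_const_mul]
  simp [h1]

lemma DensityAssumption.integral_eq_setIntegral (h : DensityAssumption f C) (g : E d → ℝ) :
    ∫ y, g y ∂(densityMeasure f) = ∫ y in C, f y * g y := by
  rw [h.integral_densityMeasure, setIntegral_eq_integral_of_forall_compl_eq_zero]
  intro x hx
  rw [h.zero_off x hx, zero_mul]

/-- The mean of a weighted sum of the square roots of nearest neighbour volumes. -/
theorem exists_bias_le (hd : 0 < d) (h : DensityAssumption f C)
    [IsProbabilityMeasure (densityMeasure f)] (hπ : IsRetraction C π)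
    (hD0 : 0 < D) (hD : ∀ x ∈ C, ∀ y ∈ C, dist x y ≤ D) :
    ∃ A : ℝ, 0 ≤ A ∧ ∀ m k : ℕ, 1 ≤ k → k ≤ m → ∀ w : E d → ℝ, Measurable w →
      ∀ M : ℝ, (∀ x, |w x| ≤ M) →
      |∫ x, knnSum k w (fun j => π (x j)) ∂(Measure.pi fun _ : Fin (m + 1) => densityMeasure f)
        - (m + 1) * (betaMoment m k (1 / 2) * ∫ y in C, w y * √(f y))|
      ≤ (m + 1) * (A * M * ((k : ℝ) / (m + 1)) ^ (1 / 2 + 1 / (d : ℝ))) := by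
  obtain ⟨L, hL0, hLvol, hL⟩ := h.exists_massError hd hD0 hD
  obtain ⟨K, hK0, hK⟩ := exists_integral_massError_le hd h hπ hL0 hLvol
  obtain ⟨a, ha0, ha⟩ := h.bounded
  have hfin : IsFiniteMeasure (volume.restrict C) := ⟨by simpa using h.compact.measure_lt_top⟩
  refine ⟨√a * K, by positivity, fun m k hk hkm w hwm M hwM => ?_⟩
  have hw : BddMeasurable w := ⟨hwm, M, hwM⟩
  have hM0 : 0 ≤ M := (abs_nonneg _).trans (hwM 0)
  set ρ := Measure.pi fun _ : Fin m => densityMeasure f with hρ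
  set V : E d × (Fin m → E d) → ℝ := fun p => nnVolume k (π p.1) (fun j => π (p.2 j)) with hV
  set U : E d × (Fin m → E d) → ℝ := fun p => nnMass f k (π p.1) (fun j => π (p.2 j)) with hU
  have hVb : BddMeasurable V := bddMeasurable_nnVolume hπ hD hk hkm
  have hUb : BddMeasurable U := bddMeasurable_nnMass hπ hk hkm
  have hU0 : ∀ p, U p ∈ Set.Icc (0 : ℝ) 1 := fun p => nnMass_mem _ _
  have hV0 : ∀ p, 0 ≤ V p := fun p =>
    nnVolume_nonneg hD hk hkm (hπ.mem p.1) fun j => hπ.mem (p.2 j)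
  have hfb : BddMeasurable f := ⟨h.measurable, a, fun x => by
    rw [abs_of_nonneg (h.nonneg x)]; exact ha x⟩
  have hsec : ∀ {g : E d × (Fin m → E d) → ℝ}, BddMeasurable g → ∀ y,
      BddMeasurable fun z => g (y, z) := fun hg y => hg.comp measurable_prodMk_left
  have herr : BddMeasurable fun p : E d × (Fin m → E d) =>
      U p ^ (1 / 2 : ℝ) * DensityAssumption.massError C L p.1 (U p) := by
    refine BddMeasurable.mul ?_ ⟨(DensityAssumption.measurable_massError C L).comp
      (measurable_fst.prodMk hUb.measurable), 2 * L, fun p => ?_⟩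
    · simpa only [Real.sqrt_eq_rpow] using hUb.sqrt
    · rw [abs_of_nonneg (DensityAssumption.massError_nonneg hL0 _ (hU0 _).1)]
      exact DensityAssumption.massError_le hL0 _ (hU0 _).1 (hU0 _).2
  rw [integral_knnSum hπ hD _ hk hkm hw, ← mul_sub, abs_mul,
    abs_of_nonneg (by positivity : (0 : ℝ) ≤ m + 1)]
  refine mul_le_mul_of_nonneg_left ?_ (by positivity)
  rw [h.integral_eq_setIntegral]
  have e3 : betaMoment m k (1 / 2) * ∫ y in C, w y * √(f y)
      = ∫ y in C, w y * √(f y) * ∫ z, √(U (y, z)) ∂ρ := by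
    rw [← integral_const_mul]
    refine integral_congr_ae (ae_of_all _ fun y => ?_)
    simp only [Real.sqrt_eq_rpow, hU]
    rw [integral_nnMass_rpow hd h hπ hk hkm (π y) (by norm_num), mul_comm]
  have b1 : BddMeasurable fun y => f y * (w (π y) * ∫ z, √(V (y, z)) ∂ρ) :=
    hfb.mul ((hw.comp hπ.measurable).mul (hVb.sqrt.integral_right ρ))
  have b2 : BddMeasurable fun y => w y * √(f y) * ∫ z, √(U (y, z)) ∂ρ :=
    (hw.mul hfb.sqrt).mul (hUb.sqrt.integral_right ρ)
  rw [e3, ← integral_sub (b1.integrable _) (b2.integrable _), ← Real.norm_eq_abs]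
  have b3 : BddMeasurable fun y => √a * M *
      ∫ z, U (y, z) ^ (1 / 2 : ℝ) * DensityAssumption.massError C L y (U (y, z)) ∂ρ :=
    (BddMeasurable.const _).mul (herr.integral_right ρ)
  refine (norm_integral_le_of_norm_le (b3.integrable _) ?_).trans ?_
  · refine (ae_restrict_iff' h.measurableSet).2 (ae_of_all _ fun y hy => ?_)
    have hfy := h.nonneg y
    -- Writing f√V = √f √(fV) reduces the bias to the comparison of √(fV) with √U.
    have e4 : f y * (w (π y) * ∫ z, √(V (y, z)) ∂ρ) - w y * √(f y) * ∫ z, √(U (y, z)) ∂ρ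
        = w y * √(f y) * ∫ z, (√(f y * V (y, z)) - √(U (y, z))) ∂ρ := by
      simp only [Real.sqrt_mul hfy]
      rw [integral_sub (((BddMeasurable.const _).mul (hsec hVb.sqrt y)).integrable _)
        ((hsec hUb.sqrt y).integrable _), integral_const_mul, hπ.eq y hy]
      nth_rewrite 1 [← Real.mul_self_sqrt hfy]
      ring
    rw [e4, norm_mul, norm_mul, Real.norm_of_nonneg (Real.sqrt_nonneg _)]
    refine mul_le_mul ?_ ?_ (norm_nonneg _) (by positivity)
    · rw [mul_comm]
      exact mul_le_mul (Real.sqrt_le_sqrt (ha y)) (hwM y) (abs_nonneg _) (Real.sqrt_nonneg _)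
    · refine norm_integral_le_of_norm_le ((hsec herr y).integrable _) (ae_of_all _ fun z => ?_)
      simp only [← Real.sqrt_eq_rpow]
      have hr := nnRadius_mem hD hk hkm (hπ.mem y) (z := fun j => π (z j)) fun j => hπ.mem (z j)
      have h5 := hL (π y) (hπ.mem y) _ hr.1 hr.2
      refine abs_sqrt_sub_sqrt_le (mul_nonneg hfy (hV0 _)) (hU0 _).1 ?_
      simp only [hU, hV, nnMass, nnVolume]
      simp only [hπ.eq y hy] at h5 ⊢
      exact h5
  · rw [integral_const_mul]
    calc _ ≤ √a * M * (K * ((k : ℝ) / (m + 1)) ^ (1 / 2 + 1 / (d : ℝ))) :=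
          mul_le_mul_of_nonneg_left (hK m k hk hkm (1 / 2) (by norm_num) (by norm_num))
            (by positivity)
      _ = _ := by ring

/-- Second moments of weighted nearest neighbour volumes. -/
theorem exists_second_moment_le (hd : 0 < d) (h : DensityAssumption f C)
    [IsProbabilityMeasure (densityMeasure f)] (hπ : IsRetraction C π)
    (hD0 : 0 < D) (hD : ∀ x ∈ C, ∀ y ∈ C, dist x y ≤ D) :
    ∃ K : ℝ, 0 ≤ K ∧ ∀ m k p : ℕ, 1 ≤ k → k ≤ m → p ≤ 1 → ∀ w : E d → ℝ, Measurable w →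
      ∀ M : ℝ, (∀ x, |w x| ≤ M) →
      ∫ y, w (π y) ^ 2 * ∫ z, nnVolume k (π y) (fun j => π (z j)) *
          nnMass f k (π y) (fun j => π (z j)) ^ p
          ∂(Measure.pi fun _ : Fin m => densityMeasure f) ∂(densityMeasure f)
        ≤ betaMoment m k (p + 1) * (∫ y in C, w y ^ 2)
          + K * M ^ 2 * ((k : ℝ) / (m + 1)) ^ (p + 1 + 1 / (d : ℝ)) := by
  obtain ⟨L, hL0, hLvol, hL⟩ := h.exists_massError hd hD0 hD
  obtain ⟨K, hK0, hK⟩ := exists_integral_massError_le hd h hπ hL0 hLvol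
  obtain ⟨a, ha0, ha⟩ := h.bounded
  have hfin : IsFiniteMeasure (volume.restrict C) := ⟨by simpa using h.compact.measure_lt_top⟩
  refine ⟨K, hK0, fun m k p hk hkm hp w hwm M hwM => ?_⟩
  have hw : BddMeasurable w := ⟨hwm, M, hwM⟩
  have hM0 : 0 ≤ M := (abs_nonneg _).trans (hwM 0)
  set ρ := Measure.pi fun _ : Fin m => densityMeasure f with hρ
  set V : E d × (Fin m → E d) → ℝ := fun p => nnVolume k (π p.1) (fun j => π (p.2 j)) with hV
  set U : E d × (Fin m → E d) → ℝ := fun p => nnMass f k (π p.1) (fun j => π (p.2 j)) with hU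
  have hVb : BddMeasurable V := bddMeasurable_nnVolume hπ hD hk hkm
  have hUb : BddMeasurable U := bddMeasurable_nnMass hπ hk hkm
  have hU0 : ∀ p, U p ∈ Set.Icc (0 : ℝ) 1 := fun p => nnMass_mem _ _
  have hfb : BddMeasurable f := ⟨h.measurable, a, fun x => by
    rw [abs_of_nonneg (h.nonneg x)]; exact ha x⟩
  have hsec : ∀ {g : E d × (Fin m → E d) → ℝ}, BddMeasurable g → ∀ y,
      BddMeasurable fun z => g (y, z) := fun hg y => hg.comp measurable_prodMk_left
  -- Replacing f V by U turns f V U^p into U^(p+1). The case p = 0 serves the deleted point and p =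
  -- 1 the points affected by the deletion.
  set s : ℝ := p + 1 with hs
  have hUs : ∀ q, U q ^ s = U q ^ (p + 1) := fun q => by
    rw [hs, ← Real.rpow_natCast]; push_cast; rfl
  have herr : BddMeasurable fun q : E d × (Fin m → E d) =>
      U q ^ s * DensityAssumption.massError C L q.1 (U q) := by
    refine BddMeasurable.mul ?_ ⟨(DensityAssumption.measurable_massError C L).comp
      (measurable_fst.prodMk hUb.measurable), 2 * L, fun p => ?_⟩
    · simpa only [hUs] using hUb.pow (p + 1)
    · rw [abs_of_nonneg (DensityAssumption.massError_nonneg hL0 _ (hU0 _).1)]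
      exact DensityAssumption.massError_le hL0 _ (hU0 _).1 (hU0 _).2
  have hUsb : BddMeasurable fun q => U q ^ s := by simpa only [hUs] using hUb.pow (p + 1)
  have hVU : BddMeasurable fun q => V q * U q ^ p := hVb.mul (hUb.pow p)
  rw [h.integral_eq_setIntegral]
  have b1 : BddMeasurable fun y => f y * (w (π y) ^ 2 * ∫ z, V (y, z) * U (y, z) ^ p ∂ρ) :=
    hfb.mul (((hw.comp hπ.measurable).pow 2).mul (hVU.integral_right ρ))
  have b2 : BddMeasurable fun y => w y ^ 2 * ∫ z, U (y, z) ^ s ∂ρ :=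
    (hw.pow 2).mul (hUsb.integral_right ρ)
  have b3 : BddMeasurable fun y => M ^ 2 *
      ∫ z, U (y, z) ^ s * DensityAssumption.massError C L y (U (y, z)) ∂ρ :=
    (BddMeasurable.const _).mul (herr.integral_right ρ)
  calc _ ≤ ∫ y in C, (w y ^ 2 * ∫ z, U (y, z) ^ s ∂ρ + M ^ 2 *
          ∫ z, U (y, z) ^ s * DensityAssumption.massError C L y (U (y, z)) ∂ρ) := by
        refine setIntegral_mono_on (b1.integrable _) ((b2.add b3).integrable _) h.measurableSet
          fun y hy => ?_
        have hfy := h.nonneg y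
        have e1 : f y * (w (π y) ^ 2 * ∫ z, V (y, z) * U (y, z) ^ p ∂ρ)
            = w y ^ 2 * ∫ z, f y * V (y, z) * U (y, z) ^ p ∂ρ := by
          simp only [mul_assoc]
          rw [integral_const_mul, hπ.eq y hy]
          ring
        have e2 : ∫ z, f y * V (y, z) * U (y, z) ^ p ∂ρ ≤ ∫ z, U (y, z) ^ s ∂ρ +
            ∫ z, U (y, z) ^ s * DensityAssumption.massError C L y (U (y, z)) ∂ρ := by
          rw [← integral_add ((hsec hUsb y).integrable _) ((hsec herr y).integrable _)]
          refine integral_mono ((((BddMeasurable.const _).mul (hsec hVb y)).mul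
            ((hsec hUb y).pow p)).integrable _)
            (((hsec hUsb y).add (hsec herr y)).integrable _) fun z => ?_
          have hr := nnRadius_mem hD hk hkm (hπ.mem y) (z := fun j => π (z j))
            fun j => hπ.mem (z j)
          have h5 := hL (π y) (hπ.mem y) _ hr.1 hr.2
          have h6 : f y * V (y, z) ≤ U (y, z)
              + U (y, z) * DensityAssumption.massError C L y (U (y, z)) := by
            have h7 := (abs_le.1 h5).2
            simp only [hU, hV, nnMass, nnVolume]
            simp only [hπ.eq y hy] at h7 ⊢
            linarith
          have h8 : 0 ≤ U (y, z) ^ p := pow_nonneg (hU0 _).1 p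
          simp only [hUs]
          calc _ ≤ (U (y, z) + U (y, z) * DensityAssumption.massError C L y (U (y, z)))
                * U (y, z) ^ p := mul_le_mul_of_nonneg_right h6 h8
            _ = _ := by ring
        have h9 : 0 ≤ ∫ z, U (y, z) ^ s * DensityAssumption.massError C L y (U (y, z)) ∂ρ :=
          integral_nonneg fun z => mul_nonneg (Real.rpow_nonneg (hU0 _).1 _)
            (DensityAssumption.massError_nonneg hL0 _ (hU0 _).1)
        have h10 : w y ^ 2 ≤ M ^ 2 := sq_le_sq' (abs_le.1 (hwM y)).1 (abs_le.1 (hwM y)).2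
        change f y * (w (π y) ^ 2 * ∫ z, V (y, z) * U (y, z) ^ p ∂ρ) ≤ _
        rw [e1]
        calc _ ≤ w y ^ 2 * (∫ z, U (y, z) ^ s ∂ρ +
            ∫ z, U (y, z) ^ s * DensityAssumption.massError C L y (U (y, z)) ∂ρ) := by gcongr
          _ ≤ _ := by rw [mul_add]; gcongr
    _ = betaMoment m k s * (∫ y in C, w y ^ 2) + M ^ 2 * ∫ y in C,
          ∫ z, U (y, z) ^ s * DensityAssumption.massError C L y (U (y, z)) ∂ρ := by
        rw [integral_add (b2.integrable _) (b3.integrable _), integral_const_mul (M ^ 2),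
          ← integral_const_mul (betaMoment m k s)]
        congr 1
        refine integral_congr_ae (ae_of_all _ fun y => ?_)
        simp only [hU]
        rw [integral_nnMass_rpow hd h hπ hk hkm (π y) (by positivity), mul_comm]
    _ ≤ betaMoment m k s * (∫ y in C, w y ^ 2)
        + M ^ 2 * (K * ((k : ℝ) / (m + 1)) ^ (s + 1 / (d : ℝ))) := by
        gcongr
        refine hK m k hk hkm s (by positivity) ?_
        have : (p : ℝ) ≤ 1 := by exact_mod_cast hp
        linarith
    _ = _ := by ring

end

/-! ### The variance of weighted sums of nearest neighbour volumes -/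

lemma sq_add_sum_le {ι : Type*} (J : Finset ι) (a : ℝ) (b : ι → ℝ) :
    (a + ∑ i ∈ J, b i) ^ 2 ≤ (1 + J.card) * (a ^ 2 + ∑ i ∈ J, b i ^ 2) := by
  have h1 : (∑ i ∈ J, b i) ^ 2 ≤ J.card * ∑ i ∈ J, b i ^ 2 := sq_sum_le_card_mul_sum_sq
  set s := ∑ i ∈ J, b i
  set B := ∑ i ∈ J, b i ^ 2
  rcases J.card.eq_zero_or_pos with h0 | h0
  · have hs : s = 0 := by simp [s, Finset.card_eq_zero.1 h0]
    have hB : 0 ≤ B := Finset.sum_nonneg fun _ _ => sq_nonneg _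
    rw [h0, hs]
    simp only [CharP.cast_eq_zero]
    linarith
  · have hJ : (0 : ℝ) < J.card := by exact_mod_cast h0
    set c : ℝ := (J.card : ℝ)
    -- This is the square of c a - s, with s² replaced by its upper bound c B; it controls the cross
    -- term.
    have h2 : 0 ≤ c * (c * a ^ 2 - 2 * a * s + B) := by nlinarith [sq_nonneg (c * a - s)]
    have h3 := nonneg_of_mul_nonneg_right h2 hJ
    nlinarith

section

variable {d : ℕ} {f : E d → ℝ} {C : Set (E d)} {π : E d → E d} {D : ℝ} {m k : ℕ}

open Classical in
/-- The effect of deleting one point on a weighted sum of nearest neighbour volumes. -/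
lemma sq_knnSum_sub_le {γ : ℕ}
    (hγ : ∀ (m k : ℕ), 1 ≤ k → k ≤ m → ∀ (x : Fin (m + 1) → E d) (p : E d),
      (Finset.univ.filter (fun i => dist p (x i) < knnDist k x i)).card ≤ γ * k)
    (hk : 1 ≤ k) (hkm : k ≤ m) (w : E d → ℝ) (x : Fin (m + 1 + 1) → E d) (a : Fin (m + 1 + 1)) :
    (knnSum k w x - knnSum k w (fun j => x (a.succAbove j))) ^ 2
      ≤ (1 + γ * k) * (w (x a) ^ 2 * knnVolume k x a +
        ∑ i, if dist (x a) (x (a.succAbove i)) < knnDist k (fun j => x (a.succAbove j)) i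
          then w (x (a.succAbove i)) ^ 2 * knnVolume k (fun j => x (a.succAbove j)) i else 0) := by
  set y : Fin (m + 1) → E d := fun j => x (a.succAbove j) with hy
  set J := Finset.univ.filter (fun i => dist (x a) (y i) < knnDist k y i) with hJ
  have hc := (unitBallVolume_pos d).le
  have hVy : ∀ i, 0 ≤ knnVolume k y i := fun i =>
    mul_nonneg hc (pow_nonneg (knnDist_nonneg hk y i) d)
  have hVx : ∀ i, 0 ≤ knnVolume k x i := fun i =>
    mul_nonneg hc (pow_nonneg (knnDist_nonneg hk x i) d)
  have hle : ∀ i, knnVolume k x (a.succAbove i) ≤ knnVolume k y i := fun i =>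
    mul_le_mul_of_nonneg_left (pow_le_pow_left₀ (knnDist_nonneg hk x _)
      (knnDist_succAbove_le hk hkm x a i) d) hc
  -- Besides the term of the deleted point, only points with the deleted point strictly inside their
  -- neighbour ball contribute; these form `J`.
  have hdiff : knnSum k w x - knnSum k w y = w (x a) * √(knnVolume k x a) +
      ∑ i ∈ J, w (y i) * (√(knnVolume k x (a.succAbove i)) - √(knnVolume k y i)) := by
    rw [knnSum, Fin.sum_univ_succAbove _ a, knnSum, add_sub_assoc, ← Finset.sum_sub_distrib]
    congr 1
    have h1 : ∀ i, w (x (a.succAbove i)) * √(knnVolume k x (a.succAbove i)) -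
        w (y i) * √(knnVolume k y i)
        = w (y i) * (√(knnVolume k x (a.succAbove i)) - √(knnVolume k y i)) := fun i =>
      (mul_sub _ _ _).symm
    rw [Finset.sum_congr rfl fun i _ => h1 i]
    refine (Finset.sum_subset (Finset.subset_univ J) fun i _ hi => ?_).symm
    have : knnDist k x (a.succAbove i) = knnDist k y i :=
      knnDist_succAbove_eq hk hkm x a i (not_lt.1 fun h => hi (Finset.mem_filter.2 ⟨Finset.mem_univ i, h⟩))
    rw [knnVolume, knnVolume, this, sub_self, mul_zero]
  have hJc : (J.card : ℝ) ≤ γ * k := by exact_mod_cast hγ m k hk hkm y (x a)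
  rw [hdiff]
  refine (sq_add_sum_le _ _ _).trans ?_
  rw [← Finset.sum_filter]
  refine mul_le_mul (by linarith) (add_le_add (le_of_eq ?_) (Finset.sum_le_sum fun i _ => ?_))
    (add_nonneg (sq_nonneg _) (Finset.sum_nonneg fun _ _ => sq_nonneg _)) (by positivity)
  · rw [mul_pow, Real.sq_sqrt (hVx a)]
  · rw [mul_pow]
    refine mul_le_mul_of_nonneg_left ?_ (sq_nonneg _)
    -- Restoring the point can only shrink the volume, so the change of the root lies between minus
    -- the old root and 0.
    calc (√(knnVolume k x (a.succAbove i)) - √(knnVolume k y i)) ^ 2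
        ≤ √(knnVolume k y i) ^ 2 := by
          refine sq_le_sq' ?_ ?_
          · linarith [Real.sqrt_nonneg (knnVolume k x (a.succAbove i))]
          · linarith [Real.sqrt_le_sqrt (hle i), Real.sqrt_nonneg (knnVolume k y i)]
      _ = knnVolume k y i := Real.sq_sqrt (hVy i)

/-- The expected effect of deleting one point. -/
lemma integral_sq_knnSum_sub_le {γ : ℕ}
    (hγ : ∀ (m k : ℕ), 1 ≤ k → k ≤ m → ∀ (x : Fin (m + 1) → E d) (p : E d),
      (Finset.univ.filter (fun i => dist p (x i) < knnDist k x i)).card ≤ γ * k)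
    (h : DensityAssumption f C)
    [IsProbabilityMeasure (densityMeasure f)] (hπ : IsRetraction C π)
    (hD : ∀ x ∈ C, ∀ y ∈ C, dist x y ≤ D)
    (hk : 1 ≤ k) (hkm : k ≤ m) {w : E d → ℝ} (hw : BddMeasurable w) (a : Fin (m + 1 + 1)) :
    ∫ x, (knnSum k w (fun j => π (x j)) - knnSum k w (fun j => π (x (a.succAbove j)))) ^ 2
        ∂(Measure.pi fun _ => densityMeasure f)
      ≤ (1 + γ * k) *
        (∫ y, w (π y) ^ 2 * ∫ z, nnVolume k (π y) (fun j => π (z j)) *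
            nnMass f k (π y) (fun j => π (z j)) ^ 0
            ∂(Measure.pi fun _ : Fin (m + 1) => densityMeasure f) ∂(densityMeasure f)
        + (m + 1) * ∫ y, w (π y) ^ 2 * ∫ z, nnVolume k (π y) (fun j => π (z j)) *
            nnMass f k (π y) (fun j => π (z j)) ^ 1
            ∂(Measure.pi fun _ : Fin m => densityMeasure f) ∂(densityMeasure f)) := by
  classical
  set μ := densityMeasure f with hμ
  have hwπ : ∀ {n : ℕ} (i : Fin n), BddMeasurable fun x : Fin n → E d => w (π (x i)) ^ 2 :=
    fun i => (hw.comp (hπ.measurable.comp (measurable_pi_apply i))).pow 2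
  -- the term of the deleted point
  set A : (Fin (m + 1 + 1) → E d) → ℝ := fun x =>
    w (π (x a)) ^ 2 * knnVolume k (fun j => π (x j)) a with hA
  have hAb : BddMeasurable A :=
    (hwπ a).mul (bddMeasurable_knnVolume hπ hD hk (hkm.trans (Nat.le_succ m)) a)
  -- the terms of the other points
  set B : Fin (m + 1) → (Fin (m + 1) → E d) → ℝ := fun i y =>
    w (π (y i)) ^ 2 * knnVolume k (fun j => π (y j)) i with hB
  have hBb : ∀ i, BddMeasurable (B i) := fun i =>
    (hwπ i).mul (bddMeasurable_knnVolume hπ hD hk hkm i)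
  have hB0 : ∀ i y, 0 ≤ B i y := fun i y => mul_nonneg (sq_nonneg _)
    (mul_nonneg (unitBallVolume_pos d).le (pow_nonneg (knnDist_nonneg hk _ i) d))
  set S : Fin (m + 1) → Set (E d × (Fin (m + 1) → E d)) := fun i =>
    {q | dist (π q.1) (π (q.2 i)) < knnDist k (fun j => π (q.2 j)) i} with hS
  have hSm : ∀ i, MeasurableSet (S i) := by
    intro i
    have h1 : Measurable fun y : Fin (m + 1) → E d => knnDist k (fun j => π (y j)) i := by
      simp only [knnDist_eq_nnRadius]
      exact (bddMeasurable_nnRadius hπ hD hk hkm).measurable.comp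
        (measurable_eval_prod_succAbove i)
    exact measurableSet_lt ((hπ.measurable.comp measurable_fst).dist
      (hπ.measurable.comp ((measurable_pi_apply i).comp measurable_snd))) (h1.comp measurable_snd)
  set H : Fin (m + 1) → E d × (Fin (m + 1) → E d) → ℝ := fun i =>
    (S i).indicator fun q => B i q.2 with hH
  have hHb : ∀ i, BddMeasurable (H i) := fun i =>
    ((hBb i).comp measurable_snd).indicator (hSm i)
  have hHx : ∀ i, BddMeasurable fun x : Fin (m + 1 + 1) → E d =>
      H i (x a, fun j => x (a.succAbove j)) := fun i =>
    (hHb i).comp (measurable_eval_prod_succAbove a)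
  have hT := bddMeasurable_knnSum hπ hD hk (hkm.trans (Nat.le_succ m)) hw
  have hT' : BddMeasurable fun x : Fin (m + 1 + 1) → E d =>
      knnSum k w (fun j => π (x (a.succAbove j))) :=
    (bddMeasurable_knnSum hπ hD hk hkm hw).comp
      (measurable_pi_lambda _ fun _ => measurable_pi_apply _)
  have hbound : BddMeasurable fun x : Fin (m + 1 + 1) → E d =>
      (1 + γ * k : ℝ) * (A x + ∑ i, H i (x a, fun j => x (a.succAbove j))) :=
    (BddMeasurable.const _).mul (hAb.add (BddMeasurable.sum _ hHx))
  have hIA : ∫ x, A x ∂(Measure.pi fun _ => μ)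
      = ∫ y, w (π y) ^ 2 * ∫ z, nnVolume k (π y) (fun j => π (z j)) *
            nnMass f k (π y) (fun j => π (z j)) ^ 0
            ∂(Measure.pi fun _ : Fin (m + 1) => μ) ∂μ := by
    rw [integral_pi_succAbove μ a hAb]
    simp only [hA, knnVolume_eq_nnVolume, Fin.insertNth_apply_same,
      Fin.insertNth_apply_succAbove, integral_const_mul, pow_zero, mul_one]
  have hIH : ∀ i, ∫ x : Fin (m + 1 + 1) → E d, H i (x a, fun j => x (a.succAbove j))
        ∂(Measure.pi fun _ => μ)
      ≤ ∫ y, w (π y) ^ 2 * ∫ z, nnVolume k (π y) (fun j => π (z j)) *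
            nnMass f k (π y) (fun j => π (z j)) ^ 1
            ∂(Measure.pi fun _ : Fin m => μ) ∂μ := by
    intro i
    rw [integral_pi_succAbove' μ a (hHx i)]
    simp only [Fin.insertNth_apply_same, Fin.insertNth_apply_succAbove]
    have hM : BddMeasurable fun y : Fin (m + 1) → E d =>
        B i y * nnMass f k (π (y i)) (fun j => π (y (i.succAbove j))) :=
      (hBb i).mul ((bddMeasurable_nnMass hπ hk hkm).comp (measurable_eval_prod_succAbove i))
    calc ∫ y, ∫ p, H i (p, y) ∂μ ∂(Measure.pi fun _ : Fin (m + 1) => μ)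
        ≤ ∫ y, B i y * nnMass f k (π (y i)) (fun j => π (y (i.succAbove j)))
            ∂(Measure.pi fun _ : Fin (m + 1) => μ) := by
          refine integral_mono (((hHb i).integral_left μ).integrable _) (hM.integrable _)
            fun y => ?_
          -- Given the other points, the deleted one falls in the neighbour ball of point `i` with
          -- probability at most the mass of that ball; this is where the additional factor `nnMass`
          -- comes from.
          have h1 : ∫ p, H i (p, y) ∂μ
              = ∫ p, ((fun p => (p, y)) ⁻¹' S i).indicator (fun _ => B i y) p ∂μ := rfl
          simp only
          rw [h1, integral_indicator_const _ (measurable_prodMk_right (hSm i)), smul_eq_mul,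
            mul_comm]
          refine mul_le_mul_of_nonneg_left ?_ (hB0 i y)
          rw [nnMass, ← knnDist_eq_nnRadius k (fun j => π (y j)) i]
          refine ENNReal.toReal_mono (measure_ne_top _ _) (measure_mono_ae ?_)
          filter_upwards [h.ae_mem] with p hp hpS
          have : dist (π p) (π (y i)) < knnDist k (fun j => π (y j)) i := hpS
          rw [hπ.eq p hp] at this
          exact this.le
      _ = _ := by
          rw [integral_pi_succAbove μ i hM]
          simp only [hB, knnVolume_eq_nnVolume, Fin.insertNth_apply_same,
            Fin.insertNth_apply_succAbove, pow_one, mul_assoc, integral_const_mul]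
  calc _ ≤ ∫ x : Fin (m + 1 + 1) → E d, (1 + γ * k : ℝ) *
          (A x + ∑ i, H i (x a, fun j => x (a.succAbove j))) ∂(Measure.pi fun _ => μ) := by
        refine integral_mono (((hT.sub hT').pow 2).integrable _) (hbound.integrable _) fun x => ?_
        refine (sq_knnSum_sub_le hγ hk hkm w (fun j => π (x j)) a).trans (le_of_eq ?_)
        simp only [hA, hH, hB, hS, Set.indicator_apply, Set.mem_ofPred_eq]
    _ = (1 + γ * k : ℝ) * (∫ x, A x ∂(Measure.pi fun _ => μ)
          + ∑ i, ∫ x : Fin (m + 1 + 1) → E d, H i (x a, fun j => x (a.succAbove j))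
            ∂(Measure.pi fun _ => μ)) := by
        rw [integral_const_mul, integral_add (hAb.integrable _)
          ((BddMeasurable.sum _ hHx).integrable _),
          integral_finsetSum _ fun i _ => (hHx i).integrable _]
    _ ≤ _ := by
        rw [hIA]
        refine mul_le_mul_of_nonneg_left (add_le_add le_rfl ?_) (by positivity)
        refine (Finset.sum_le_sum fun i _ => hIH i).trans (le_of_eq ?_)
        simp

/-- The variance of a weighted sum of the square roots of nearest neighbour volumes. -/
theorem exists_variance_le {γ : ℕ}
    (hγ : ∀ (m k : ℕ), 1 ≤ k → k ≤ m → ∀ (x : Fin (m + 1) → E d) (p : E d),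
      (Finset.univ.filter (fun i => dist p (x i) < knnDist k x i)).card ≤ γ * k)
    (hd : 0 < d) (h : DensityAssumption f C)
    [IsProbabilityMeasure (densityMeasure f)] (hπ : IsRetraction C π)
    (hD0 : 0 < D) (hD : ∀ x ∈ C, ∀ y ∈ C, dist x y ≤ D) :
    ∃ K : ℝ, 0 ≤ K ∧ ∀ m k : ℕ, 1 ≤ k → k ≤ m → ∀ w : E d → ℝ, Measurable w →
      ∀ M : ℝ, (∀ x, |w x| ≤ M) →
      ∫ x, knnSum k w (fun j => π (x j)) ^ 2
          ∂(Measure.pi fun _ : Fin (m + 1 + 1) => densityMeasure f)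
        - (∫ x, knnSum k w (fun j => π (x j))
          ∂(Measure.pi fun _ : Fin (m + 1 + 1) => densityMeasure f)) ^ 2
      ≤ 3 * (1 + γ) * (k : ℝ) ^ 3 * ((∫ y in C, w y ^ 2)
          + K * M ^ 2 * ((k : ℝ) / (m + 1)) ^ (1 / (d : ℝ))) := by
  obtain ⟨K, hK0, hK⟩ := exists_second_moment_le hd h hπ hD0 hD
  refine ⟨K, hK0, fun m k hk hkm w hwm M hwM => ?_⟩
  have hw : BddMeasurable w := ⟨hwm, M, hwM⟩
  have hT := bddMeasurable_knnSum hπ hD hk (hkm.trans (Nat.le_succ m)) hw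
  have hES := efronStein (densityMeasure f) hT
    (S := fun a x => knnSum k w (fun j => π (x (a.succAbove j))))
    (fun a => (bddMeasurable_knnSum hπ hD hk hkm hw).comp
      (measurable_pi_lambda _ fun _ => measurable_pi_apply _))
    (fun a x x' hx => by
      congr 1
      funext j
      rw [hx _ (Fin.succAbove_ne a j)])
  refine hES.trans ((Finset.sum_le_sum fun a _ =>
    integral_sq_knnSum_sub_le hγ h hπ hD hk hkm hw a).trans ?_)
  -- The deleted point sees all m + 1 others, whereas an affected point is considered in the reduced
  -- sample and sees only m.
  have h1 := hK (m + 1) k 0 hk (hkm.trans (Nat.le_succ m)) (by norm_num) w hwm M hwM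
  have h2 := hK m k 1 hk hkm le_rfl w hwm M hwM
  set I := ∫ y in C, w y ^ 2 with hI
  have hI0 : 0 ≤ I := integral_nonneg fun _ => sq_nonneg _
  have hk1 : (1 : ℝ) ≤ k := by exact_mod_cast hk
  set c : ℝ := (k : ℝ) / (m + 1) with hc
  have hc0 : 0 < c := by positivity
  set η := c ^ (1 / (d : ℝ)) with hη
  have hη0 : 0 ≤ η := by positivity
  set Q := K * M ^ 2 with hQ
  have hQ0 : 0 ≤ Q := by positivity
  have e1 : betaMoment (m + 1) k ((0 : ℕ) + 1) = k / (m + 2) := by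
    rw [Nat.cast_zero, zero_add, betaMoment_one _ hk]; push_cast; ring
  have e2 : betaMoment m k ((1 : ℕ) + 1) = k / (m + 1) * ((k + 1) / (m + 2)) := by
    rw [Nat.cast_one, one_add_one_eq_two, betaMoment_two _ hk]; ring
  have e3 : ((k : ℝ) / ((m + 1 : ℕ) + 1)) ^ (((0 : ℕ) : ℝ) + 1 + 1 / (d : ℝ))
      ≤ k / (m + 2) * η := by
    rw [Nat.cast_zero, zero_add, Real.rpow_add (by positivity), Real.rpow_one]
    have : ((m + 1 : ℕ) : ℝ) + 1 = m + 2 := by push_cast; ring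
    rw [this]
    gcongr
    rw [hη, hc]
    gcongr
    linarith
  have e4 : c ^ (((1 : ℕ) : ℝ) + 1 + 1 / (d : ℝ)) = c ^ 2 * η := by
    rw [Real.rpow_add hc0, Nat.cast_one, one_add_one_eq_two, Real.rpow_two]
  rw [e1] at h1
  rw [e2, e4] at h2
  have h1' := h1.trans (add_le_add_right (mul_le_mul_of_nonneg_left e3 hQ0) _)
  rw [Finset.sum_const, Finset.card_univ, Fintype.card_fin, nsmul_eq_mul]
  push_cast
  have hγ0 : (0 : ℝ) ≤ γ := Nat.cast_nonneg γ
  have hm2 : (0 : ℝ) < m + 2 := by positivity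
  -- The m + 2 deletions cancel the denominator m + 2. What remains has at most the factor (1 + γ)k
  -- from counting affected points and 3k² from k + k(k + 1), whence the power k³.
  calc _ ≤ ((m : ℝ) + 1 + 1) * ((1 + γ * k) * ((k / (m + 2) * I + Q * (k / (m + 2) * η))
        + (m + 1) * (k / (m + 1) * ((k + 1) / (m + 2)) * I + Q * (c ^ 2 * η)))) := by gcongr
    _ = (1 + γ * k) * ((k + k * (k + 1)) * I
          + (k + k ^ 2 * (1 + 1 / (m + 1))) * (Q * η)) := by
        rw [hc]; field_simp; ring
    _ ≤ ((1 + γ) * k) * ((3 * k ^ 2) * I + (3 * k ^ 2) * (Q * η)) := by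
        have h3 : (1 : ℝ) / (m + 1) ≤ 1 := by
          rw [div_le_one (by positivity)]; linarith [Nat.cast_nonneg (α := ℝ) m]
        gcongr
        · nlinarith
        · nlinarith
        · nlinarith
    _ = _ := by ring

end

/-! ### Bounded functions of bounded support and their dilates -/

/-- Measurable functions bounded by `M` that vanish off the ball of radius `ρ`. -/
structure IsWindow {d : ℕ} (g : E d → ℝ) (ρ M : ℝ) : Prop where
  meas : AEStronglyMeasurable g (volume : Measure (E d))
  bound : ∀ x, |g x| ≤ M
  supp : ∀ x, g x ≠ 0 → ‖x‖ ≤ ρ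

namespace IsWindow

variable {d : ℕ} {g h : E d → ℝ} {ρ M M' : ℝ}

lemma bound_nonneg (hg : IsWindow g ρ M) : 0 ≤ M := (abs_nonneg _).trans (hg.bound 0)

lemma memLp (hg : IsWindow g ρ M) (p : ENNReal) : MemLp g p volume := by
  have h1 : g = (Metric.closedBall (0 : E d) ρ).indicator g := by
    refine (Set.indicator_eq_self.2 fun x hx => ?_).symm
    simpa using hg.supp x hx
  have : IsFiniteMeasure (volume.restrict (Metric.closedBall (0 : E d) ρ)) :=
    ⟨by simpa using measure_closedBall_lt_top⟩
  rw [h1, memLp_indicator_iff_restrict Metric.isClosed_closedBall.measurableSet]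
  exact MemLp.of_bound hg.meas.restrict M (ae_of_all _ hg.bound)

lemma integrable (hg : IsWindow g ρ M) : Integrable g := memLp_one_iff_integrable.1 (hg.memLp 1)

lemma const_mul (hg : IsWindow g ρ M) (c : ℝ) : IsWindow (fun x => c * g x) ρ (|c| * M) where
  meas := hg.meas.const_mul c
  bound x := by
    rw [abs_mul]
    exact mul_le_mul_of_nonneg_left (hg.bound x) (abs_nonneg c)
  supp x hx := hg.supp x (right_ne_zero_of_mul hx)

lemma mul (hg : IsWindow g ρ M) (hh : AEStronglyMeasurable h volume) (hb : ∀ x, |h x| ≤ M') :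
    IsWindow (fun x => g x * h x) ρ (M * M') where
  meas := hg.meas.mul hh
  bound x := by
    rw [abs_mul]
    exact mul_le_mul (hg.bound x) (hb x) (abs_nonneg _) hg.bound_nonneg
  supp x hx := hg.supp x (left_ne_zero_of_mul hx)

end IsWindow

section Dilates

variable {d : ℕ} {g h : E d → ℝ} {ρ ρ' M M' : ℝ}

lemma quasiMeasurePreserving_smul_sub {c : ℝ} (hc : c ≠ 0) (v : E d) :
    Measure.QuasiMeasurePreserving (fun x : E d => c • x - v) volume volume := by
  have h1 : Measure.QuasiMeasurePreserving (fun x : E d => c • x) volume volume :=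
    ⟨measurable_const_smul c, by
      rw [Measure.map_addHaar_smul volume hc]
      exact Measure.smul_absolutelyContinuous⟩
  exact (measurePreserving_sub_right volume v).quasiMeasurePreserving.comp h1

lemma scale_sq (d j : ℕ) :
    (2 : ℝ) ^ ((d : ℝ) * (j : ℝ) / 2) * (2 : ℝ) ^ ((d : ℝ) * (j : ℝ) / 2) = (2 ^ j) ^ d := by
  rw [← Real.rpow_add two_pos, ← pow_mul, ← Real.rpow_natCast]
  congr 1
  push_cast
  ring

lemma dilate_add (g : E d → ℝ) (a m : ℕ) (z : Fin d → ℤ) (x : E d) :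
    dilate g (a + m) z x = (2 : ℝ) ^ ((d : ℝ) * (m : ℝ) / 2) * dilate g a z ((2 : ℝ) ^ m • x) := by
  rw [dilate, dilate, smul_smul, ← pow_add, ← mul_assoc, ← Real.rpow_add two_pos]
  congr 2
  push_cast
  ring

lemma IsWindow.aestronglyMeasurable_dilate (hg : IsWindow g ρ M) (j : ℕ) (z : Fin d → ℤ) :
    AEStronglyMeasurable (dilate g j z) volume :=
  (hg.meas.comp_quasiMeasurePreserving
    (quasiMeasurePreserving_smul_sub (by positivity) _)).const_mul _

lemma IsWindow.abs_dilate_le (hg : IsWindow g ρ M) (j : ℕ) (z : Fin d → ℤ) (x : E d) :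
    |dilate g j z x| ≤ (2 : ℝ) ^ ((d : ℝ) * (j : ℝ) / 2) * M := by
  rw [dilate, abs_mul, abs_of_nonneg (by positivity)]
  exact mul_le_mul_of_nonneg_left (hg.bound _) (by positivity)

lemma IsWindow.norm_le_of_dilate_ne_zero (hg : IsWindow g ρ M) {j : ℕ} {z : Fin d → ℤ} {x : E d}
    (hx : dilate g j z x ≠ 0) : ‖(2 : ℝ) ^ j • x - latticePoint z‖ ≤ ρ :=
  hg.supp _ (right_ne_zero_of_mul hx)

lemma norm_le_norm_two_pow_smul (j : ℕ) (x : E d) : ‖x‖ ≤ ‖(2 : ℝ) ^ j • x‖ := by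
  rw [norm_smul, Real.norm_of_nonneg (by positivity)]
  exact le_mul_of_one_le_left (norm_nonneg _) (one_le_pow₀ (by norm_num))

lemma IsWindow.dilate (hg : IsWindow g ρ M) (j : ℕ) (z : Fin d → ℤ) :
    IsWindow (dilate g j z) (ρ + ‖latticePoint z‖) ((2 : ℝ) ^ ((d : ℝ) * (j : ℝ) / 2) * M) where
  meas := hg.aestronglyMeasurable_dilate j z
  bound := hg.abs_dilate_le j z
  supp x hx := by
    have h1 := hg.norm_le_of_dilate_ne_zero hx
    have h2 := norm_le_norm_two_pow_smul j x
    have h3 := norm_le_norm_sub_add ((2 : ℝ) ^ j • x) (latticePoint z)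
    linarith

/-- The lattice points within sup-distance `ρ` of `x`. -/
def latticeBox (ρ : ℝ) (x : E d) : Finset (Fin d → ℤ) :=
  Fintype.piFinset fun i => Finset.Icc ⌈x i - ρ⌉ ⌊x i + ρ⌋

lemma mem_latticeBox {x : E d} {z : Fin d → ℤ} (h : ‖x - latticePoint z‖ ≤ ρ) :
    z ∈ latticeBox ρ x := by
  rw [latticeBox, Fintype.mem_piFinset]
  intro i
  have h1 := (PiLp.norm_apply_le (x - latticePoint z) i).trans h
  rw [Real.norm_eq_abs, abs_le] at h1
  simp only [latticePoint, PiLp.sub_apply] at h1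
  rw [Finset.mem_Icc, Int.ceil_le, Int.le_floor]
  constructor <;> linarith

lemma card_latticeBox_le (hρ : 0 ≤ ρ) (x : E d) :
    ((latticeBox ρ x).card : ℝ) ≤ (2 * ρ + 1) ^ d := by
  rw [latticeBox, Fintype.card_piFinset]
  push_cast
  have h1 : ∀ i, ((Finset.Icc ⌈x i - ρ⌉ ⌊x i + ρ⌋).card : ℝ) ≤ 2 * ρ + 1 := by
    intro i
    rw [Int.card_Icc]
    have h2 : (((⌊x i + ρ⌋ + 1 - ⌈x i - ρ⌉).toNat : ℤ) : ℝ) ≤ 2 * ρ + 1 := by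
      rw [Int.toNat_eq_max]
      push_cast
      refine max_le ?_ (by positivity)
      have := Int.floor_le (x i + ρ)
      have := Int.le_ceil (x i - ρ)
      linarith
    exact_mod_cast h2
  calc _ ≤ ∏ _i : Fin d, (2 * ρ + 1) := Finset.prod_le_prod (fun _ _ => Nat.cast_nonneg _)
        fun i _ => h1 i
    _ = _ := by simp

lemma IsWindow.mem_latticeBox_of_dilate_ne_zero (hg : IsWindow g ρ M) {j : ℕ} {z : Fin d → ℤ}
    {x : E d} (hx : WaveletKNN.dilate g j z x ≠ 0) : z ∈ latticeBox ρ ((2 : ℝ) ^ j • x) :=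
  mem_latticeBox (hg.norm_le_of_dilate_ne_zero hx)

/-- A nonzero coefficient forces the supports to meet, so only finitely many translates matter at
each level. This makes the expansions below finite and meaningful pointwise. -/
lemma IsWindow.mem_latticeBox_of_integral_ne_zero (hg : IsWindow g ρ M) (hh : IsWindow h ρ' M')
    {j : ℕ} {z : Fin d → ℤ} (hx : ∫ x, h x * WaveletKNN.dilate g j z x ≠ 0) :
    z ∈ latticeBox (ρ + 2 ^ j * ρ') (0 : E d) := by
  obtain ⟨x, hx⟩ : ∃ x, h x * WaveletKNN.dilate g j z x ≠ 0 := by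
    by_contra hcon
    push Not at hcon
    exact hx (by simp [hcon])
  have h1 := hh.supp x (left_ne_zero_of_mul hx)
  have h2 := hg.norm_le_of_dilate_ne_zero (right_ne_zero_of_mul hx)
  refine mem_latticeBox ?_
  have h3 : ‖(2 : ℝ) ^ j • x‖ ≤ 2 ^ j * ρ' := by
    rw [norm_smul, Real.norm_of_nonneg (by positivity)]
    gcongr
  calc ‖(0 : E d) - latticePoint z‖ = ‖((2 : ℝ) ^ j • x - latticePoint z) - (2 : ℝ) ^ j • x‖ := by
        congr 1; abel
    _ ≤ _ := norm_sub_le _ _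
    _ ≤ _ := add_le_add h2 h3

/-! ### Kernels -/

/-- Any larger index set is allowed, so that several points can share one finite sum. -/
lemma IsWindow.tsum_mul_dilate (hg : IsWindow g ρ M) (j : ℕ) (x : E d) (a : (Fin d → ℤ) → ℝ)
    {A : Finset (Fin d → ℤ)} (hA : latticeBox ρ ((2 : ℝ) ^ j • x) ⊆ A) :
    ∑' z, a z * WaveletKNN.dilate g j z x = ∑ z ∈ A, a z * WaveletKNN.dilate g j z x := by
  refine tsum_eq_sum fun z hz => ?_
  by_contra hcon
  exact hz (hA (hg.mem_latticeBox_of_dilate_ne_zero (right_ne_zero_of_mul hcon)))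

lemma kernel_comm (g : E d → ℝ) (j : ℕ) (x y : E d) : kernel g j x y = kernel g j y x := by
  simp only [kernel, mul_comm]

lemma IsWindow.kernel_eq_sum (hg : IsWindow g ρ M) (j : ℕ) (x y : E d)
    {A : Finset (Fin d → ℤ)} (hA : latticeBox ρ ((2 : ℝ) ^ j • x) ⊆ A) :
    kernel g j x y = ∑ z ∈ A, WaveletKNN.dilate g j z x * WaveletKNN.dilate g j z y := by
  rw [kernel_comm]
  simp only [kernel]
  rw [hg.tsum_mul_dilate j x _ hA]
  simp only [mul_comm]

lemma IsWindow.abs_kernel_le (hg : IsWindow g ρ M) (hρ : 0 ≤ ρ) (j : ℕ) (x y : E d) :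
    |kernel g j x y| ≤ (2 * ρ + 1) ^ d * (2 ^ j) ^ d * M ^ 2 := by
  rw [hg.kernel_eq_sum j x y le_rfl]
  calc _ ≤ ∑ z ∈ latticeBox ρ ((2 : ℝ) ^ j • x),
        |WaveletKNN.dilate g j z x * WaveletKNN.dilate g j z y| := Finset.abs_sum_le_sum_abs _ _
    _ ≤ ∑ z ∈ latticeBox ρ ((2 : ℝ) ^ j • x), (2 ^ j) ^ d * M ^ 2 := by
        refine Finset.sum_le_sum fun z _ => ?_
        rw [abs_mul, ← scale_sq]
        calc _ ≤ ((2 : ℝ) ^ ((d : ℝ) * (j : ℝ) / 2) * M) * ((2 : ℝ) ^ ((d : ℝ) * (j : ℝ) / 2) * M) :=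
              mul_le_mul (hg.abs_dilate_le j z x) (hg.abs_dilate_le j z y) (abs_nonneg _)
                (mul_nonneg (by positivity) hg.bound_nonneg)
          _ = _ := by ring
    _ = (latticeBox ρ ((2 : ℝ) ^ j • x)).card * ((2 ^ j) ^ d * M ^ 2) := by simp
    _ ≤ (2 * ρ + 1) ^ d * ((2 ^ j) ^ d * M ^ 2) := by
        gcongr
        exact card_latticeBox_le hρ _
    _ = _ := by ring

lemma IsWindow.dist_le_of_kernel_ne_zero (hg : IsWindow g ρ M) {j : ℕ} {x y : E d}
    (h : kernel g j x y ≠ 0) : dist y x ≤ 2 * ρ / 2 ^ j := by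
  obtain ⟨z, -, hz⟩ : ∃ z ∈ latticeBox ρ ((2 : ℝ) ^ j • x),
      WaveletKNN.dilate g j z x * WaveletKNN.dilate g j z y ≠ 0 :=
    Finset.exists_ne_zero_of_sum_ne_zero (hg.kernel_eq_sum j x y le_rfl ▸ h)
  have h1 := hg.norm_le_of_dilate_ne_zero (left_ne_zero_of_mul hz)
  have h2 := hg.norm_le_of_dilate_ne_zero (right_ne_zero_of_mul hz)
  rw [le_div_iff₀ (by positivity), dist_eq_norm]
  calc ‖y - x‖ * 2 ^ j = ‖(2 : ℝ) ^ j • (y - x)‖ := by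
        rw [norm_smul, Real.norm_of_nonneg (by positivity), mul_comm]
    _ = ‖((2 : ℝ) ^ j • y - latticePoint z) - ((2 : ℝ) ^ j • x - latticePoint z)‖ := by
        rw [smul_sub]; congr 1; abel
    _ ≤ _ := norm_sub_le _ _
    _ ≤ 2 * ρ := by linarith

lemma IsWindow.kernel_aestronglyMeasurable (hg : IsWindow g ρ M) (j : ℕ) (x : E d) :
    AEStronglyMeasurable (kernel g j x) volume := by
  have h1 : kernel g j x = fun y => ∑ z ∈ latticeBox ρ ((2 : ℝ) ^ j • x),
      WaveletKNN.dilate g j z x * WaveletKNN.dilate g j z y :=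
    funext fun y => hg.kernel_eq_sum j x y le_rfl
  rw [h1]
  exact Finset.aestronglyMeasurable_fun_sum _ fun z _ =>
    (hg.aestronglyMeasurable_dilate j z).const_mul _

lemma IsWindow.kernel_window (hg : IsWindow g ρ M) (hρ : 0 ≤ ρ) (j : ℕ) (x : E d) :
    IsWindow (kernel g j x) (‖x‖ + 2 * ρ / 2 ^ j) ((2 * ρ + 1) ^ d * (2 ^ j) ^ d * M ^ 2) where
  meas := hg.kernel_aestronglyMeasurable j x
  bound := hg.abs_kernel_le hρ j x
  supp y hy := by
    have h1 := hg.dist_le_of_kernel_ne_zero hy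
    rw [dist_eq_norm] at h1
    have h2 := norm_le_norm_sub_add y x
    linarith

lemma kernel_eq_kernel_zero (g : E d → ℝ) (j : ℕ) (x y : E d) :
    kernel g j x y = (2 ^ j) ^ d * kernel g 0 ((2 : ℝ) ^ j • x) ((2 : ℝ) ^ j • y) := by
  rw [kernel, kernel, ← tsum_mul_left]
  refine tsum_congr fun z => ?_
  have h1 := fun x => dilate_add g 0 j z x
  simp only [zero_add] at h1
  rw [h1, h1, ← scale_sq]
  ring

lemma kernelOp_eq_tsum (hg : IsWindow g ρ M) (hh : AEStronglyMeasurable h volume)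
    (hb : ∀ x, |h x| ≤ M') (j : ℕ) (x : E d) :
    kernelOp g j h x = ∑' z, (∫ y, h y * WaveletKNN.dilate g j z y) * WaveletKNN.dilate g j z x := by
  rw [hg.tsum_mul_dilate j x _ le_rfl, kernelOp]
  simp only [hg.kernel_eq_sum j x _ le_rfl, Finset.sum_mul]
  rw [integral_finsetSum]
  · refine Finset.sum_congr rfl fun z _ => ?_
    rw [mul_comm, ← integral_const_mul]
    refine integral_congr_ae (ae_of_all _ fun y => ?_)
    ring
  · intro z _
    exact (((hg.dilate j z).const_mul (WaveletKNN.dilate g j z x)).mul hh hb).integrable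

end Dilates

/-! ### Orthonormal wavelet bases -/

/-- A family of functions that forms an orthonormal basis of `L²`. -/
structure IsONB {d : ℕ} {ι : Type*} (e : ι → E d → ℝ) : Prop where
  memLp : ∀ i, MemLp (e i) 2 volume
  ortho_self : ∀ i, ∫ x, e i x * e i x = 1
  ortho : ∀ i i', i ≠ i' → ∫ x, e i x * e i' x = 0
  parseval : ∀ g : E d → ℝ, MemLp g 2 volume →
    HasSum (fun i => (∫ x, g x * e i x) ^ 2) (∫ x, g x ^ 2)

namespace IsONB

variable {d : ℕ} {ι : Type*} {e : ι → E d → ℝ}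

lemma integrable_mul {g h : E d → ℝ} (hg : MemLp g 2 volume) (hh : MemLp h 2 volume) :
    Integrable fun x => g x * h x :=
  MemLp.integrable_mul hg hh

lemma ae_eq_zero (he : IsONB e) {g : E d → ℝ} (hg : MemLp g 2 volume)
    (h : ∀ i, ∫ x, g x * e i x = 0) : g =ᵐ[volume] 0 := by
  have h1 := he.parseval g hg
  simp only [h, ne_eq, OfNat.ofNat_ne_zero, not_false_eq_true, zero_pow] at h1
  have h2 : ∫ x, g x ^ 2 = 0 := h1.unique hasSum_zero
  rw [integral_eq_zero_iff_of_nonneg (fun x => sq_nonneg _) hg.integrable_sq] at h2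
  filter_upwards [h2] with x hx
  simpa using hx

lemma memLp_sum (he : IsONB e) (c : ι → ℝ) (S : Finset ι) :
    MemLp (fun x => ∑ i ∈ S, c i * e i x) 2 volume :=
  memLp_finsetSum _ fun i _ => (he.memLp i).const_mul (c i)

lemma integral_sum_mul (he : IsONB e) (c : ι → ℝ) (S : Finset ι) {g : E d → ℝ}
    (hg : MemLp g 2 volume) :
    ∫ x, (∑ i ∈ S, c i * e i x) * g x = ∑ i ∈ S, c i * ∫ x, e i x * g x := by
  simp only [Finset.sum_mul, mul_assoc]
  rw [integral_finsetSum _ fun i _ => (integrable_mul (he.memLp i) hg).const_mul (c i)]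
  simp only [integral_const_mul]

lemma integral_sum_mul_self (he : IsONB e) (c : ι → ℝ) (S : Finset ι) (i : ι)
    (hi : i ∉ S → c i = 0) :
    ∫ x, (∑ i ∈ S, c i * e i x) * e i x = c i := by
  rw [he.integral_sum_mul c S (he.memLp i)]
  by_cases h : i ∈ S
  · rw [Finset.sum_eq_single_of_mem i h fun j _ hj => by rw [he.ortho j i hj, mul_zero],
      he.ortho_self, mul_one]
  · rw [hi h]
    exact Finset.sum_eq_zero fun j hj => by
      rw [he.ortho j i (fun hji => h (hji ▸ hj)), mul_zero]

/-- Finite expansions. -/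
lemma ae_eq_sum (he : IsONB e) {g : E d → ℝ} (hg : MemLp g 2 volume) {S : Finset ι}
    (hS : ∀ i, i ∉ S → ∫ x, g x * e i x = 0) :
    ∀ᵐ x, g x = ∑ i ∈ S, (∫ x, g x * e i x) * e i x := by
  have h1 := he.ae_eq_zero (hg.sub (he.memLp_sum (fun i => ∫ x, g x * e i x) S)) fun i => by
    simp only [Pi.sub_apply, sub_mul]
    rw [integral_sub (integrable_mul hg (he.memLp i))
      (integrable_mul (he.memLp_sum _ S) (he.memLp i)),
      he.integral_sum_mul_self _ S i (hS i), sub_self]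
  filter_upwards [h1] with x hx
  simpa [sub_eq_zero] using hx

end IsONB

/-- The common radius and bound of the wavelets. -/
lemma WaveletAssumption.exists_windows {d j₀ : ℕ} {φ : E d → ℝ} {ψ : Q d → E d → ℝ}
    (h : WaveletAssumption j₀ φ ψ) :
    ∃ ρ M : ℝ, 0 ≤ ρ ∧ IsWindow φ ρ M ∧ ∀ q, IsWindow (ψ q) ρ M := by
  have hsupp : ∀ g : E d → ℝ, HasCompactSupport g → ∃ ρ : ℝ, ∀ x, g x ≠ 0 → ‖x‖ ≤ ρ := by
    intro g hg
    obtain ⟨ρ, hρ⟩ := hg.isBounded.exists_norm_le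
    exact ⟨ρ, fun x hx => hρ x (subset_tsupport g hx)⟩
  obtain ⟨b, hb⟩ := h.basis
  -- Measurability of the wavelets is recovered from the basis: one dilate represents an element of
  -- L², and the affine change of variables can be undone.
  have hmeas : ∀ (g : E d → ℝ) (j : ℕ) (z : Fin d → ℤ) (i), (b i : E d → ℝ) =ᵐ[volume]
      dilate g j z → AEStronglyMeasurable g volume := by
    intro g j z i hi
    have h1 : AEStronglyMeasurable (dilate g j z) volume :=
      (Lp.aestronglyMeasurable (b i)).congr hi
    have h2 := (h1.comp_quasiMeasurePreserving (quasiMeasurePreserving_smul_sub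
      (c := ((2 : ℝ) ^ j)⁻¹) (by positivity) (-(((2 : ℝ) ^ j)⁻¹ • latticePoint z)))).const_mul
      ((2 : ℝ) ^ ((d : ℝ) * (j : ℝ) / 2))⁻¹
    refine h2.congr (ae_of_all _ fun x => ?_)
    have h3 : (2 : ℝ) ^ j ≠ 0 := by positivity
    have h4 : (2 : ℝ) ^ ((d : ℝ) * (j : ℝ) / 2) ≠ 0 := by positivity
    simp only [dilate, Function.comp_apply]
    rw [sub_neg_eq_add, smul_add, smul_inv_smul₀ h3, smul_inv_smul₀ h3, add_sub_cancel_right,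
      inv_mul_cancel_left₀ h4]
  obtain ⟨ρ₀, hρ₀⟩ := hsupp φ h.father_compact
  choose ρ hρ using fun q => hsupp (ψ q) (h.mother_compact q)
  obtain ⟨M₀, hM₀⟩ := h.father_bounded
  choose M hM using h.mother_bounded
  refine ⟨|ρ₀| + ∑ q, |ρ q|, |M₀| + ∑ q, |M q|, by positivity, ?_, fun q => ?_⟩
  · refine ⟨hmeas φ j₀ 0 (Sum.inl 0) (hb _), fun x => (hM₀ x).trans ?_, fun x hx =>
      (hρ₀ x hx).trans ?_⟩
    · exact (le_abs_self _).trans (le_add_of_nonneg_right (by positivity))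
    · exact (le_abs_self _).trans (le_add_of_nonneg_right (by positivity))
  · have key : ∀ (a : ℝ) (r : Q d → ℝ), r q ≤ |a| + ∑ q, |r q| := fun a r =>
      (le_abs_self _).trans ((Finset.single_le_sum (f := fun q => |r q|)
        (fun _ _ => abs_nonneg _) (Finset.mem_univ q)).trans
        (le_add_of_nonneg_left (abs_nonneg _)))
    exact ⟨hmeas (ψ q) (j₀ + 0) 0 (Sum.inr (0, 0, q)) (hb _), fun x => (hM q x).trans (key _ _),
      fun x hx => (hρ q x hx).trans (key _ _)⟩

/-! ### Changes of scale and expansions between levels -/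

section Levels

variable {d j₀ : ℕ} {φ : E d → ℝ} {ψ : Q d → E d → ℝ} {ρ M : ℝ}

lemma isWindow_waveletFamily (hφ : IsWindow φ ρ M) (hψ : ∀ q, IsWindow (ψ q) ρ M) (j : ℕ)
    (i : WaveletIndex d) : ∃ r b, IsWindow (waveletFamily j φ ψ i) r b := by
  rcases i with z | ⟨m, z, q⟩
  · exact ⟨_, _, hφ.dilate j z⟩
  · exact ⟨_, _, (hψ q).dilate (j + m) z⟩

lemma WaveletAssumption.isONB (h : WaveletAssumption j₀ φ ψ) :
    IsONB (waveletFamily j₀ φ ψ) := by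
  classical
  obtain ⟨b, hb⟩ := h.basis
  have hmem : ∀ i, MemLp (waveletFamily j₀ φ ψ i) 2 volume := fun i =>
    (memLp_congr_ae (hb i)).1 (Lp.memLp (b i))
  have hinner : ∀ i i', ∫ x, waveletFamily j₀ φ ψ i x * waveletFamily j₀ φ ψ i' x
      = inner ℝ (b i') (b i) := by
    intro i i'
    rw [L2.inner_def]
    refine integral_congr_ae ?_
    filter_upwards [hb i, hb i'] with x hx hx'
    rw [← hx, ← hx']
    simp
  have horth := orthonormal_iff_ite.1 b.orthonormal
  refine ⟨hmem, fun i => ?_, fun i i' hii' => ?_, fun g hg => ?_⟩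
  · rw [hinner, horth, if_pos rfl]
  · rw [hinner, horth, if_neg hii'.symm]
  · have h1 := b.hasSum_inner_mul_inner (hg.toLp g) (hg.toLp g)
    have h2 : ∀ i, inner ℝ (b i) (hg.toLp g) = ∫ x, g x * waveletFamily j₀ φ ψ i x := by
      intro i
      rw [L2.inner_def]
      refine integral_congr_ae ?_
      filter_upwards [hb i, hg.coeFn_toLp] with x hx hx'
      rw [← hx, hx']
      simp
    have h3 : inner ℝ (hg.toLp g) (hg.toLp g) = ∫ x, g x ^ 2 := by
      rw [L2.inner_def]
      refine integral_congr_ae ?_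
      filter_upwards [hg.coeFn_toLp] with x hx
      rw [hx]
      simp [sq]
    rw [h3] at h1
    refine (congrArg (fun u => HasSum u (∫ x, g x ^ 2)) (funext fun i => ?_)).mp h1
    rw [real_inner_comm, h2, sq]

lemma waveletFamily_add (j m : ℕ) (i : WaveletIndex d) (x : E d) :
    waveletFamily (j + m) φ ψ i x
      = (2 : ℝ) ^ ((d : ℝ) * (m : ℝ) / 2) * waveletFamily j φ ψ i ((2 : ℝ) ^ m • x) := by
  rcases i with z | ⟨m', z, q⟩
  · exact dilate_add φ j m z x
  · simp only [waveletFamily]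
    rw [add_right_comm, dilate_add]

lemma integral_two_pow_smul (g : E d → ℝ) (m : ℕ) :
    (2 ^ m : ℝ) ^ d * ∫ x, g ((2 : ℝ) ^ m • x) = ∫ x, g x := by
  rw [Measure.integral_comp_smul, finrank_euclideanSpace_fin, abs_of_nonneg (by positivity),
    smul_eq_mul, mul_inv_cancel_left₀ (by positivity)]

/-- An orthonormal wavelet basis remains one after a change of scale. -/
lemma IsONB.add (h : IsONB (waveletFamily j₀ φ ψ)) (m : ℕ) :
    IsONB (waveletFamily (j₀ + m) φ ψ) := by
  set c := (2 : ℝ) ^ ((d : ℝ) * (m : ℝ) / 2) with hc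
  have hcc : c * c = (2 ^ m) ^ d := scale_sq d m
  have hcomp : ∀ {r : ℝ}, 0 < r → ∀ {g : E d → ℝ}, MemLp g 2 volume →
      MemLp (fun x => g (r • x)) 2 volume := by
    intro r hr g hg
    have h1 : MemLp g 2 (Measure.map (fun x : E d => r • x) volume) := by
      rw [Measure.map_addHaar_smul volume hr.ne']
      exact hg.smul_measure ENNReal.ofReal_ne_top
    exact (memLp_map_measure_iff h1.aestronglyMeasurable
      (measurable_const_smul r).aemeasurable).1 h1
  have h2m : (0 : ℝ) < 2 ^ m := by positivity
  have hmul : ∀ i i', ∫ x, waveletFamily (j₀ + m) φ ψ i x * waveletFamily (j₀ + m) φ ψ i' x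
      = ∫ x, waveletFamily j₀ φ ψ i x * waveletFamily j₀ φ ψ i' x := by
    intro i i'
    rw [← integral_two_pow_smul (fun x => waveletFamily j₀ φ ψ i x * waveletFamily j₀ φ ψ i' x) m,
      ← hcc, ← integral_const_mul]
    refine integral_congr_ae (ae_of_all _ fun x => ?_)
    simp only [waveletFamily_add]
    ring
  refine ⟨fun i => ?_, fun i => ?_, fun i i' hii' => ?_, fun g hg => ?_⟩
  · have h1 := (hcomp h2m (h.memLp i)).const_mul c
    exact (memLp_congr_ae (ae_of_all _ fun x => (waveletFamily_add j₀ m i x))).2 h1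
  · rw [hmul, h.ortho_self]
  · rw [hmul, h.ortho i i' hii']
  · set g' : E d → ℝ := fun x => g (((2 : ℝ) ^ m)⁻¹ • x) with hg'
    have h1 := (h.parseval g' (hcomp (inv_pos.2 h2m) hg)).mul_left (c * c)⁻¹
    have hgg : ∀ x, g' ((2 : ℝ) ^ m • x) = g x := fun x => by
      simp only [hg']; rw [inv_smul_smul₀ h2m.ne']
    have h3 : (c * c)⁻¹ * ∫ x, g' x ^ 2 = ∫ x, g x ^ 2 := by
      rw [← integral_two_pow_smul _ m, hcc, inv_mul_cancel_left₀ (by positivity)]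
      simp only [hgg]
    rw [h3] at h1
    refine (congrArg (fun u => HasSum u (∫ x, g x ^ 2)) (funext fun i => ?_)).mp h1
    rw [← integral_two_pow_smul (fun x => g' x * waveletFamily j₀ φ ψ i x) m, ← hcc]
    simp only [hgg, waveletFamily_add, ← hc]
    have h4 : ∀ x, g x * (c * waveletFamily j₀ φ ψ i ((2 : ℝ) ^ m • x))
        = c * (g x * waveletFamily j₀ φ ψ i ((2 : ℝ) ^ m • x)) := fun x => by ring
    simp only [h4, integral_const_mul]
    have hc0 : c ≠ 0 := by positivity
    field_simp

/-- The wavelets of level below `j₀ + m`. -/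
def IsBelow (m : ℕ) : WaveletIndex d → Prop
  | Sum.inl _ => True
  | Sum.inr (m', _, _) => m' < m

lemma waveletFamily_inr_add (j m m' : ℕ) (z : Fin d → ℤ) (q : Q d) :
    waveletFamily j φ ψ (Sum.inr (m + m', z, q)) = waveletFamily (j + m) φ ψ (Sum.inr (m', z, q)) := by
  simp only [waveletFamily, add_assoc]

/-- The indices of level below `j₀ + m` and of translation in the finset `A`. -/
def belowFinset (m : ℕ) (A : Finset (Fin d → ℤ)) : Finset (WaveletIndex d) :=
  Finset.disjSum A (Finset.range m ×ˢ A ×ˢ Finset.univ)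

/-- Both functions belong to the rescaled basis that starts at level j₀ + m. -/
lemma integral_father_mul_eq_zero (h : IsONB (waveletFamily j₀ φ ψ)) {m : ℕ} {z : Fin d → ℤ}
    {i : WaveletIndex d} (hi : ¬ IsBelow m i) :
    ∫ x, dilate φ (j₀ + m) z x * waveletFamily j₀ φ ψ i x = 0 := by
  rcases i with z' | ⟨m', z', q⟩
  · exact absurd trivial hi
  · obtain ⟨l, rfl⟩ := Nat.exists_eq_add_of_le (not_lt.1 hi)
    rw [waveletFamily_inr_add]
    exact (h.add m).ortho (Sum.inl z) _ (by simp)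

/-- Here both functions belong to the original basis, where their levels differ or one of them is a
father. -/
lemma integral_mul_mother_eq_zero (h : IsONB (waveletFamily j₀ φ ψ)) {m l : ℕ} {z : Fin d → ℤ}
    {q : Q d} {i : WaveletIndex d} (hi : IsBelow m i) :
    ∫ x, waveletFamily j₀ φ ψ i x * waveletFamily (j₀ + m) φ ψ (Sum.inr (l, z, q)) x = 0 := by
  rw [← waveletFamily_inr_add]
  refine h.ortho _ _ ?_
  rintro rfl
  exact absurd hi (by simp [IsBelow])

/-- A wavelet of level below `j₀ + m` is a finite combination of the father wavelets of that
level. -/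
lemma exists_ae_eq_sum_father (h : IsONB (waveletFamily j₀ φ ψ)) (hφ : IsWindow φ ρ M)
    (hψ : ∀ q, IsWindow (ψ q) ρ M) {m : ℕ} {i : WaveletIndex d} (hi : IsBelow m i) :
    ∃ A : Finset (Fin d → ℤ),
      (∀ z, z ∉ A → ∫ x, waveletFamily j₀ φ ψ i x * dilate φ (j₀ + m) z x = 0) ∧
      ∀ᵐ x, waveletFamily j₀ φ ψ i x = ∑ z ∈ A,
        (∫ x, waveletFamily j₀ φ ψ i x * dilate φ (j₀ + m) z x) * dilate φ (j₀ + m) z x := by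
  obtain ⟨r, b, hw⟩ := isWindow_waveletFamily hφ hψ j₀ i
  refine ⟨latticeBox (ρ + 2 ^ (j₀ + m) * r) 0, fun z hz => ?_, ?_⟩
  · by_contra hcon
    exact hz (hφ.mem_latticeBox_of_integral_ne_zero hw hcon)
  · have h1 := (h.add m).ae_eq_sum (S := (latticeBox (ρ + 2 ^ (j₀ + m) * r) 0).map
      ⟨Sum.inl, Sum.inl_injective⟩) (h.memLp i) fun i' hi' => ?_
    · filter_upwards [h1] with x hx
      rw [hx, Finset.sum_map]
      rfl
    · rcases i' with z | ⟨l, z, q⟩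
      · by_contra hcon
        exact hi' (Finset.mem_map_of_mem _ (hφ.mem_latticeBox_of_integral_ne_zero hw hcon))
      · exact integral_mul_mother_eq_zero h hi

/-- A father wavelet of level `j₀ + m` is a finite combination of the wavelets of lower level. -/
lemma exists_father_ae_eq_sum (h : IsONB (waveletFamily j₀ φ ψ)) (hφ : IsWindow φ ρ M)
    (hψ : ∀ q, IsWindow (ψ q) ρ M) (m : ℕ) (z : Fin d → ℤ) :
    ∃ S : Finset (WaveletIndex d),
      (∀ i, i ∉ S → ∫ x, dilate φ (j₀ + m) z x * waveletFamily j₀ φ ψ i x = 0) ∧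
      ∀ᵐ x, dilate φ (j₀ + m) z x = ∑ i ∈ S,
        (∫ x, dilate φ (j₀ + m) z x * waveletFamily j₀ φ ψ i x) * waveletFamily j₀ φ ψ i x := by
  classical
  have hw := hφ.dilate (j₀ + m) z
  set r := ρ + ‖latticePoint z‖
  let A : Finset (Fin d → ℤ) := latticeBox (ρ + 2 ^ j₀ * r) 0 ∪
    (Finset.range m).biUnion fun l => latticeBox (ρ + 2 ^ (j₀ + l) * r) 0
  have hS : ∀ i, i ∉ belowFinset m A →
      ∫ x, dilate φ (j₀ + m) z x * waveletFamily j₀ φ ψ i x = 0 := by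
    intro i hi
    by_cases hb : IsBelow m i
    · by_contra hcon
      refine hi ?_
      rcases i with z' | ⟨l, z', q⟩
      · exact Finset.inl_mem_disjSum.2 (Finset.mem_union_left _
          (hφ.mem_latticeBox_of_integral_ne_zero hw hcon))
      · have hl : l ∈ Finset.range m := Finset.mem_range.2 hb
        refine Finset.inr_mem_disjSum.2 (Finset.mem_product.2 ⟨hl, Finset.mem_product.2
          ⟨Finset.mem_union_right _ (Finset.mem_biUnion.2 ⟨l, hl, ?_⟩), Finset.mem_univ q⟩⟩)
        exact (hψ q).mem_latticeBox_of_integral_ne_zero hw hcon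
    · exact integral_father_mul_eq_zero h hb
  exact ⟨_, hS, h.ae_eq_sum (hw.memLp 2) hS⟩

end Levels

/-! ### The multiscale form of the kernel -/

/-- Two families that expand into each other with transposed coefficients have the same
reproducing kernel. -/
lemma tsum_mul_eq_of_expansions {α β : Type*} {u u' : α → ℝ} {v v' : β → ℝ} {c : α → β → ℝ}
    (hu : u.support.Finite) (hv' : v'.support.Finite)
    (h1 : ∀ a, ∃ S : Finset β, (∀ b, b ∉ S → c a b = 0) ∧ u' a = ∑ b ∈ S, c a b * v' b)
    (h2 : ∀ b, ∃ A : Finset α, (∀ a, a ∉ A → c a b = 0) ∧ v b = ∑ a ∈ A, c a b * u a) :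
    ∑' a, u a * u' a = ∑' b, v b * v' b := by
  classical
  set A := hu.toFinset with hA
  set B := hv'.toFinset with hB
  have hu0 : ∀ a, a ∉ A → u a = 0 := fun a ha => by simpa [hA] using ha
  have hv0 : ∀ b, b ∉ B → v' b = 0 := fun b hb => by simpa [hB] using hb
  -- The given index sets vary with `a`; the finite support of `v'` replaces them by a common one,
  -- after which the identity is an exchange of two finite sums.
  have e1 : ∀ a, u' a = ∑ b ∈ B, c a b * v' b := by
    intro a
    obtain ⟨S, hS, h⟩ := h1 a
    exact h.trans ((Finset.sum_subset (f := fun b => c a b * v' b) (Finset.subset_union_left (s₂ := B))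
      fun b _ hb => by rw [hS b hb, zero_mul]).trans
      (Finset.sum_subset (Finset.subset_union_right (s₁ := S)) fun b _ hb => by
        rw [hv0 b hb, mul_zero]).symm)
  have e2 : ∀ b, v b = ∑ a ∈ A, c a b * u a := by
    intro b
    obtain ⟨S, hS, h⟩ := h2 b
    exact h.trans ((Finset.sum_subset (f := fun a => c a b * u a) (Finset.subset_union_left (s₂ := A))
      fun a _ ha => by rw [hS a ha, zero_mul]).trans
      (Finset.sum_subset (Finset.subset_union_right (s₁ := S)) fun a _ ha => by
        rw [hu0 a ha, mul_zero]).symm)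
  rw [tsum_eq_sum (s := A) fun a ha => by rw [hu0 a ha, zero_mul],
    tsum_eq_sum (s := B) fun b hb => by rw [hv0 b hb, mul_zero]]
  simp only [e1, e2, Finset.mul_sum, Finset.sum_mul]
  rw [Finset.sum_comm]
  exact Finset.sum_congr rfl fun b _ => Finset.sum_congr rfl fun a _ => by ring

section Levels

variable {d j₀ : ℕ} {φ : E d → ℝ} {ψ : Q d → E d → ℝ} {ρ M : ℝ}

lemma IsWindow.finite_support_dilate {g : E d → ℝ} (hg : IsWindow g ρ M) (j : ℕ) (x : E d) :
    (Function.support fun z => WaveletKNN.dilate g j z x).Finite :=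
  (latticeBox ρ ((2 : ℝ) ^ j • x)).finite_toSet.subset fun _ hz =>
    hg.mem_latticeBox_of_dilate_ne_zero hz

open Classical in
/-- The wavelets of level below `j₀ + m`, with the others replaced by zero. -/
def lowFamily (j₀ m : ℕ) (φ : E d → ℝ) (ψ : Q d → E d → ℝ) (x : E d) (i : WaveletIndex d) : ℝ :=
  if IsBelow m i then waveletFamily j₀ φ ψ i x else 0

lemma exists_lowFamily_support (hφ : IsWindow φ ρ M) (hψ : ∀ q, IsWindow (ψ q) ρ M) (m : ℕ)
    (x : E d) : ∃ A : Finset (Fin d → ℤ),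
      ∀ i, i ∉ belowFinset m A → lowFamily j₀ m φ ψ x i = 0 := by
  classical
  refine ⟨latticeBox ρ ((2 : ℝ) ^ j₀ • x) ∪ (Finset.range m).biUnion fun l =>
    latticeBox ρ ((2 : ℝ) ^ (j₀ + l) • x), fun i hi => ?_⟩
  rw [lowFamily]
  split_ifs with hb
  · by_contra hcon
    refine hi ?_
    rcases i with z | ⟨l, z, q⟩
    · exact Finset.inl_mem_disjSum.2 (Finset.mem_union_left _
        (hφ.mem_latticeBox_of_dilate_ne_zero hcon))
    · have hl : l ∈ Finset.range m := Finset.mem_range.2 hb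
      exact Finset.inr_mem_disjSum.2 (Finset.mem_product.2 ⟨hl, Finset.mem_product.2
        ⟨Finset.mem_union_right _ (Finset.mem_biUnion.2 ⟨l, hl,
          (hψ q).mem_latticeBox_of_dilate_ne_zero hcon⟩), Finset.mem_univ q⟩⟩)
  · rfl

lemma tsum_lowFamily (hφ : IsWindow φ ρ M) (hψ : ∀ q, IsWindow (ψ q) ρ M) (m : ℕ)
    (x y : E d) :
    ∑' i, lowFamily j₀ m φ ψ x i * lowFamily j₀ m φ ψ y i
      = kernel φ j₀ x y + ∑ l ∈ Finset.range m, ∑ q, kernel (ψ q) (j₀ + l) x y := by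
  classical
  obtain ⟨A, hA⟩ := exists_lowFamily_support (j₀ := j₀) hφ hψ m x
  rw [tsum_eq_sum (s := belowFinset m A) fun i hi => by rw [hA i hi, zero_mul], belowFinset,
    Finset.sum_disjSum, Finset.sum_product]
  congr 1
  · rw [kernel, tsum_eq_sum (s := A)]
    · refine Finset.sum_congr rfl fun z _ => ?_
      simp [lowFamily, IsBelow, waveletFamily]
    · intro z hz
      have : dilate φ j₀ z x = 0 := by
        simpa [lowFamily, IsBelow, waveletFamily] using
          hA (Sum.inl z) fun h => hz (Finset.inl_mem_disjSum.1 h)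
      rw [this, zero_mul]
  · refine Finset.sum_congr rfl fun l hl => ?_
    have hl' : l < m := Finset.mem_range.1 hl
    rw [Finset.sum_product, Finset.sum_comm]
    refine Finset.sum_congr rfl fun q _ => ?_
    rw [kernel, tsum_eq_sum (s := A)]
    · refine Finset.sum_congr rfl fun z _ => ?_
      simp [lowFamily, IsBelow, waveletFamily, hl']
    · intro z hz
      have : dilate (ψ q) (j₀ + l) z x = 0 := by
        simpa [lowFamily, IsBelow, waveletFamily, hl'] using hA (Sum.inr (l, z, q)) fun h =>
          hz (Finset.mem_product.1 (Finset.mem_product.1 (Finset.inr_mem_disjSum.1 h)).2).1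
      rw [this, zero_mul]

/-- The kernel of level `j₀ + m` decomposes along the lower levels. -/
theorem ae_kernel_eq (h : IsONB (waveletFamily j₀ φ ψ)) (hφ : IsWindow φ ρ M)
    (hψ : ∀ q, IsWindow (ψ q) ρ M) (m : ℕ) :
    ∃ G : Set (E d), (∀ᵐ x, x ∈ G) ∧ ∀ x ∈ G, ∀ y ∈ G, kernel φ (j₀ + m) x y
      = kernel φ j₀ x y + ∑ l ∈ Finset.range m, ∑ q, kernel (ψ q) (j₀ + l) x y := by
  classical
  choose S hS hS' using exists_father_ae_eq_sum h hφ hψ m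
  choose A hA hA' using fun i : {i : WaveletIndex d // IsBelow m i} =>
    exists_ae_eq_sum_father h hφ hψ i.2
  refine ⟨{x | (∀ z, dilate φ (j₀ + m) z x = ∑ i ∈ S z,
        (∫ x, dilate φ (j₀ + m) z x * waveletFamily j₀ φ ψ i x) * waveletFamily j₀ φ ψ i x) ∧
      ∀ i : {i : WaveletIndex d // IsBelow m i}, waveletFamily j₀ φ ψ i x = ∑ z ∈ A i,
        (∫ x, waveletFamily j₀ φ ψ i x * dilate φ (j₀ + m) z x) * dilate φ (j₀ + m) z x},
    (ae_all_iff.2 hS').and (ae_all_iff.2 hA'), ?_⟩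
  -- At `x` the low wavelets are expanded in fathers, at `y` the fathers in low wavelets. There are
  -- countably many identities, so they hold together on a set of full measure.
  rintro x ⟨-, hx⟩ y ⟨hy, -⟩
  rw [← tsum_lowFamily hφ hψ m x y, kernel]
  obtain ⟨B, hB⟩ := exists_lowFamily_support (j₀ := j₀) hφ hψ m y
  refine tsum_mul_eq_of_expansions
    (c := fun z i => ∫ x, dilate φ (j₀ + m) z x * waveletFamily j₀ φ ψ i x)
    (hφ.finite_support_dilate _ x) ?_ (fun z => ⟨S z, hS z, ?_⟩) fun i => ?_
  · exact (belowFinset m B).finite_toSet.subset fun i hi => by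
      by_contra hcon
      exact hi (hB i hcon)
  · rw [hy z]
    refine Finset.sum_congr rfl fun i _ => ?_
    rw [lowFamily]
    split_ifs with hb
    · rfl
    · rw [integral_father_mul_eq_zero h hb, zero_mul, zero_mul]
  · by_cases hb : IsBelow m i
    · refine ⟨A ⟨i, hb⟩, fun z hz => ?_, ?_⟩
      · simpa only [mul_comm] using hA ⟨i, hb⟩ z hz
      · rw [lowFamily, if_pos hb, hx ⟨i, hb⟩]
        simp only [mul_comm (waveletFamily j₀ φ ψ i _)]
    · refine ⟨∅, fun z _ => integral_father_mul_eq_zero h hb, ?_⟩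
      rw [lowFamily, if_neg hb, Finset.sum_empty]

/-! ### The two forms of the estimator -/

lemma IsWindow.tsum_coefEstimator {g : E d → ℝ} (hg : IsWindow g ρ M) {n : ℕ} (k : ℕ)
    (x : Fin n → E d) (j : ℕ) (y : E d) :
    ∑' z, coefEstimator g k x j z * WaveletKNN.dilate g j z y
      = gammaRatio k * (1 / √(n : ℝ)) * ∑ i, kernel g j y (x i) * √(knnVolume k x i) := by
  rw [hg.tsum_mul_dilate j y _ le_rfl]
  simp only [hg.kernel_eq_sum j y _ le_rfl, coefEstimator, Finset.sum_mul, Finset.mul_sum]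
  rw [Finset.sum_comm]
  exact Finset.sum_congr rfl fun i _ => Finset.sum_congr rfl fun z _ => by ring

/-- At each point only finitely many translates survive, so the sums over translates and sample
points can be exchanged. -/
lemma sqrtEstimator_eq (hφ : IsWindow φ ρ M) {n : ℕ} (J k : ℕ) (x : Fin n → E d) (y : E d) :
    sqrtEstimator φ J k x y = gammaRatio k * (1 / √(n : ℝ)) * knnSum k (kernel φ (J + 1) y) x :=
  hφ.tsum_coefEstimator k x (J + 1) y

lemma sqrtEstimatorMultiscale_eq (hφ : IsWindow φ ρ M) (hψ : ∀ q, IsWindow (ψ q) ρ M) {n : ℕ}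
    (J k : ℕ) (x : Fin n → E d) (y : E d) :
    sqrtEstimatorMultiscale j₀ φ ψ J k x y = gammaRatio k * (1 / √(n : ℝ)) *
      ∑ i, (kernel φ j₀ y (x i) + ∑ j ∈ Finset.Icc j₀ J, ∑ q, kernel (ψ q) j y (x i)) *
        √(knnVolume k x i) := by
  have h1 : ∀ j, ∑' z : Fin d → ℤ, ∑ q : Q d, coefEstimator (ψ q) k x j z * dilate (ψ q) j z y
      = ∑ q, gammaRatio k * (1 / √(n : ℝ)) * ∑ i, kernel (ψ q) j y (x i) * √(knnVolume k x i) := by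
    intro j
    rw [Summable.tsum_finsetSum]
    · exact Finset.sum_congr rfl fun q _ => (hψ q).tsum_coefEstimator k x j y
    · intro q _
      refine summable_of_hasFiniteSupport (((hψ q).finite_support_dilate j y).subset ?_)
      exact Function.support_mul_subset_right _ _
  rw [sqrtEstimatorMultiscale, hφ.tsum_coefEstimator]
  simp only [h1, add_mul, Finset.sum_mul, Finset.sum_add_distrib, mul_add, ← Finset.mul_sum]
  congr 2
  rw [Finset.sum_comm (s := Finset.univ) (t := Finset.Icc j₀ J)]
  refine Finset.sum_congr rfl fun j _ => ?_
  exact Finset.sum_comm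

/-- The kernels agree on G × G with G of full measure. The sample has absolutely continuous laws, so
all its points lie in G almost surely; one null event serves every `n` and `k`. -/
theorem ae_sqrtEstimatorMultiscale_eq (h : IsONB (waveletFamily j₀ φ ψ)) (hφ : IsWindow φ ρ M)
    (hψ : ∀ q, IsWindow (ψ q) ρ M) {Ω : Type*} [MeasurableSpace Ω] {P : Measure Ω}
    {X : ℕ → Ω → E d} (hX : ∀ i, Measurable (X i)) (hlaw : ∀ i, P.map (X i) ≪ volume)
    {J : ℕ} (hJ : j₀ ≤ J) :
    ∀ᵐ x : E d, ∀ᵐ ω ∂P, ∀ n k : ℕ, sqrtEstimatorMultiscale j₀ φ ψ J k (sample X n ω) x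
      = sqrtEstimator φ J k (sample X n ω) x := by
  obtain ⟨G, hG, hK⟩ := ae_kernel_eq h hφ hψ (J + 1 - j₀)
  filter_upwards [hG] with x hx
  have h1 : ∀ i, ∀ᵐ ω ∂P, X i ω ∈ G := fun i =>
    ae_of_ae_map (hX i).aemeasurable ((hlaw i).ae_le hG)
  filter_upwards [ae_all_iff.2 h1] with ω hω n k
  rw [sqrtEstimatorMultiscale_eq hφ hψ, sqrtEstimator_eq hφ, knnSum]
  congr 1
  refine Finset.sum_congr rfl fun i _ => ?_
  have h2 := hK x hx (sample X n ω i) (hω i)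
  rw [Nat.add_sub_cancel' (by omega)] at h2
  rw [h2, ← Finset.Ico_add_one_right_eq_Icc, Finset.sum_Ico_eq_sum_range]

end Levels

section Approximation

variable {d j₀ : ℕ} {φ g : E d → ℝ} {ψ : Q d → E d → ℝ} {ρ M r b : ℝ}

/-! ### The kernel as a reproducing kernel -/

/-- K(x, ·) is a finite combination of orthonormal fathers with coefficients φ_z(x), so its squared
norm is the sum of the φ_z(x)². -/
lemma integral_kernel_sq (h : IsONB (waveletFamily j₀ φ ψ)) (hφ : IsWindow φ ρ M) (x : E d) :
    ∫ y, kernel φ j₀ x y ^ 2 = kernel φ j₀ x x := by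
  classical
  set S : Finset (WaveletIndex d) := (latticeBox ρ ((2 : ℝ) ^ j₀ • x)).map
    ⟨Sum.inl, Sum.inl_injective⟩
  have h1 : ∀ y, kernel φ j₀ x y
      = ∑ i ∈ S, waveletFamily j₀ φ ψ i x * waveletFamily j₀ φ ψ i y := by
    intro y
    rw [hφ.kernel_eq_sum j₀ x y le_rfl, Finset.sum_map]
    rfl
  set c : WaveletIndex d → ℝ := fun i => if i ∈ S then waveletFamily j₀ φ ψ i x else 0 with hc
  have h2 : ∀ y, kernel φ j₀ x y = ∑ i ∈ S, c i * waveletFamily j₀ φ ψ i y := by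
    intro y
    rw [h1]
    exact Finset.sum_congr rfl fun i hi => by rw [hc]; simp only [if_pos hi]
  simp only [sq]
  calc ∫ y, kernel φ j₀ x y * kernel φ j₀ x y
      = ∫ y, (∑ i ∈ S, c i * waveletFamily j₀ φ ψ i y) *
          (∑ i ∈ S, c i * waveletFamily j₀ φ ψ i y) := by simp only [h2]
    _ = ∑ i ∈ S, c i * ∫ y, waveletFamily j₀ φ ψ i y *
          (∑ i ∈ S, c i * waveletFamily j₀ φ ψ i y) := h.integral_sum_mul c S (h.memLp_sum c S)
    _ = ∑ i ∈ S, c i * c i := by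
        refine Finset.sum_congr rfl fun i _ => ?_
        rw [← h.integral_sum_mul_self c S i fun hi => by rw [hc]; simp only [if_neg hi]]
        simp only [mul_comm]
    _ = kernel φ j₀ x x := by
        rw [h1]
        exact Finset.sum_congr rfl fun i hi => by rw [hc]; simp only [if_pos hi]

lemma IsWindow.kernel_sq_le (hφ : IsWindow φ ρ M) (j : ℕ) (x y : E d) :
    kernel φ j x y ^ 2 ≤ kernel φ j x x * kernel φ j y y := by
  classical
  have hx := Finset.subset_union_left (s₁ := latticeBox ρ ((2 : ℝ) ^ j • x))
    (s₂ := latticeBox ρ ((2 : ℝ) ^ j • y))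
  have hy := Finset.subset_union_right (s₁ := latticeBox ρ ((2 : ℝ) ^ j • x))
    (s₂ := latticeBox ρ ((2 : ℝ) ^ j • y))
  rw [hφ.kernel_eq_sum j x y hx, hφ.kernel_eq_sum j x x hx, hφ.kernel_eq_sum j y y hy]
  simpa only [sq] using Finset.sum_mul_sq_le_sq_mul_sq _ (fun z => WaveletKNN.dilate φ j z x)
    fun z => WaveletKNN.dilate φ j z y

/-- Cauchy–Schwarz gives K(x,y)² ≤ K(x,x) K(y,y), where K(x,x) = ∫ K(x,·)². Error terms carrying the
supremum of K(x,·)² thus become multiples of the main variance term, uniformly in `x`. -/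
lemma kernel_sq_le_integral (h : IsONB (waveletFamily j₀ φ ψ)) (hφ : IsWindow φ ρ M)
    (hρ : 0 ≤ ρ) (x y : E d) :
    kernel φ j₀ x y ^ 2
      ≤ (2 * ρ + 1) ^ d * (2 ^ j₀) ^ d * M ^ 2 * ∫ y, kernel φ j₀ x y ^ 2 := by
  refine (hφ.kernel_sq_le j₀ x y).trans ?_
  rw [integral_kernel_sq h hφ x, mul_comm]
  exact mul_le_mul_of_nonneg_right ((le_abs_self _).trans (hφ.abs_kernel_le hρ j₀ y y))
    (integral_kernel_sq h hφ x ▸ integral_nonneg fun _ => sq_nonneg _)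

/-! ### Convergence in `L²` of the kernel operators -/

lemma kernelOp_eq_sum (hφ : IsWindow φ ρ M) (hg : IsWindow g r b) (j : ℕ) (x : E d) :
    kernelOp φ j g x = ∑ z ∈ latticeBox (ρ + 2 ^ j * r) 0,
      (∫ y, g y * dilate φ j z y) * dilate φ j z x := by
  rw [kernelOp_eq_tsum hφ hg.meas hg.bound, tsum_eq_sum]
  intro z hz
  have : ∫ y, g y * dilate φ j z y = 0 := by
    by_contra hcon
    exact hz (hφ.mem_latticeBox_of_integral_ne_zero hg hcon)
  rw [this, zero_mul]

lemma memLp_kernelOp (hφ : IsWindow φ ρ M) (hg : IsWindow g r b) (j : ℕ) :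
    MemLp (kernelOp φ j g) 2 volume := by
  rw [funext (kernelOp_eq_sum hφ hg j)]
  exact memLp_finsetSum _ fun z _ => ((hφ.dilate j z).memLp 2).const_mul _

lemma integral_sub_kernelOp_mul_father (h : IsONB (waveletFamily j₀ φ ψ)) (hφ : IsWindow φ ρ M)
    (hg : IsWindow g r b) (z : Fin d → ℤ) :
    ∫ x, (g x - kernelOp φ j₀ g x) * dilate φ j₀ z x = 0 := by
  classical
  have hz := (hφ.dilate j₀ z).memLp 2
  simp only [sub_mul]
  rw [integral_sub (IsONB.integrable_mul (hg.memLp 2) hz)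
    (IsONB.integrable_mul (memLp_kernelOp hφ hg j₀) hz), sub_eq_zero]
  set S : Finset (WaveletIndex d) := (latticeBox (ρ + 2 ^ j₀ * r) 0).map
    ⟨Sum.inl, Sum.inl_injective⟩ with hS
  set c : WaveletIndex d → ℝ := fun i => ∫ y, g y * waveletFamily j₀ φ ψ i y
  have h1 := h.integral_sum_mul_self c S (Sum.inl z) fun hi => by
    by_contra hcon
    exact hi (Finset.mem_map_of_mem _ (hφ.mem_latticeBox_of_integral_ne_zero hg hcon))
  refine Eq.trans ?_ (Eq.trans h1.symm ?_)
  · rfl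
  · refine integral_congr_ae (ae_of_all _ fun x => ?_)
    simp only
    rw [kernelOp_eq_sum hφ hg, hS, Finset.sum_map]
    rfl

/-- The wavelet expansion of `g` converges to `g` in quadratic mean. -/
theorem tendsto_integral_sub_kernelOp_sq (h : IsONB (waveletFamily j₀ φ ψ)) (hφ : IsWindow φ ρ M)
    (hψ : ∀ q, IsWindow (ψ q) ρ M) (hg : IsWindow g r b) :
    Tendsto (fun m => ∫ x, (g x - kernelOp φ (j₀ + m) g x) ^ 2) atTop (𝓝 0) := by
  classical
  set e := waveletFamily j₀ φ ψ with he
  have hmem : ∀ m, MemLp (fun x => g x - kernelOp φ (j₀ + m) g x) 2 volume := fun m =>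
    (hg.memLp 2).sub (memLp_kernelOp hφ hg _)
  -- The residual is orthogonal to all wavelets of lower level and has the coefficients of `g` on
  -- the rest, so its squared norm is a tail of the Parseval series of `g`.
  have h1 : ∀ m i, ∫ x, (g x - kernelOp φ (j₀ + m) g x) * e i x
      = if IsBelow m i then 0 else ∫ x, g x * e i x := by
    intro m i
    split_ifs with hb
    · obtain ⟨A, -, hA⟩ := exists_ae_eq_sum_father h hφ hψ hb
      set c : (Fin d → ℤ) → ℝ := fun z => ∫ x, e i x * dilate φ (j₀ + m) z x
      have h2 : ∫ x, (g x - kernelOp φ (j₀ + m) g x) * e i x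
          = ∫ x, ∑ z ∈ A, c z * ((g x - kernelOp φ (j₀ + m) g x) * dilate φ (j₀ + m) z x) := by
        refine integral_congr_ae ?_
        filter_upwards [hA] with x hx
        simp only [he]
        rw [hx, Finset.mul_sum]
        exact Finset.sum_congr rfl fun z _ => by simp only [c, he]; ring
      rw [h2, integral_finsetSum]
      · refine Finset.sum_eq_zero fun z _ => ?_
        rw [integral_const_mul, integral_sub_kernelOp_mul_father (h.add m) hφ hg, mul_zero]
      · exact fun z _ => (IsONB.integrable_mul (hmem m) ((hφ.dilate _ z).memLp 2)).const_mul _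
    · simp only [sub_mul]
      rw [integral_sub (IsONB.integrable_mul (hg.memLp 2) (h.memLp i))
        (IsONB.integrable_mul (memLp_kernelOp hφ hg _) (h.memLp i)), sub_eq_self]
      simp only [kernelOp_eq_sum hφ hg, Finset.sum_mul, mul_assoc]
      rw [integral_finsetSum]
      · refine Finset.sum_eq_zero fun z _ => ?_
        rw [integral_const_mul, integral_father_mul_eq_zero h hb, mul_zero]
      · exact fun z _ => (IsONB.integrable_mul ((hφ.dilate _ z).memLp 2) (h.memLp i)).const_mul _
  have h3 : ∀ m, ∫ x, (g x - kernelOp φ (j₀ + m) g x) ^ 2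
      = ∑' i, (if IsBelow m i then 0 else ∫ x, g x * e i x) ^ 2 := fun m => by
    rw [← (h.parseval _ (hmem m)).tsum_eq]
    exact tsum_congr fun i => by rw [h1]
  simp only [h3]
  rw [← tsum_zero (α := ℝ) (β := WaveletIndex d)]
  refine tendsto_tsum_of_dominated_convergence (h.parseval g (hg.memLp 2)).summable
    (fun i => ?_) (Eventually.of_forall fun m i => ?_)
  · obtain ⟨m₀, hm₀⟩ : ∃ m₀, ∀ m ≥ m₀, IsBelow m i := by
      rcases i with z | ⟨l, z, q⟩
      · exact ⟨0, fun _ _ => trivial⟩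
      · exact ⟨l + 1, fun m hm => Nat.lt_of_succ_le hm⟩
    refine tendsto_const_nhds.congr' (eventually_atTop.2 ⟨m₀, fun m hm => ?_⟩)
    simp [hm₀ m hm]
  · rw [Real.norm_of_nonneg (sq_nonneg _)]
    split_ifs
    · simpa using sq_nonneg _
    · exact le_rfl

end Approximation

section UnitMass

variable {d j₀ : ℕ} {φ g : E d → ℝ} {ψ : Q d → E d → ℝ} {ρ M r b : ℝ}

/-! ### Periodic functions and integer dilations -/

/-- The unit cube `[0, 1)^d`. -/
def unitCube (d : ℕ) : Set (E d) := {x | ∀ i, 0 ≤ x i ∧ x i < 1}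

lemma measurableSet_unitCube : MeasurableSet (unitCube d) := by
  have h1 : unitCube d = ⋂ i : Fin d, {x : E d | 0 ≤ x i ∧ x i < 1} := by
    ext x
    simp [unitCube]
  rw [h1]
  refine MeasurableSet.iInter fun i => ?_
  have h2 : Measurable fun x : E d => x i := by fun_prop
  exact (measurableSet_le measurable_const h2).inter (measurableSet_lt h2 measurable_const)

lemma norm_le_of_mem_unitCube {x : E d} (hx : x ∈ unitCube d) : ‖x‖ ≤ √(d : ℝ) := by
  rw [EuclideanSpace.norm_eq]
  refine Real.sqrt_le_sqrt ?_
  calc ∑ i, ‖x i‖ ^ 2 ≤ ∑ _i : Fin d, (1 : ℝ) := Finset.sum_le_sum fun i _ => by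
        rw [Real.norm_of_nonneg (hx i).1]
        exact pow_le_one₀ (hx i).1 (hx i).2.le
    _ = d := by simp

lemma exists_sub_latticePoint_mem_unitCube (x : E d) :
    ∃ z : Fin d → ℤ, x - latticePoint z ∈ unitCube d :=
  ⟨fun i => ⌊x i⌋, fun i => by simpa [latticePoint] using Int.fract_lt_one (x i)⟩

lemma eq_of_sub_latticePoint_mem_unitCube {x : E d} {z z' : Fin d → ℤ}
    (h : x - latticePoint z ∈ unitCube d) (h' : x - latticePoint z' ∈ unitCube d) : z = z' := by
  funext i
  have h1 := h i
  have h2 := h' i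
  simp only [latticePoint, PiLp.sub_apply] at h1 h2
  have e1 : ⌊x i⌋ = z i := Int.floor_eq_iff.2 ⟨by linarith, by linarith⟩
  have e2 : ⌊x i⌋ = z' i := Int.floor_eq_iff.2 ⟨by linarith, by linarith⟩
  rw [← e1, e2]

/-- For a periodic function, the mean over the unit cube is at most that of its dilates. -/
lemma setLIntegral_unitCube_le {β : E d → ENNReal}
    (hβ : ∀ (z : Fin d → ℤ) x, β (x + latticePoint z) = β x) (N : ℕ) (hN : 0 < N) :
    ∫⁻ x in unitCube d, β x ≤ ∫⁻ x in unitCube d, β ((N : ℝ) • x) := by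
  classical
  have hN' : (0 : ℝ) < N := Nat.cast_pos.2 hN
  set I : Finset (Fin d → ℤ) := Fintype.piFinset fun _ => Finset.Ico (0 : ℤ) N with hI
  have hcard : I.card = N ^ d := by simp [hI]
  have htrans : ∀ z, ∫⁻ x in {x | x - latticePoint z ∈ unitCube d}, β x
      = ∫⁻ x in unitCube d, β x := by
    intro z
    have hm : MeasurableSet {x : E d | x - latticePoint z ∈ unitCube d} :=
      measurableSet_unitCube.preimage (measurable_id.sub_const _)
    rw [← lintegral_indicator hm, ← lintegral_indicator measurableSet_unitCube,
      ← lintegral_add_right_eq_self _ (latticePoint z)]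
    refine lintegral_congr fun x => ?_
    simp only [Set.indicator, Set.mem_ofPred_eq, add_sub_cancel_right, hβ]
  -- The N^d integer translates of the unit cube with corners in {0, …, N-1}^d are disjoint and
  -- contained in the cube of side N. Containment suffices for the inequality.
  have hsum : (N ^ d : ENNReal) * ∫⁻ x in unitCube d, β x
      ≤ ∫⁻ x in {x | (N : ℝ)⁻¹ • x ∈ unitCube d}, β x := by
    calc (N ^ d : ENNReal) * ∫⁻ x in unitCube d, β x
        = ∑ z ∈ I, ∫⁻ x in {x | x - latticePoint z ∈ unitCube d}, β x := by
          simp only [htrans, Finset.sum_const, hcard, nsmul_eq_mul, Nat.cast_pow]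
      _ = ∫⁻ x in ⋃ z ∈ I, {x | x - latticePoint z ∈ unitCube d}, β x := by
          refine (lintegral_biUnion_finset (fun z _ z' _ hzz => ?_) (fun z _ =>
            measurableSet_unitCube.preimage (measurable_id.sub_const _)) β).symm
          exact Set.disjoint_left.2 fun x hx hx' =>
            hzz (eq_of_sub_latticePoint_mem_unitCube hx hx')
      _ ≤ _ := by
          refine lintegral_mono_set fun x hx i => ?_
          obtain ⟨z, hz, hx⟩ := Set.mem_iUnion₂.1 hx
          have h1 := hx i
          have h2 := Finset.mem_Ico.1 (Fintype.mem_piFinset.1 hz i)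
          have h3 : (0 : ℝ) ≤ z i := Int.cast_nonneg h2.1
          have h4 : (z i : ℝ) + 1 ≤ N := by exact_mod_cast h2.2
          simp only [latticePoint, PiLp.sub_apply] at h1
          simp only [PiLp.smul_apply, smul_eq_mul]
          rw [inv_mul_lt_iff₀ hN']
          exact ⟨mul_nonneg (inv_nonneg.2 hN'.le) (by linarith), by linarith⟩
  have hscale : ∫⁻ x in {x | (N : ℝ)⁻¹ • x ∈ unitCube d}, β x
      = (N ^ d : ENNReal) * ∫⁻ x in unitCube d, β ((N : ℝ) • x) := by
    have hm : MeasurableSet {x : E d | (N : ℝ)⁻¹ • x ∈ unitCube d} :=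
      measurableSet_unitCube.preimage (measurable_const_smul _)
    rw [← lintegral_indicator hm, ← lintegral_indicator measurableSet_unitCube]
    have h1 := (measurableEmbedding_const_smul₀ (α := E d) hN'.ne').lintegral_map (μ := volume)
      ({x : E d | (N : ℝ)⁻¹ • x ∈ unitCube d}.indicator β)
    rw [Measure.map_addHaar_smul volume hN'.ne', lintegral_smul_measure,
      finrank_euclideanSpace_fin, abs_of_nonneg (by positivity)] at h1
    have h2 : ∀ x : E d, {x : E d | (N : ℝ)⁻¹ • x ∈ unitCube d}.indicator β ((N : ℝ) • x)
        = (unitCube d).indicator (fun x => β ((N : ℝ) • x)) x := by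
      intro x
      simp only [Set.indicator, Set.mem_ofPred_eq, inv_smul_smul₀ hN'.ne']
    simp only [h2] at h1
    rw [← h1, smul_eq_mul, ← mul_assoc, ENNReal.ofReal_inv_of_pos (by positivity),
      ENNReal.ofReal_pow hN'.le, ENNReal.ofReal_natCast, ENNReal.mul_inv_cancel, one_mul]
    · exact pow_ne_zero _ (Nat.cast_ne_zero.2 hN.ne')
    · exact ENNReal.pow_ne_top (ENNReal.natCast_ne_top N)
  rw [hscale] at hsum
  exact (ENNReal.mul_le_mul_iff_right (pow_ne_zero _ (Nat.cast_ne_zero.2 hN.ne'))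
    (ENNReal.pow_ne_top (ENNReal.natCast_ne_top N))).1 hsum

/-! ### The kernels integrate to one -/

lemma kernelOp_one_scale (φ : E d → ℝ) (j : ℕ) (x : E d) :
    kernelOp φ j (fun _ => 1) x = kernelOp φ 0 (fun _ => 1) ((2 : ℝ) ^ j • x) := by
  simp only [kernelOp, mul_one]
  rw [← integral_two_pow_smul (kernel φ 0 ((2 : ℝ) ^ j • x)) j, ← integral_const_mul]
  simp only [kernel_eq_kernel_zero φ j]

lemma kernelOp_one_eq_tsum (hφ : IsWindow φ ρ M) (x : E d) :
    kernelOp φ 0 (fun _ => 1) x = ∑' z, (∫ y, φ y) * φ (x - latticePoint z) := by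
  rw [kernelOp_eq_tsum hφ aestronglyMeasurable_const (M' := 1) (by simp)]
  refine tsum_congr fun z => ?_
  simp only [dilate, Nat.cast_zero, mul_zero, zero_div, Real.rpow_zero, one_mul, pow_zero, one_smul]
  rw [integral_sub_right_eq_self]

lemma kernelOp_one_add_latticePoint (hφ : IsWindow φ ρ M) (z : Fin d → ℤ) (x : E d) :
    kernelOp φ 0 (fun _ => 1) (x + latticePoint z) = kernelOp φ 0 (fun _ => 1) x := by
  rw [kernelOp_one_eq_tsum hφ, kernelOp_one_eq_tsum hφ, ← (Equiv.addRight z).tsum_eq]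
  refine tsum_congr fun w => ?_
  have : latticePoint (w + z) = latticePoint w + latticePoint z := by
    ext i
    simp [latticePoint]
  rw [Equiv.coe_addRight, this, add_sub_add_right_eq_sub]

/-- The constant 1 is not in L² for d > 0. As the kernel has range at most 2ρ at every level, the
indicator of a ball can take its place. -/
lemma kernelOp_one_eq_kernelOp_indicator (hφ : IsWindow φ ρ M) (hρ : 0 ≤ ρ) {R : ℝ} {x : E d}
    (hx : ‖x‖ ≤ R) (j : ℕ) :
    kernelOp φ j ((Metric.closedBall 0 (R + 2 * ρ)).indicator fun _ => 1) x
      = kernelOp φ j (fun _ => 1) x := by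
  refine integral_congr_ae (ae_of_all _ fun y => ?_)
  by_cases hy : kernel φ j x y = 0
  · simp [hy]
  · have h1 := hφ.dist_le_of_kernel_ne_zero hy
    have h2 : 2 * ρ / 2 ^ j ≤ 2 * ρ := div_le_self (by positivity) (one_le_pow₀ (by norm_num))
    rw [dist_eq_norm] at h1
    have h3 := norm_le_norm_sub_add y x
    simp only
    rw [Set.indicator_of_mem]
    rw [mem_closedBall_zero_iff]
    linarith

lemma aestronglyMeasurable_kernelOp_one (hφ : IsWindow φ ρ M) :
    AEStronglyMeasurable (kernelOp φ 0 fun _ => 1) (volume.restrict (unitCube d)) := by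
  set A : Finset (Fin d → ℤ) := latticeBox (√(d : ℝ) + ρ) 0
  refine AEStronglyMeasurable.congr (f := fun x => ∑ z ∈ A, (∫ y, φ y) * φ (x - latticePoint z))
    ?_ ?_
  · refine AEStronglyMeasurable.restrict (Finset.aestronglyMeasurable_fun_sum _ fun z _ => ?_)
    have := hφ.meas.comp_quasiMeasurePreserving
      (quasiMeasurePreserving_smul_sub one_ne_zero (latticePoint z))
    simp only [one_smul] at this
    exact this.const_mul _
  · filter_upwards [ae_restrict_mem measurableSet_unitCube] with x hx
    rw [kernelOp_one_eq_tsum hφ, tsum_eq_sum]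
    intro z hz
    by_contra hcon
    refine hz (mem_latticeBox ?_)
    have h1 := hφ.supp _ (right_ne_zero_of_mul hcon)
    have h2 := norm_le_of_mem_unitCube hx
    calc ‖(0 : E d) - latticePoint z‖ = ‖(x - latticePoint z) - x‖ := by congr 1; abel
      _ ≤ _ := norm_sub_le _ _
      _ ≤ _ := by linarith

/-- The deviation of K_0 1 from 1 is periodic, so its mean square over the unit cube is at most that
of its dilate by 2^j, which is the deviation of K_j 1. On the cube the latter is the residual of a
fixed ball's indicator, whose L² norm tends to 0. So K_0 1 = 1 almost everywhere on the cube, and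
then everywhere up to a null set by periodicity. -/
theorem ae_kernelOp_one_eq (h : IsONB (waveletFamily j₀ φ ψ)) (hφ : IsWindow φ ρ M)
    (hρ : 0 ≤ ρ) (hψ : ∀ q, IsWindow (ψ q) ρ M) : ∀ᵐ x : E d, kernelOp φ 0 (fun _ => 1) x = 1 := by
  set G : E d → ℝ := kernelOp φ 0 fun _ => 1 with hG
  set β : E d → ENNReal := fun x => ENNReal.ofReal ((1 - G x) ^ 2) with hβ
  set R := √(d : ℝ)
  set g : E d → ℝ := (Metric.closedBall 0 (R + 2 * ρ)).indicator fun _ => 1 with hgdef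
  have hg : IsWindow g (R + 2 * ρ) 1 := by
    refine ⟨(aestronglyMeasurable_const.indicator Metric.isClosed_closedBall.measurableSet),
      fun x => ?_, fun x hx => ?_⟩
    · rw [hgdef, Set.indicator]
      split_ifs <;> simp
    · simpa using Set.mem_of_indicator_ne_zero hx
  have hle : ∀ m, ∫⁻ x in unitCube d, β x
      ≤ ENNReal.ofReal (∫ x, (g x - kernelOp φ (j₀ + m) g x) ^ 2) := by
    intro m
    have h1 := setLIntegral_unitCube_le (β := β) (fun z x => by
      simp only [hβ, hG, kernelOp_one_add_latticePoint hφ]) (2 ^ (j₀ + m)) (by positivity)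
    refine h1.trans ?_
    rw [ofReal_integral_eq_lintegral_ofReal (f := fun x => (g x - kernelOp φ (j₀ + m) g x) ^ 2)
      ((hg.memLp 2).sub (memLp_kernelOp hφ hg _)).integrable_sq (ae_of_all _ fun _ => sq_nonneg _)]
    refine le_trans (le_of_eq (setLIntegral_congr_fun measurableSet_unitCube fun x hx => ?_))
      (setLIntegral_le_lintegral (unitCube d) _)
    have h2 := norm_le_of_mem_unitCube hx
    have h3 : g x = 1 := Set.indicator_of_mem (by
      rw [mem_closedBall_zero_iff]; linarith) _
    simp only [hβ, hG]
    rw [h3, hgdef, kernelOp_one_eq_kernelOp_indicator hφ hρ h2, kernelOp_one_scale φ (j₀ + m)]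
    push_cast
    rfl
  have hzero : ∫⁻ x in unitCube d, β x = 0 := by
    have h1 := ENNReal.tendsto_ofReal (tendsto_integral_sub_kernelOp_sq h hφ hψ hg)
    rw [ENNReal.ofReal_zero] at h1
    exact le_antisymm (ge_of_tendsto' h1 hle) zero_le
  have hcube : ∀ᵐ x, x ∈ unitCube d → G x = 1 := by
    rw [← ae_restrict_iff' measurableSet_unitCube]
    have hGm : AEMeasurable G (volume.restrict (unitCube d)) :=
      (aestronglyMeasurable_kernelOp_one hφ).aemeasurable
    rw [lintegral_eq_zero_iff' (by fun_prop)] at hzero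
    filter_upwards [hzero] with x hx
    simp only [hβ, Pi.zero_apply, ENNReal.ofReal_eq_zero] at hx
    have := pow_eq_zero_iff (two_ne_zero) |>.1 (le_antisymm hx (sq_nonneg _))
    linarith
  have hall : ∀ z : Fin d → ℤ, ∀ᵐ x, x - latticePoint z ∈ unitCube d → G (x - latticePoint z) = 1 := by
    intro z
    have h1 := (quasiMeasurePreserving_smul_sub one_ne_zero (latticePoint z)).ae hcube
    simpa only [one_smul] using h1
  filter_upwards [ae_all_iff.2 hall] with x hx
  obtain ⟨z, hz⟩ := exists_sub_latticePoint_mem_unitCube x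
  have h1 := kernelOp_one_add_latticePoint hφ z (x - latticePoint z)
  rw [sub_add_cancel] at h1
  exact h1.trans (hx z hz)

lemma ae_forall_kernelOp_one_eq (h : IsONB (waveletFamily j₀ φ ψ)) (hφ : IsWindow φ ρ M)
    (hρ : 0 ≤ ρ) (hψ : ∀ q, IsWindow (ψ q) ρ M) :
    ∀ᵐ x : E d, ∀ j, kernelOp φ j (fun _ => 1) x = 1 := by
  refine ae_all_iff.2 fun j => ?_
  have h1 := (quasiMeasurePreserving_smul_sub (d := d) (c := 2 ^ j) (by positivity) 0).ae
    (ae_kernelOp_one_eq h hφ hρ hψ)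
  filter_upwards [h1] with x hx
  rw [sub_zero] at hx
  rw [kernelOp_one_scale, hx]

/-! ### Pointwise convergence of the kernel operators -/

/-- Approximate identity: the mass is 1, the range 2ρ/2^j shrinks, and the size of order 2^(jd)
balances the volume of the range, so the L¹ norm stays below the constant `K`. -/
theorem tendsto_kernelOp (hφ : IsWindow φ ρ M) (hρ : 0 ≤ ρ) {s : E d → ℝ} {x : E d}
    (hs : AEStronglyMeasurable s volume) (hb : ∀ y, |s y| ≤ b) (hx : ContinuousAt s x)
    (h1 : ∀ j, kernelOp φ j (fun _ => 1) x = 1) :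
    Tendsto (fun j => kernelOp φ j s x) atTop (𝓝 (s x)) := by
  set K := (2 * ρ + 1) ^ d * M ^ 2 * (unitBallVolume d * (2 * ρ) ^ d) with hK
  have hK0 : 0 ≤ K := by
    have := unitBallVolume_pos d
    positivity
  rw [Metric.tendsto_atTop]
  intro ε hε
  obtain ⟨δ, hδ, hδs⟩ := Metric.continuousAt_iff.1 hx (ε / (K + 1)) (by positivity)
  have h2 : Tendsto (fun j : ℕ => 2 * ρ / (2 : ℝ) ^ j) atTop (𝓝 0) :=
    tendsto_const_nhds.div_atTop (tendsto_pow_atTop_atTop_of_one_lt (by norm_num))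
  obtain ⟨j₁, hj₁⟩ := eventually_atTop.1 (h2.eventually_lt_const hδ)
  refine ⟨j₁, fun j hj => ?_⟩
  have h3 := hφ.kernel_window hρ j x
  have h4 : kernelOp φ j s x - s x = ∫ y in Metric.closedBall x (2 * ρ / 2 ^ j),
      kernel φ j x y * (s y - s x) := by
    calc kernelOp φ j s x - s x = kernelOp φ j s x - s x * kernelOp φ j (fun _ => 1) x := by
          rw [h1, mul_one]
      _ = ∫ y, (kernel φ j x y * s y - s x * (kernel φ j x y * 1)) := by
          rw [integral_sub (h3.mul hs hb).integrable, integral_const_mul]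
          · rfl
          · simpa using h3.integrable.const_mul (s x)
      _ = ∫ y, kernel φ j x y * (s y - s x) := integral_congr_ae (ae_of_all _ fun y => by
          simp only; ring)
      _ = _ := by
          refine (setIntegral_eq_integral_of_forall_compl_eq_zero fun y hy => ?_).symm
          have : kernel φ j x y = 0 := by
            by_contra hcon
            exact hy (hφ.dist_le_of_kernel_ne_zero hcon)
          rw [this, zero_mul]
  have h5 := norm_setIntegral_le_of_norm_le_const (μ := volume)
    (s := Metric.closedBall x (2 * ρ / 2 ^ j)) (f := fun y => kernel φ j x y * (s y - s x))
    (C := (2 * ρ + 1) ^ d * (2 ^ j) ^ d * M ^ 2 * (ε / (K + 1))) measure_closedBall_lt_top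
    fun y hy => by
      rw [norm_mul]
      refine mul_le_mul (hφ.abs_kernel_le hρ j x y) ?_ (norm_nonneg _) (by positivity)
      exact (hδs (lt_of_le_of_lt hy (hj₁ j hj))).le
  rw [volume_real_closedBall x (by positivity)] at h5
  rw [Real.dist_eq, h4]
  refine lt_of_le_of_lt h5 ?_
  calc _ = K / (K + 1) * ε := by
        rw [hK, div_pow]
        field_simp
    _ < 1 * ε := by
        refine mul_lt_mul_of_pos_right ?_ hε
        rw [div_lt_one (by positivity)]
        linarith
    _ = ε := one_mul ε

end UnitMass

/-! ### Ratios of Gamma functions -/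

/-- Log-convexity of Gamma at the midpoint of x and x + 1. -/
lemma Gamma_add_half_le {x : ℝ} (hx : 0 < x) :
    Real.Gamma (x + 1 / 2) ≤ √x * Real.Gamma x := by
  have h1 := Real.Gamma_mul_add_mul_le_rpow_Gamma_mul_rpow_Gamma (s := x) (t := x + 1)
    (a := 1 / 2) (b := 1 / 2) hx (by linarith) (by norm_num) (by norm_num) (by norm_num)
  have hG := Real.Gamma_pos_of_pos hx
  rw [Real.Gamma_add_one hx.ne', ← Real.sqrt_eq_rpow, ← Real.sqrt_eq_rpow, Real.sqrt_mul hx.le,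
    mul_left_comm, Real.mul_self_sqrt hG.le] at h1
  convert h1 using 2
  ring

lemma mul_Gamma_le {x : ℝ} (hx : 0 < x) :
    x * Real.Gamma x ≤ √(x + 1 / 2) * Real.Gamma (x + 1 / 2) := by
  have h1 := Gamma_add_half_le (x := x + 1 / 2) (by linarith)
  rwa [add_assoc, add_halves, Real.Gamma_add_one hx.ne'] at h1

lemma gammaRatio_pos {k : ℕ} (hk : 1 ≤ k) : 0 < gammaRatio k := by
  have hk' : (0 : ℝ) < k := Nat.cast_pos.2 hk
  exact div_pos (Real.Gamma_pos_of_pos hk') (Real.Gamma_pos_of_pos (by linarith))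

lemma one_le_sqrt_mul_gammaRatio {k : ℕ} (hk : 1 ≤ k) : 1 ≤ √(k : ℝ) * gammaRatio k := by
  have hk' : (0 : ℝ) < k := Nat.cast_pos.2 hk
  rw [gammaRatio, mul_div_assoc', one_le_div (Real.Gamma_pos_of_pos (by linarith))]
  exact Gamma_add_half_le hk'

lemma sqrt_mul_gammaRatio_le {k : ℕ} (hk : 1 ≤ k) :
    √(k : ℝ) * gammaRatio k ≤ 1 + 1 / k := by
  have hk' : (0 : ℝ) < k := Nat.cast_pos.2 hk
  have hG := Real.Gamma_pos_of_pos (show (0 : ℝ) < k + 1 / 2 by linarith)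
  rw [gammaRatio, mul_div_assoc', div_le_iff₀ hG]
  have h1 := mul_Gamma_le hk'
  have h2 : √(k : ℝ) * √((k : ℝ) + 1 / 2) ≤ k + 1 := by
    rw [← Real.sqrt_mul hk'.le]
    refine Real.sqrt_le_iff.2 ⟨by linarith, by nlinarith⟩
  have h3 : (1 : ℝ) + 1 / k = (k + 1) / k := by field_simp
  rw [h3, div_mul_eq_mul_div, le_div_iff₀ hk']
  calc √(k : ℝ) * Real.Gamma k * k = √(k : ℝ) * (k * Real.Gamma k) := by ring
    _ ≤ √(k : ℝ) * (√((k : ℝ) + 1 / 2) * Real.Gamma (k + 1 / 2)) := by gcongr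
    _ = √(k : ℝ) * √((k : ℝ) + 1 / 2) * Real.Gamma (k + 1 / 2) := by ring
    _ ≤ _ := by gcongr

lemma sqrt_mul_gammaRatio_le_two {k : ℕ} (hk : 1 ≤ k) : √(k : ℝ) * gammaRatio k ≤ 2 := by
  have h1 : (1 : ℝ) / k ≤ 1 := (div_le_one (Nat.cast_pos.2 hk)).2 (Nat.one_le_cast.2 hk)
  linarith [sqrt_mul_gammaRatio_le hk]

/-- This explains the normalisation of the estimator: the dependence on `k` of the mean of √U
cancels exactly, leaving a quantity of the sample size m + 1 alone. -/
lemma gammaRatio_mul_betaMoment (m : ℕ) {k : ℕ} (hk : 1 ≤ k) :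
    gammaRatio k * betaMoment m k (1 / 2) = gammaRatio (m + 1) := by
  have hk' : (0 : ℝ) < k := Nat.cast_pos.2 hk
  have h1 := (Real.Gamma_pos_of_pos hk').ne'
  have h2 := (Real.Gamma_pos_of_pos (show (0 : ℝ) < k + 1 / 2 by linarith)).ne'
  have h3 := (Real.Gamma_pos_of_pos (show (0 : ℝ) < (m : ℝ) + 1 + 1 / 2 by positivity)).ne'
  rw [gammaRatio, gammaRatio, betaMoment]
  push_cast
  field_simp

/-! ### The law of the sample -/

section Sample

variable {d : ℕ} {f : E d → ℝ} {C : Set (E d)} {π : E d → E d} {D : ℝ}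
  {Ω : Type*} [MeasurableSpace Ω] {P : Measure Ω} {X : ℕ → Ω → E d}

lemma SampleAssumption.map_eq (hX : SampleAssumption P X f) (i : ℕ) :
    P.map (X i) = densityMeasure f := by
  rw [hX.law, densityMeasure]

lemma SampleAssumption.law_absolutelyContinuous (hX : SampleAssumption P X f) (i : ℕ) :
    P.map (X i) ≪ volume := by
  rw [hX.law]
  exact withDensity_absolutelyContinuous _ _

lemma SampleAssumption.measurable_sample (hX : SampleAssumption P X f) (n : ℕ) :
    Measurable (sample X n) :=
  measurable_pi_lambda _ fun i => hX.measurable i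

/-- An almost everywhere bounded function has a measurable version bounded by the same
constant. -/
lemma exists_measurable_abs_le_ae_eq {w : E d → ℝ} (hw : AEStronglyMeasurable w volume) {B : ℝ}
    (hB : ∀ x, |w x| ≤ B) : ∃ w' : E d → ℝ, Measurable w' ∧ (∀ x, |w' x| ≤ B) ∧ w =ᵐ[volume] w' := by
  have hB0 : 0 ≤ B := (abs_nonneg _).trans (hB 0)
  refine ⟨fun x => max (-B) (min B (hw.mk w x)),
    measurable_const.max (measurable_const.min hw.stronglyMeasurable_mk.measurable),
    fun x => abs_le.2 ⟨le_max_left _ _, max_le (by linarith) (min_le_left _ _)⟩, ?_⟩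
  filter_upwards [hw.ae_eq_mk] with x hx
  have h1 := abs_le.1 (hB x)
  rw [← hx, min_eq_right h1.2, max_eq_right h1.1]

/-- Transfers results for genuinely measurable weights and retracted points to the kernel, which is
only almost everywhere measurable, and to the actual sample. -/
lemma SampleAssumption.ae_knnSum_eq (hX : SampleAssumption P X f) (h : DensityAssumption f C)
    (hπ : IsRetraction C π) {w w' : E d → ℝ} (hw : w =ᵐ[volume] w') (n k : ℕ) :
    ∀ᵐ ω ∂P, knnSum k w (sample X n ω) = knnSum k w' fun j => π (sample X n ω j) := by
  have h1 : ∀ i, ∀ᵐ ω ∂P, w (X i ω) = w' (X i ω) := fun i =>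
    ae_of_ae_map (hX.measurable i).aemeasurable ((hX.law_absolutelyContinuous i).ae_le hw)
  have h2 : ∀ i, ∀ᵐ ω ∂P, X i ω ∈ C := fun i => by
    refine ae_of_ae_map (hX.measurable i).aemeasurable ?_
    rw [hX.map_eq]
    exact h.ae_mem
  filter_upwards [ae_all_iff.2 h1, ae_all_iff.2 h2] with ω hω hC
  have h3 : (fun j => π (sample X n ω j)) = sample X n ω := funext fun j => hπ.eq _ (hC j)
  rw [h3, knnSum, knnSum]
  exact Finset.sum_congr rfl fun i _ => by simp only [sample, hω]

variable [IsProbabilityMeasure P]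

lemma SampleAssumption.isProbabilityMeasure (hX : SampleAssumption P X f) :
    IsProbabilityMeasure (densityMeasure f) := by
  rw [← hX.map_eq 0]
  exact Measure.isProbabilityMeasure_map (hX.measurable 0).aemeasurable

lemma SampleAssumption.map_sample (hX : SampleAssumption P X f) (n : ℕ) :
    P.map (sample X n) = Measure.pi fun _ : Fin n => densityMeasure f := by
  have h1 := (iIndepFun_iff_map_fun_eq_pi_map
    (f := fun (i : Fin n) => X i) fun i => (hX.measurable i).aemeasurable).1
    (hX.indep.precomp (g := fun i : Fin n => (i : ℕ)) Fin.val_injective)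
  simp only [hX.map_eq] at h1
  exact h1

/-- The moments of a `k`-nearest neighbour sum over the sample. -/
lemma SampleAssumption.moments_knnSum (hX : SampleAssumption P X f) (h : DensityAssumption f C)
    (hπ : IsRetraction C π) (hD : ∀ x ∈ C, ∀ y ∈ C, dist x y ≤ D) {w w' : E d → ℝ}
    (hw : w =ᵐ[volume] w') (hw' : BddMeasurable w') {m k : ℕ} (hk : 1 ≤ k) (hkm : k ≤ m) (c : ℝ) :
    MemLp (fun ω => c * knnSum k w (sample X (m + 1) ω)) 2 P ∧
    ∫ ω, c * knnSum k w (sample X (m + 1) ω) ∂P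
      = c * ∫ x, knnSum k w' (fun j => π (x j)) ∂(Measure.pi fun _ : Fin (m + 1) => densityMeasure f) ∧
    variance (fun ω => c * knnSum k w (sample X (m + 1) ω)) P = c ^ 2 *
      ((∫ x, knnSum k w' (fun j => π (x j)) ^ 2
          ∂(Measure.pi fun _ : Fin (m + 1) => densityMeasure f))
        - (∫ x, knnSum k w' (fun j => π (x j))
          ∂(Measure.pi fun _ : Fin (m + 1) => densityMeasure f)) ^ 2) := by
  have hS := bddMeasurable_knnSum hπ hD hk hkm hw'
  have hae := hX.ae_knnSum_eq h hπ hw (m + 1) k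
  have hsm := hX.measurable_sample (m + 1)
  have hL : MemLp (fun ω => knnSum k w (sample X (m + 1) ω)) 2 P := by
    obtain ⟨B, hB⟩ := hS.bounded
    exact (memLp_congr_ae hae).2 (MemLp.of_bound
      (hS.measurable.comp hsm).aestronglyMeasurable B (ae_of_all _ fun ω => hB _))
  have h1 : ∫ ω, knnSum k w (sample X (m + 1) ω) ∂P
      = ∫ x, knnSum k w' (fun j => π (x j)) ∂(Measure.pi fun _ : Fin (m + 1) => densityMeasure f) := by
    rw [← hX.map_sample, integral_map hsm.aemeasurable hS.measurable.aestronglyMeasurable]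
    exact integral_congr_ae hae
  have h2 : ∫ ω, knnSum k w (sample X (m + 1) ω) ^ 2 ∂P
      = ∫ x, knnSum k w' (fun j => π (x j)) ^ 2
        ∂(Measure.pi fun _ : Fin (m + 1) => densityMeasure f) := by
    rw [← hX.map_sample, integral_map hsm.aemeasurable
      (hS.measurable.pow_const 2).aestronglyMeasurable]
    refine integral_congr_ae ?_
    filter_upwards [hae] with ω hω
    rw [hω]
  refine ⟨hL.const_mul c, ?_, ?_⟩
  · rw [integral_const_mul, h1]
  · rw [variance_const_mul, variance_eq_sub hL, h1, ← h2]
    rfl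

end Sample

/-! ### Mean and variance of the estimator for finite samples -/

section Moments

variable {d : ℕ} {f φ : E d → ℝ} {ψ : Q d → E d → ℝ} {C : Set (E d)} {ρ M : ℝ}
  {Ω : Type*} [MeasurableSpace Ω] {P : Measure Ω} [IsProbabilityMeasure P] {X : ℕ → Ω → E d}

lemma memLp_sqrtEstimator (hX : SampleAssumption P X f) (h : DensityAssumption f C)
    (hφ : IsWindow φ ρ M) (hρ : 0 ≤ ρ) (J : ℕ) {m k : ℕ} (hk : 1 ≤ k) (hkm : k ≤ m) (x : E d) :
    MemLp (fun ω => sqrtEstimator φ J k (sample X (m + 1) ω) x) 2 P := by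
  have := hX.isProbabilityMeasure
  obtain ⟨π, hπ⟩ := h.exists_retraction
  obtain ⟨D, -, hD⟩ := h.exists_dist_le
  obtain ⟨w, hw, hwB, hww⟩ := exists_measurable_abs_le_ae_eq
    (hφ.kernel_aestronglyMeasurable (J + 1) x) (hφ.abs_kernel_le hρ (J + 1) x)
  simp only [sqrtEstimator_eq hφ]
  exact (hX.moments_knnSum h hπ hD hww ⟨hw, _, hwB⟩ hk hkm _).1

lemma kernelOp_eq_setIntegral (h : DensityAssumption f C) {j : ℕ} {x : E d} {w : E d → ℝ}
    (hw : kernel φ j x =ᵐ[volume] w) :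
    kernelOp φ j (fun y => √(f y)) x = ∫ y in C, w y * √(f y) := by
  rw [setIntegral_eq_integral_of_forall_compl_eq_zero fun y hy => by
    rw [h.zero_off y hy, Real.sqrt_zero, mul_zero]]
  refine integral_congr_ae ?_
  filter_upwards [hw] with y hy
  rw [hy]

/-- Two errors add up: the one of `exists_bias_le`, and the deviation of √n Γ(n)/Γ(n+1/2) from 1,
which is at most 1/n. -/
theorem exists_bias_sqrtEstimator_le (hd : 0 < d) (hX : SampleAssumption P X f)
    (h : DensityAssumption f C) (hφ : IsWindow φ ρ M) (hρ : 0 ≤ ρ) (J : ℕ) :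
    ∃ A : ℝ, 0 ≤ A ∧ ∀ m k : ℕ, 1 ≤ k → k ≤ m → ∀ x,
      |(∫ ω, sqrtEstimator φ J k (sample X (m + 1) ω) x ∂P)
          - kernelOp φ (J + 1) (fun y => √(f y)) x|
        ≤ A * ((k : ℝ) / (m + 1 : ℕ)) ^ (1 / (d : ℝ)) := by
  have := hX.isProbabilityMeasure
  obtain ⟨π, hπ⟩ := h.exists_retraction
  obtain ⟨D, hD0, hD⟩ := h.exists_dist_le
  obtain ⟨A, hA0, hA⟩ := exists_bias_le hd h hπ hD0 hD
  obtain ⟨a, ha0, ha⟩ := h.bounded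
  set B := (2 * ρ + 1) ^ d * (2 ^ (J + 1)) ^ d * M ^ 2 with hB
  have hB0 : 0 ≤ B := by positivity
  set L := B * √a * volume.real C with hL
  have hL0 : 0 ≤ L := by positivity
  refine ⟨2 * (A * B) + L, by positivity, fun m k hk hkm x => ?_⟩
  obtain ⟨w, hw, hwB, hww⟩ := exists_measurable_abs_le_ae_eq
    (hφ.kernel_aestronglyMeasurable (J + 1) x) (hφ.abs_kernel_le hρ (J + 1) x)
  simp only [sqrtEstimator_eq hφ]
  rw [(hX.moments_knnSum h hπ hD hww ⟨hw, _, hwB⟩ hk hkm _).2.1, kernelOp_eq_setIntegral h hww]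
  have hbias := hA m k hk hkm w hw B hwB
  set S := ∫ x, knnSum k w (fun j => π (x j))
    ∂(Measure.pi fun _ : Fin (m + 1) => densityMeasure f)
  set I := ∫ y in C, w y * √(f y) with hI
  have hwf : ∀ y ∈ C, ‖w y * √(f y)‖ ≤ B * √a := fun y _ => by
    rw [Real.norm_eq_abs, abs_mul, abs_of_nonneg (Real.sqrt_nonneg _)]
    exact mul_le_mul (hwB y) (Real.sqrt_le_sqrt (ha y)) (Real.sqrt_nonneg _) hB0
  have hIL : |I| ≤ L := norm_setIntegral_le_of_norm_le_const h.compact.measure_lt_top hwf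
  push_cast
  set n : ℝ := (m : ℝ) + 1 with hn
  have hn0 : 0 < n := by positivity
  have hk0 : (0 : ℝ) < k := Nat.cast_pos.2 hk
  have hkn : (k : ℝ) / n ≤ 1 := by
    rw [div_le_one hn0, hn]
    exact_mod_cast hkm.trans (Nat.le_succ m)
  set t := ((k : ℝ) / n) ^ (1 / (d : ℝ)) with ht
  have ht0 : 0 ≤ t := by positivity
  -- The normalisation error 1/n is absorbed, because k/n ≤ 1 and 1/d ≤ 1.
  have hnt : 1 / n ≤ t := by
    calc 1 / n ≤ k / n := by gcongr; exact_mod_cast hk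
      _ = ((k : ℝ) / n) ^ (1 : ℝ) := (Real.rpow_one _).symm
      _ ≤ t := by
          refine Real.rpow_le_rpow_of_exponent_ge (by positivity) hkn ?_
          rw [div_le_one (Nat.cast_pos.2 hd)]
          exact_mod_cast hd
  have hgr : gammaRatio (m + 1) = gammaRatio k * betaMoment m k (1 / 2) :=
    (gammaRatio_mul_betaMoment m hk).symm
  have hr1 := one_le_sqrt_mul_gammaRatio (Nat.le_add_left 1 m)
  have hr2 := sqrt_mul_gammaRatio_le (Nat.le_add_left 1 m)
  push_cast at hr1 hr2
  rw [← hn] at hr1 hr2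
  set c := gammaRatio k * (1 / √n) with hc
  have hc0 : 0 ≤ c := mul_nonneg (gammaRatio_pos hk).le (by positivity)
  have hcn : c * n = gammaRatio k * √n := by
    rw [hc, mul_assoc, one_div_mul_eq_div, Real.div_sqrt]
  -- The prefactor gains √n and the half power of k/n gives it back, leaving √k Γ(k)/Γ(k+1/2),
  -- bounded uniformly in `k`.
  have hck : c * n * ((k : ℝ) / n) ^ (1 / 2 : ℝ) ≤ 2 := by
    rw [hcn, ← Real.sqrt_eq_rpow, mul_assoc, ← Real.sqrt_mul hn0.le, mul_div_cancel₀ _ hn0.ne',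
      mul_comm]
    exact sqrt_mul_gammaRatio_le_two hk
  have hcb : c * n * betaMoment m k (1 / 2) = √n * gammaRatio (m + 1) := by
    rw [hcn, hgr]; ring
  calc |c * S - I| = |c * (S - n * (betaMoment m k (1 / 2) * I))
        + (√n * gammaRatio (m + 1) - 1) * I| := by
        rw [← hcb]; congr 1; ring
    _ ≤ c * |S - n * (betaMoment m k (1 / 2) * I)| + (√n * gammaRatio (m + 1) - 1) * |I| := by
        refine (abs_add_le _ _).trans (le_of_eq ?_)
        rw [abs_mul c, abs_mul _ I, abs_of_nonneg hc0, abs_of_nonneg (sub_nonneg.2 hr1)]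
    _ ≤ c * (n * (A * B * ((k : ℝ) / n) ^ (1 / 2 + 1 / (d : ℝ)))) + 1 / n * L := by
        gcongr
        linarith
    _ = (c * n * ((k : ℝ) / n) ^ (1 / 2 : ℝ)) * (A * B * t) + 1 / n * L := by
        rw [Real.rpow_add (by positivity), ← ht]; ring
    _ ≤ 2 * (A * B * t) + t * L := by gcongr
    _ = _ := by ring

theorem exists_variance_sqrtEstimator_le {γ : ℕ}
    (hγ : ∀ m k : ℕ, 1 ≤ k → k ≤ m → ∀ (x : Fin (m + 1) → E d) (p : E d),
      (Finset.univ.filter fun i => dist p (x i) < knnDist k x i).card ≤ γ * k)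
    (hd : 0 < d) (hX : SampleAssumption P X f) (h : DensityAssumption f C)
    (hφ : IsWindow φ ρ M) (hρ : 0 ≤ ρ) {J : ℕ} (hb : IsONB (waveletFamily (J + 1) φ ψ)) :
    ∃ K : ℝ, 0 ≤ K ∧ ∀ m k : ℕ, 1 ≤ k → k ≤ m → ∀ x,
      (Real.Gamma ((k : ℝ) + 1 / 2) / Real.Gamma (k : ℝ)) ^ 2 * (((m + 1 + 1 : ℕ) : ℝ) / (k : ℝ) ^ 3)
          * variance (fun ω => sqrtEstimator φ J k (sample X (m + 1 + 1) ω) x) P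
        ≤ 3 * (1 + γ) * (1 + K * ((k : ℝ) / (m + 1)) ^ (1 / (d : ℝ)))
          * ∫ y, kernel φ (J + 1) x y ^ 2 := by
  have := hX.isProbabilityMeasure
  obtain ⟨π, hπ⟩ := h.exists_retraction
  obtain ⟨D, hD0, hD⟩ := h.exists_dist_le
  obtain ⟨K, hK0, hK⟩ := exists_variance_le hγ hd h hπ hD0 hD
  set B := (2 * ρ + 1) ^ d * (2 ^ (J + 1)) ^ d * M ^ 2 with hB
  have hB0 : 0 ≤ B := by positivity
  refine ⟨K * B, by positivity, fun m k hk hkm x => ?_⟩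
  set W := ∫ y, kernel φ (J + 1) x y ^ 2 with hW
  have hW0 : 0 ≤ W := integral_nonneg fun _ => sq_nonneg _
  -- The bound √(B W) makes the squared supremum of the weight proportional to `W`, so the whole
  -- estimate is a multiple of `W`.
  obtain ⟨w, hw, hwB, hww⟩ := exists_measurable_abs_le_ae_eq
    (hφ.kernel_aestronglyMeasurable (J + 1) x) (B := √(B * W))
    fun y => Real.abs_le_sqrt (kernel_sq_le_integral hb hφ hρ x y)
  simp only [sqrtEstimator_eq hφ]
  rw [(hX.moments_knnSum h hπ hD hww ⟨hw, _, hwB⟩ hk (hkm.trans (Nat.le_succ m)) _).2.2]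
  have hvar := hK m k hk hkm w hw _ hwB
  rw [Real.sq_sqrt (by positivity)] at hvar
  have hCW : ∫ y in C, w y ^ 2 ≤ W := by
    have hae : (fun y => w y ^ 2) =ᵐ[volume] fun y => kernel φ (J + 1) x y ^ 2 := by
      filter_upwards [hww] with y hy
      rw [hy]
    rw [hW, ← integral_congr_ae hae]
    exact setIntegral_le_integral (((hφ.kernel_window hρ (J + 1) x).memLp 2).integrable_sq.congr
      hae.symm) (ae_of_all _ fun _ => sq_nonneg _)
  set V := (∫ x, knnSum k w (fun j => π (x j)) ^ 2
      ∂(Measure.pi fun _ : Fin (m + 1 + 1) => densityMeasure f))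
    - (∫ x, knnSum k w (fun j => π (x j))
      ∂(Measure.pi fun _ : Fin (m + 1 + 1) => densityMeasure f)) ^ 2
  have hk0 : (0 : ℝ) < k := Nat.cast_pos.2 hk
  have hn0 : (0 : ℝ) < (m + 1 + 1 : ℕ) := by positivity
  have hg0 := gammaRatio_pos hk
  have hinv : Real.Gamma ((k : ℝ) + 1 / 2) / Real.Gamma (k : ℝ) = (gammaRatio k)⁻¹ := by
    rw [gammaRatio, inv_div]
  calc _ = V / (k : ℝ) ^ 3 := by
        rw [hinv, mul_pow, div_pow, Real.sq_sqrt hn0.le]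
        field_simp
    _ ≤ 3 * (1 + γ) * ((∫ y in C, w y ^ 2)
          + K * (B * W) * ((k : ℝ) / (m + 1)) ^ (1 / (d : ℝ))) := by
        rw [div_le_iff₀ (by positivity)]
        linarith
    _ ≤ 3 * (1 + γ) * (W + K * (B * W) * ((k : ℝ) / (m + 1)) ^ (1 / (d : ℝ))) := by gcongr
    _ = _ := by ring

end Moments

/-! ### Growth of the number of neighbours -/

section Growth

variable {k : ℕ → ℕ}

/-- Since Γ(k)/Γ(k+1/2) ≥ k^(-1/2), the growth hypothesis dominates `k` itself. -/
lemma tendsto_div_sqrt (hk : ∀ n, 1 ≤ k n)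
    (ho : (fun n : ℕ => (k n : ℝ) ^ (3 / 2 : ℝ) * gammaRatio (k n))
      =o[atTop] (fun n : ℕ => √(n : ℝ))) :
    Tendsto (fun n : ℕ => (k n : ℝ) / √(n : ℝ)) atTop (𝓝 0) := by
  refine squeeze_zero (fun n => by positivity) (fun n => ?_) ho.tendsto_div_nhds_zero
  have hk0 : (0 : ℝ) < k n := Nat.cast_pos.2 (hk n)
  gcongr
  calc (k n : ℝ) = k n * 1 := (mul_one _).symm
    _ ≤ k n * (√(k n : ℝ) * gammaRatio (k n)) := by
        gcongr
        exact one_le_sqrt_mul_gammaRatio (hk n)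
    _ = (k n : ℝ) ^ (3 / 2 : ℝ) * gammaRatio (k n) := by
        rw [Real.sqrt_eq_rpow, show (3 / 2 : ℝ) = 1 + 1 / 2 by norm_num, Real.rpow_add hk0,
          Real.rpow_one]
        ring

lemma tendsto_div_of_tendsto_div_sqrt
    (hk : Tendsto (fun n : ℕ => (k n : ℝ) / √(n : ℝ)) atTop (𝓝 0)) :
    Tendsto (fun n : ℕ => (k n : ℝ) / n) atTop (𝓝 0) := by
  refine squeeze_zero' (Eventually.of_forall fun n => by positivity) ?_ hk
  filter_upwards [eventually_ge_atTop 1] with n hn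
  have hn1 : (1 : ℝ) ≤ n := Nat.one_le_cast.2 hn
  have h0 : (0 : ℝ) < √n := Real.sqrt_pos.2 (by linarith)
  gcongr
  exact Real.sqrt_le_iff.2 ⟨by linarith, by nlinarith⟩

lemma eventually_add_two_le (hk : Tendsto (fun n : ℕ => (k n : ℝ) / n) atTop (𝓝 0)) :
    ∀ᶠ n in atTop, k n + 2 ≤ n := by
  filter_upwards [hk.eventually_lt_const (show (0 : ℝ) < 1 / 2 by norm_num),
    eventually_ge_atTop 4] with n hn hn4
  have h4 : (4 : ℝ) ≤ n := by exact_mod_cast hn4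
  rw [div_lt_iff₀ (by linarith)] at hn
  have : (k n : ℝ) + 2 ≤ n := by linarith
  exact_mod_cast this

lemma tendsto_rpow_one_div {d : ℕ} (hd : 0 < d) {u : ℕ → ℝ} (hu : Tendsto u atTop (𝓝 0)) :
    Tendsto (fun n => u n ^ (1 / (d : ℝ))) atTop (𝓝 0) := by
  have hd0 : 0 < 1 / (d : ℝ) := by positivity
  have h1 := hu.rpow_const (p := 1 / (d : ℝ)) (Or.inr hd0.le)
  rwa [Real.zero_rpow hd0.ne'] at h1

end Growth

/-- Chebyshev's inequality for a sequence with converging means and vanishing variances. -/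
lemma tendsto_measure_le_abs_sub {Ω : Type*} [MeasurableSpace Ω] {P : Measure Ω}
    [IsProbabilityMeasure P] {Y : ℕ → Ω → ℝ} {a : ℝ} (hY : ∀ᶠ n in atTop, MemLp (Y n) 2 P)
    (hmean : Tendsto (fun n => ∫ ω, Y n ω ∂P) atTop (𝓝 a))
    (hvar : Tendsto (fun n => variance (Y n) P) atTop (𝓝 0)) {ε : ℝ} (hε : 0 < ε) :
    Tendsto (fun n => P {ω | ε ≤ |Y n ω - a|}) atTop (𝓝 0) := by
  have h1 : Tendsto (fun n => ENNReal.ofReal (variance (Y n) P / (ε / 2) ^ 2)) atTop (𝓝 0) := by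
    simpa using ENNReal.tendsto_ofReal (hvar.div_const ((ε / 2) ^ 2))
  refine tendsto_of_tendsto_of_tendsto_of_le_of_le' tendsto_const_nhds h1
    (Eventually.of_forall fun _ => zero_le) ?_
  filter_upwards [hY, Metric.tendsto_nhds.1 hmean (ε / 2) (by positivity)] with n hn hm
  refine (measure_mono fun ω hω => ?_).trans (meas_ge_le_variance_div_sq hn (half_pos hε))
  rw [Real.dist_eq] at hm
  have h2 : |Y n ω - a| ≤ |Y n ω - ∫ ω, Y n ω ∂P| + |(∫ ω, Y n ω ∂P) - a| := abs_sub_le _ _ _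
  have h3 : ε ≤ |Y n ω - a| := hω
  show ε / 2 ≤ _
  linarith

/-- The frontier of a convex set is null and √f is continuous at interior points of `C`. The jump of
`f` at the boundary thus affects only a null set. -/
lemma ae_tendsto_kernelOp_sqrt {d j₀ : ℕ} {f φ : E d → ℝ} {ψ : Q d → E d → ℝ} {C : Set (E d)}
    {ρ M : ℝ} (h : DensityAssumption f C) (hb : IsONB (waveletFamily j₀ φ ψ))
    (hφ : IsWindow φ ρ M) (hρ : 0 ≤ ρ) (hψ : ∀ q, IsWindow (ψ q) ρ M) :
    ∀ᵐ x : E d, x ∈ C →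
      Tendsto (fun j => kernelOp φ j (fun y => √(f y)) x) atTop (𝓝 √(f x)) := by
  obtain ⟨a, -, ha⟩ := h.bounded
  have hfr : ∀ᵐ x : E d, x ∉ frontier C :=
    measure_eq_zero_iff_ae_notMem.1 (h.convex.addHaar_frontier volume)
  filter_upwards [ae_forall_kernelOp_one_eq hb hφ hρ hψ, hfr] with x hx hxC hC
  have hint : C ∈ 𝓝 x := by
    rw [← mem_interior_iff_mem_nhds, ← self_sdiff_frontier]
    exact ⟨hC, hxC⟩
  refine tendsto_kernelOp hφ hρ (b := √a) h.measurable.sqrt.aestronglyMeasurable (fun y => ?_)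
    (h.differentiable.differentiableAt hint).continuousAt.sqrt hx
  rw [abs_of_nonneg (Real.sqrt_nonneg _)]
  exact Real.sqrt_le_sqrt (ha y)

/-! ### Large samples -/

section Asymptotics

variable {d : ℕ} {f φ : E d → ℝ} {ψ : Q d → E d → ℝ} {C : Set (E d)} {ρ M : ℝ}
  {Ω : Type*} [MeasurableSpace Ω] {P : Measure Ω} [IsProbabilityMeasure P] {X : ℕ → Ω → E d}
  {k : ℕ → ℕ}

lemma eventually_memLp_sqrtEstimator (hX : SampleAssumption P X f) (h : DensityAssumption f C)
    (hφ : IsWindow φ ρ M) (hρ : 0 ≤ ρ) (J : ℕ) (hk : ∀ n, 1 ≤ k n)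
    (hkn : ∀ᶠ n in atTop, k n + 2 ≤ n) : ∀ᶠ n in atTop, ∀ x,
      MemLp (fun ω => sqrtEstimator φ J (k n) (sample X n ω) x) 2 P := by
  filter_upwards [hkn] with n hn x
  obtain ⟨m, rfl⟩ : ∃ m, n = m + 1 := ⟨n - 1, by omega⟩
  exact memLp_sqrtEstimator hX h hφ hρ J (hk _) (by omega) x

lemma exists_eventually_bias_le (hd : 0 < d) (hX : SampleAssumption P X f)
    (h : DensityAssumption f C) (hφ : IsWindow φ ρ M) (hρ : 0 ≤ ρ) (J : ℕ) (hk : ∀ n, 1 ≤ k n)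
    (hkn : ∀ᶠ n in atTop, k n + 2 ≤ n) :
    ∃ A : ℝ, ∀ᶠ n in atTop, ∀ x,
      |(∫ ω, sqrtEstimator φ J (k n) (sample X n ω) x ∂P)
          - kernelOp φ (J + 1) (fun y => √(f y)) x|
        ≤ A * ((k n : ℝ) / n) ^ (1 / (d : ℝ)) := by
  obtain ⟨A, -, hA⟩ := exists_bias_sqrtEstimator_le hd hX h hφ hρ J
  refine ⟨A, ?_⟩
  filter_upwards [hkn] with n hn x
  obtain ⟨m, rfl⟩ : ∃ m, n = m + 1 := ⟨n - 1, by omega⟩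
  exact hA m _ (hk _) (by omega) x

/-- The relative error in the finite-sample bound is eventually at most 1, uniformly in `x`; this
doubles 3 to 6 and leaves no remainder. -/
lemma eventually_variance_le {γ : ℕ}
    (hγ : ∀ m k : ℕ, 1 ≤ k → k ≤ m → ∀ (x : Fin (m + 1) → E d) (p : E d),
      (Finset.univ.filter fun i => dist p (x i) < knnDist k x i).card ≤ γ * k)
    (hd : 0 < d) (hX : SampleAssumption P X f) (h : DensityAssumption f C)
    (hφ : IsWindow φ ρ M) (hρ : 0 ≤ ρ) {J : ℕ} (hb : IsONB (waveletFamily (J + 1) φ ψ))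
    (hk : ∀ n, 1 ≤ k n) (hkn : Tendsto (fun n : ℕ => (k n : ℝ) / n) atTop (𝓝 0)) :
    ∀ᶠ n : ℕ in atTop, ∀ x,
      (Real.Gamma ((k n : ℝ) + 1 / 2) / Real.Gamma (k n : ℝ)) ^ 2 * ((n : ℝ) / (k n : ℝ) ^ 3)
          * variance (fun ω => sqrtEstimator φ J (k n) (sample X n ω) x) P
        ≤ 6 * (1 + γ) * ∫ y, kernel φ (J + 1) x y ^ 2 := by
  obtain ⟨K, hK0, hK⟩ := exists_variance_sqrtEstimator_le hγ hd hX h hφ hρ hb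
  have h1 : Tendsto (fun n : ℕ => K * (2 * ((k n : ℝ) / n)) ^ (1 / (d : ℝ))) atTop (𝓝 0) := by
    have h2 : Tendsto (fun n : ℕ => 2 * ((k n : ℝ) / n)) atTop (𝓝 0) := by
      simpa using hkn.const_mul 2
    simpa using (tendsto_rpow_one_div hd h2).const_mul K
  filter_upwards [eventually_add_two_le hkn, h1.eventually_lt_const one_pos] with n hn hn1 x
  obtain ⟨m, rfl⟩ : ∃ m, n = m + 1 + 1 := ⟨n - 2, by omega⟩
  refine (hK m _ (hk _) (by omega) x).trans ?_
  have h2 : ((k (m + 1 + 1) : ℝ) / (m + 1)) ≤ 2 * ((k (m + 1 + 1) : ℝ) / (m + 1 + 1 : ℕ)) := by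
    rw [← mul_div_assoc, div_le_div_iff₀ (by positivity) (by positivity)]
    push_cast
    have : (0 : ℝ) ≤ k (m + 1 + 1) * m := by positivity
    nlinarith
  have h3 : K * ((k (m + 1 + 1) : ℝ) / (m + 1)) ^ (1 / (d : ℝ)) ≤ 1 :=
    (mul_le_mul_of_nonneg_left (Real.rpow_le_rpow (by positivity) h2 (by positivity)) hK0).trans
      hn1.le
  have hW : 0 ≤ ∫ y, kernel φ (J + 1) x y ^ 2 := integral_nonneg fun _ => sq_nonneg _
  calc _ ≤ 3 * (1 + (γ : ℝ)) * (1 + 1) * ∫ y, kernel φ (J + 1) x y ^ 2 := by gcongr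
    _ = _ := by ring

/-- Consistency of the estimator at a fixed resolution level. -/
lemma tendsto_measure_sqrtEstimator {γ : ℕ}
    (hγ : ∀ m k : ℕ, 1 ≤ k → k ≤ m → ∀ (x : Fin (m + 1) → E d) (p : E d),
      (Finset.univ.filter fun i => dist p (x i) < knnDist k x i).card ≤ γ * k)
    (hd : 0 < d) (hX : SampleAssumption P X f) (h : DensityAssumption f C)
    (hφ : IsWindow φ ρ M) (hρ : 0 ≤ ρ) {J : ℕ} (hb : IsONB (waveletFamily (J + 1) φ ψ))
    (hk : ∀ n, 1 ≤ k n)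
    (ho : (fun n : ℕ => (k n : ℝ) ^ (3 / 2 : ℝ) * gammaRatio (k n))
      =o[atTop] (fun n : ℕ => √(n : ℝ))) (x : E d) {ε : ℝ} (hε : 0 < ε) :
    Tendsto (fun n => P {ω | ε ≤ |sqrtEstimator φ J (k n) (sample X n ω) x
      - kernelOp φ (J + 1) (fun y => √(f y)) x|}) atTop (𝓝 0) := by
  have hkn := tendsto_div_of_tendsto_div_sqrt (tendsto_div_sqrt hk ho)
  have hk2 := eventually_add_two_le hkn
  refine tendsto_measure_le_abs_sub ?_ ?_ ?_ hε
  · filter_upwards [eventually_memLp_sqrtEstimator hX h hφ hρ J hk hk2] with n hn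
    exact hn x
  · obtain ⟨A, hA⟩ := exists_eventually_bias_le hd hX h hφ hρ J hk hk2
    rw [tendsto_iff_norm_sub_tendsto_zero]
    refine squeeze_zero' (Eventually.of_forall fun _ => norm_nonneg _)
      (by filter_upwards [hA] with n hn using hn x)
      (by simpa using (tendsto_rpow_one_div hd hkn).const_mul A)
  · set W := ∫ y, kernel φ (J + 1) x y ^ 2
    have h1 := ((ho.tendsto_div_nhds_zero).pow 2).const_mul (6 * (1 + (γ : ℝ)) * W)
    rw [zero_pow two_ne_zero, mul_zero] at h1
    refine squeeze_zero' (Eventually.of_forall fun _ => variance_nonneg _ _) ?_ h1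
    filter_upwards [eventually_variance_le hγ hd hX h hφ hρ hb hk hkn, hk2] with n hn hn2
    have hk0 : (0 : ℝ) < k n := Nat.cast_pos.2 (hk n)
    have hn0 : (0 : ℝ) < n := Nat.cast_pos.2 (by omega)
    have hg := gammaRatio_pos (hk n)
    have hinv : Real.Gamma ((k n : ℝ) + 1 / 2) / Real.Gamma (k n : ℝ) = (gammaRatio (k n))⁻¹ := by
      rw [gammaRatio, inv_div]
    have h2 := hn x
    rw [hinv] at h2
    -- The square of the quotient in the growth condition is exactly the factor multiplying ∫ K² in
    -- the variance bound.
    have h3 : ((k n : ℝ) ^ (3 / 2 : ℝ) * gammaRatio (k n) / √(n : ℝ)) ^ 2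
        = gammaRatio (k n) ^ 2 * (k n : ℝ) ^ 3 / n := by
      rw [div_pow, mul_pow, Real.sq_sqrt hn0.le, ← Real.rpow_mul_natCast hk0.le]
      norm_num
      ring
    rw [h3]
    refine le_trans (le_of_eq ?_) (mul_le_mul_of_nonneg_right h2 (by positivity))
    field_simp

end Asymptotics

end WaveletKNN

end

/-! ### The proposition -/

theorem mainTheorem5 (d : ℕ) (hd : 0 < d) :
    -- the constant in the variance bound depends on the dimension only
    ∃ κ : ℝ, ∀ (j₀ : ℕ) (φ : WaveletKNN.E d → ℝ) (ψ : WaveletKNN.Q d → WaveletKNN.E d → ℝ)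
      (f : WaveletKNN.E d → ℝ) (C : Set (WaveletKNN.E d))
      (Ω : Type*) [MeasurableSpace Ω] (P : Measure Ω) [IsProbabilityMeasure P]
      (X : ℕ → Ω → WaveletKNN.E d),
      WaveletKNN.SampleAssumption P X f →
      WaveletKNN.WaveletAssumption j₀ φ ψ →
      WaveletKNN.DensityAssumption f C →
      -- the two forms of the estimator coincide
      (∀ J : ℕ, j₀ ≤ J → ∀ᵐ x : WaveletKNN.E d, ∀ᵐ ω ∂P, ∀ n k : ℕ,
        WaveletKNN.sqrtEstimatorMultiscale j₀ φ ψ J k (WaveletKNN.sample X n ω) x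
          = WaveletKNN.sqrtEstimator φ J k (WaveletKNN.sample X n ω) x) ∧
      ∀ k : ℕ → ℕ, (∀ n, 1 ≤ k n) →
        (fun n : ℕ => (k n : ℝ) ^ (3 / 2 : ℝ) * WaveletKNN.gammaRatio (k n))
          =o[atTop] (fun n : ℕ => √(n : ℝ)) →
        (∀ J : ℕ, j₀ ≤ J →
          -- the estimator has finite second moment
          (∀ᶠ n : ℕ in atTop, ∀ x ∈ C, MemLp (fun ω =>
            WaveletKNN.sqrtEstimator φ J (k n) (WaveletKNN.sample X n ω) x) 2 P) ∧
          -- expectation, uniformly on `C`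
          (∃ A : ℝ, ∀ᶠ n : ℕ in atTop, ∀ x ∈ C,
            |(∫ ω, WaveletKNN.sqrtEstimator φ J (k n) (WaveletKNN.sample X n ω) x ∂P)
                - WaveletKNN.kernelOp φ (J + 1) (fun y => √(f y)) x|
              ≤ A * ((k n : ℝ) / (n : ℝ)) ^ (1 / (d : ℝ))) ∧
          -- variance, uniformly on `C`
          (∃ B : ℝ, ∀ᶠ n : ℕ in atTop, ∀ x ∈ C,
            (Real.Gamma ((k n : ℝ) + 1 / 2) / Real.Gamma (k n : ℝ)) ^ 2
                * ((n : ℝ) / (k n : ℝ) ^ 3)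
                * variance (fun ω =>
                    WaveletKNN.sqrtEstimator φ J (k n) (WaveletKNN.sample X n ω) x) P
              ≤ κ * (∫ y, WaveletKNN.kernel φ (J + 1) x y ^ 2)
                + B * (n : ℝ) ^ (-(1 / (d : ℝ)))) ∧
          -- pointwise consistency at a fixed resolution level
          (∀ x ∈ C, TendstoInMeasure P
            (fun (n : ℕ) ω => WaveletKNN.sqrtEstimator φ J (k n) (WaveletKNN.sample X n ω) x)
            atTop (fun _ => WaveletKNN.kernelOp φ (J + 1) (fun y => √(f y)) x))) ∧
        -- pointwise consistency for `√f`, as `n` and then the resolution level tend to infinity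
        (∀ᵐ x : WaveletKNN.E d, x ∈ C → ∀ ε : ℝ, 0 < ε → ∃ J₀ : ℕ, ∀ J : ℕ, J₀ ≤ J →
          Tendsto (fun n : ℕ => P {ω | ε ≤
            |WaveletKNN.sqrtEstimator φ J (k n) (WaveletKNN.sample X n ω) x - √(f x)|})
            atTop (𝓝 0)) := by
  obtain ⟨γ, hγ⟩ := WaveletKNN.exists_card_lt_knnDist_le d
  refine ⟨6 * (1 + γ), fun j₀ φ ψ f C Ω _ P _ X hX hW h => ?_⟩
  obtain ⟨ρ, M, hρ, hφ, hψ⟩ := hW.exists_windows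
  have hb := hW.isONB
  have hbJ : ∀ J, j₀ ≤ J → WaveletKNN.IsONB (WaveletKNN.waveletFamily (J + 1) φ ψ) := by
    intro J hJ
    have := hb.add (J + 1 - j₀)
    rwa [Nat.add_sub_cancel' (by omega)] at this
  refine ⟨fun J hJ => WaveletKNN.ae_sqrtEstimatorMultiscale_eq hb hφ hψ hX.measurable
    hX.law_absolutelyContinuous hJ, fun k hk ho => ?_⟩
  have hkn := WaveletKNN.tendsto_div_of_tendsto_div_sqrt (WaveletKNN.tendsto_div_sqrt hk ho)
  have hk2 := WaveletKNN.eventually_add_two_le hkn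
  -- The remainder in the variance bound may be taken to be 0.
  refine ⟨fun J hJ => ⟨?_, ?_, ⟨0, ?_⟩, fun x _ => ?_⟩, ?_⟩
  · filter_upwards [WaveletKNN.eventually_memLp_sqrtEstimator hX h hφ hρ J hk hk2] with n hn x _
    exact hn x
  · obtain ⟨A, hA⟩ := WaveletKNN.exists_eventually_bias_le hd hX h hφ hρ J hk hk2
    refine ⟨A, ?_⟩
    filter_upwards [hA] with n hn x _
    exact hn x
  · filter_upwards [WaveletKNN.eventually_variance_le hγ hd hX h hφ hρ (hbJ J hJ) hk hkn]
      with n hn x _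
    simpa using hn x
  · rw [tendstoInMeasure_iff_norm]
    exact fun ε hε =>
      WaveletKNN.tendsto_measure_sqrtEstimator hγ hd hX h hφ hρ (hbJ J hJ) hk ho x hε
  · filter_upwards [WaveletKNN.ae_tendsto_kernelOp_sqrt h hb hφ hρ hψ] with x hx hC ε hε
    -- Half of ε is spent on the distance of K_{J+1} √f from √f, the other half on the deviation of
    -- the estimator at the fixed level.
    obtain ⟨J₁, hJ₁⟩ := Metric.tendsto_atTop.1 (hx hC) (ε / 2) (by positivity)
    refine ⟨max j₀ J₁, fun J hJ => ?_⟩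
    have hJ0 : j₀ ≤ J := (le_max_left _ _).trans hJ
    refine tendsto_of_tendsto_of_tendsto_of_le_of_le tendsto_const_nhds
      (WaveletKNN.tendsto_measure_sqrtEstimator hγ hd hX h hφ hρ (hbJ J hJ0) hk ho x
        (half_pos hε)) (fun _ => zero_le) fun n => measure_mono fun ω hω => ?_
    have h1 := hJ₁ (J + 1) (((le_max_right _ _).trans hJ).trans (Nat.le_succ J))
    rw [Real.dist_eq] at h1
    have h2 : ε ≤ |WaveletKNN.sqrtEstimator φ J (k n) (WaveletKNN.sample X n ω) x - √(f x)| := hω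
    have h3 := abs_sub_le (WaveletKNN.sqrtEstimator φ J (k n) (WaveletKNN.sample X n ω) x)
      (WaveletKNN.kernelOp φ (J + 1) (fun y => √(f y)) x) √(f x)
    show ε / 2 ≤ _
    linarith
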